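/- Let $\Sigma$ be a set of $\sigma$ terminal letters and $\mathcal X$ a set of variables. A pattern $\alpha$ is a nonempty string over $\Sigma\cup\mathcal X$. A substitution $h$ maps variables to words in $\Sigma^*$, and $h(\alpha)$ is obtained from $\alpha$ by replacing every occurrence of every variable $x$ by $h(x)$. For words of equal length let $d_{\mathrm{HAM}}$ be the Hamming distance, and for a word $w\in\Sigma^*$ put $$d_{\mathrm{HAM}}(\alpha,w)=\min\{d_{\mathrm{HAM}}(h(\alpha),w) : h \text{ a substitution with } |h(\alpha)|=|w|\},$$ with value $\infty$ if there is no such $h$. The skeleton of $\alpha$ is the string obtained from $\alpha$ by deleting all terminals. The pattern $\alpha$ is $k$-local if its variables can be ordered as $x_1<\dots<x_p$ such that for every $i\in\{1,\dots,p\}$ the occurrences of $x_1,\dots,x_i$ in the skeleton form at most $k$ length-maximal factors (maximal blocks of consecutive positions). An input consists of a word $w$ with $|w|=n$ and a $k$-local pattern $\alpha$ with $1\le|\alpha|=m\le n$, over the terminals $\Sigma=\{1,\dots,\sigma\}$ with $\sigma\le n$, and with variables out of a set of $n$ variables, encoded by the integers $n+1,\dots,2n$; no marking order is given. The problem $\mathtt{MinMisMatch}_{k\mathtt{LOC}}$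 asks to compute $d_{\mathrm{HAM}}(\alpha,w)\in\mathbb N\cup\{\infty\}$. In the problem $\mathtt{MisMatch}_{k\mathtt{LOC}}$ an integer $\Delta$ with $0\le\Delta\le n$ is given in addition, and one has to decide whether $d_{\mathrm{HAM}}(\alpha,w)\le\Delta$. Theorem. For every fixed $k\ge 0$, both $\mathtt{MinMisMatch}_{k\mathtt{LOC}}$ and $\mathtt{MisMatch}_{k\mathtt{LOC}}$ can be solved in $O(n^{2k+2}m)$ time on a unit-cost RAM with words of $O(\log n)$ bits. That is, for each of the two problems there are a program of the RAM (with arithmetic and bitwise operations, comparisons and indirect addressing, each of unit cost) and constants $C$ and $c$, all depending only on $k$, such that on every input the program halts with the correct answer after at most $C\,n^{2k+2}m$ steps, and all numbers that occur in its registers and memory cells are smaller than $(n+2)^c$. -/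

import Mathlib

namespace PatternMatching

/-! ## Patterns, substitutions, Hamming distance -/

/-- Strings over terminal letters `A` (left summand) and variables `X` (right summand). -/
abbrev Pattern (A X : Type) : Type := List (A ⊕ X)

/-- The word `h(α)`: each occurrence of a variable `x` is replaced by `h x`, terminals stay. -/
def Pattern.subst {A X : Type} (h : X → List A) (α : Pattern A X) : List A :=
  α.flatMap (Sum.elim (fun a => [a]) h)

/-- The number of positions where `u` and `v` differ; only used for words of equal length. -/
def mismatches {A : Type} [DecidableEq A] (u v : List A) : ℕ :=
  ((Finset.range u.length).filter (fun i => u[i]? ≠ v[i]?)).card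

/-- The least Hamming distance between `w` and a word `h(α)` of the same length as `w`, over all
substitutions `h`. It is `⊤` if no such `h` exists. -/
noncomputable def Pattern.dist {A X : Type} [DecidableEq A] (α : Pattern A X) (w : List A) : ℕ∞ :=
  ⨅ h : {h : X → List A // (α.subst h).length = w.length}, (mismatches (α.subst h.1) w : ℕ∞)

/-! ## Locality -/

/-- The pattern with all its terminals removed. -/
def Pattern.skeleton {A X : Type} (α : Pattern A X) : List X :=
  α.filterMap Sum.getRight?

/-- Position `j` of `v` exists and carries one of the variables in `M`. -/
def IsMarked {X : Type} (v M : List X) (j : ℕ) : Prop :=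
  ∃ x ∈ M, v[j]? = some x

/-- The length-maximal factors of `v` all of whose positions are marked. The pair `(a, b)` stands
for the nonempty factor on the positions `a ≤ j < b` (counted from `0`). -/
def markedBlocks {X : Type} (v M : List X) : Set (ℕ × ℕ) :=
  {p | p.1 < p.2 ∧ p.2 ≤ v.length ∧ (∀ j, p.1 ≤ j → j < p.2 → IsMarked v M j) ∧
    (p.1 = 0 ∨ ¬ IsMarked v M (p.1 - 1)) ∧ ¬ IsMarked v M p.2}

/-- `s` is an ordering of the variables of `α`. -/
def Pattern.IsMarkingSequence {A X : Type} (α : Pattern A X) (s : List X) : Prop :=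
  s.Nodup ∧ ∀ x, x ∈ s ↔ x ∈ α.skeleton

/-- `α` is `k`-local: for some marking sequence, after each step of the marking the marked
variables form at most `k` length-maximal factors of the skeleton. -/
def Pattern.IsLocal {A X : Type} (k : ℕ) (α : Pattern A X) : Prop :=
  ∃ s : List X, α.IsMarkingSequence s ∧
    ∀ i, 1 ≤ i → i ≤ s.length → (markedBlocks α.skeleton (s.take i)).encard ≤ k

/-! ## Random access machine -/

namespace RAM

/-- Arithmetic and bitwise operations on words. -/
inductive Op
  | add | sub | mul | div | mod | and | or | xor | shl | shr

/-- Subtraction is truncated at `0`; division by `0` gives `0`. -/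
def Op.eval : Op → ℕ → ℕ → ℕ
  | .add, a, b => a + b
  | .sub, a, b => a - b
  | .mul, a, b => a * b
  | .div, a, b => a / b
  | .mod, a, b => a % b
  | .and, a, b => Nat.land a b
  | .or, a, b => Nat.lor a b
  | .xor, a, b => Nat.xor a b
  | .shl, a, b => a <<< b
  | .shr, a, b => a >>> b

/-- Instructions; `d`, `a`, `b` are register numbers and `l` is a position in the program. -/
inductive Instr
  /-- register `d` gets the constant `v` -/
  | const (d v : ℕ)
  /-- register `d` gets the result of the operation on registers `a` and `b` -/
  | arith (o : Op) (d a b : ℕ)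
  /-- register `d` gets the memory cell whose address is in register `a` -/
  | load (d a : ℕ)
  /-- the memory cell whose address is in register `a` gets register `b` -/
  | store (a b : ℕ)
  /-- jump to `l` -/
  | jump (l : ℕ)
  /-- jump to `l` if register `a` is smaller than register `b` -/
  | jumpLt (a b l : ℕ)

/-- A program is a finite list of instructions. It halts on leaving the list. -/
abbrev Program : Type := List Instr

/-- Program counter, registers and memory. -/
structure Config where
  pc : ℕ
  reg : ℕ → ℕ
  mem : ℕ → ℕ

/-- The effect of one instruction. -/
def Instr.exec : Instr → Config → Config
  | .const d v, c => { c with pc := c.pc + 1, reg := Function.update c.reg d v }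
  | .arith o d a b, c =>
      { c with pc := c.pc + 1, reg := Function.update c.reg d (o.eval (c.reg a) (c.reg b)) }
  | .load d a, c => { c with pc := c.pc + 1, reg := Function.update c.reg d (c.mem (c.reg a)) }
  | .store a b, c => { c with pc := c.pc + 1, mem := Function.update c.mem (c.reg a) (c.reg b) }
  | .jump l, c => { c with pc := l }
  | .jumpLt a b l, c => { c with pc := if c.reg a < c.reg b then l else c.pc + 1 }

/-- One step of the computation; a halted configuration does not change. -/
def step (P : Program) (c : Config) : Config :=
  match P[c.pc]? with
  | some i => i.exec c
  | none => c

/-- Started in `c`, the program `P` halts after at most `T` steps with `out` in register `0`, and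
up to then all numbers in registers and memory cells (hence all addresses) are below `B`. -/
def Outputs (P : Program) (c : Config) (T B out : ℕ) : Prop :=
  ∃ t ≤ T, P.length ≤ ((step P)^[t] c).pc ∧ ((step P)^[t] c).reg 0 = out ∧
    ∀ s ≤ t, ∀ i, ((step P)^[s] c).reg i < B ∧ ((step P)^[s] c).mem i < B

end RAM

/-! ## The two problems -/

/-- A word `w` with `|w| = n` and a nonempty pattern `α` with `|α| ≤ n`, over `σ ≤ n` terminal
letters and variables out of a set of `n` variables. -/
structure Input where
  n : ℕ
  σ : ℕ
  word : List (Fin σ)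
  pattern : Pattern (Fin σ) (Fin n)
  word_length : word.length = n
  pattern_ne_nil : pattern ≠ []
  pattern_length_le : pattern.length ≤ n
  alphabet_le : σ ≤ n

/-- The length `m` of the pattern. -/
def Input.m (I : Input) : ℕ := I.pattern.length

/-- Terminal letters are encoded by `1, …, σ` and variables by `n + 1, …, 2 n`; the word is
followed by the pattern. -/
def Input.code (I : Input) : List ℕ :=
  I.word.map (fun a => a.val + 1) ++
    I.pattern.map (Sum.elim (fun a => a.val + 1) (fun x => I.n + 1 + x.val))

/-- The initial configuration: `code` is stored in the memory from address `0` on, registers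
`0, 1, 2, 3` hold `n, m, σ, Δ`, and everything else is `0`. -/
def Input.init (I : Input) (Δ : ℕ) : RAM.Config where
  pc := 0
  reg := fun i => [I.n, I.m, I.σ, Δ].getD i 0
  mem := fun i => I.code.getD i 0

open Classical in
/-- The answer to the minimisation problem as a number: the distance, or `n + 1` if it is `⊤`
(a finite distance is at most `n`). -/
noncomputable def Input.minMisMatch (I : Input) : ℕ :=
  if I.pattern.dist I.word = ⊤ then I.n + 1 else (I.pattern.dist I.word).toNat

open Classical in
/-- The answer to the decision problem as a number: `1` for yes, `0` for no. -/
noncomputable def Input.misMatch (I : Input) (Δ : ℕ) : ℕ :=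
  if I.pattern.dist I.word ≤ Δ then 1 else 0

/-- `P` solves the minimisation problem on the `k`-local patterns, in at most `T n m` steps on
words of `O(log n)` bits. -/
def SolvesMinMisMatchLocal (k : ℕ) (P : RAM.Program) (T : ℕ → ℕ → ℕ) : Prop :=
  ∃ c : ℕ, ∀ I : Input, I.pattern.IsLocal k →
    RAM.Outputs P (I.init 0) (T I.n I.m) ((I.n + 2) ^ c) I.minMisMatch

/-- `P` solves the decision problem on the `k`-local patterns, in at most `T n m` steps on
words of `O(log n)` bits. -/
def SolvesMisMatchLocal (k : ℕ) (P : RAM.Program) (T : ℕ → ℕ → ℕ) : Prop :=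
  ∃ c : ℕ, ∀ I : Input, I.pattern.IsLocal k → ∀ Δ ≤ I.n,
    RAM.Outputs P (I.init Δ) (T I.n I.m) ((I.n + 2) ^ c) (I.misMatch Δ)

end PatternMatching

/-! Let every terminal belong to the variable before it, and leading terminals to the first
variable. If variables are marked in an order that witnesses locality, the pattern positions covered
after `i` marks form at most `k` blocks (`Input.exists_order`). All that later marks need to know
about a placement of the covered positions is where each block starts and ends in the word: at most
`2 * k` numbers up to `n`. A dynamic programme therefore keeps one cost for each stage and each of
the `(n + 2) ^ (2 * k)` codes of such boundary positions.

To pass from the covered set `S` to the set `S'` that also contains `x`, one guesses the length of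
the image of `x`, the starts of the blocks of `S'` and the ends of the blocks of `S`, which are `2 *
k + 1` numbers. All other boundaries follow by walking along the pattern, since newly covered
letters are laid one after the other. So one guess yields the old code, the new code and the starts
of the occurrences of `x` (`walk_sound`, `walk_complete`). The best image of `x` takes a most
frequent letter in each column (`wordErr_best`); for `t` occurrences of length `L` it is found in `t
* L ≤ n` rounds (`countCmd_spec`). A guess thus takes `O(n)` steps, and `m` stages with `(n + 2) ^
(2 * k + 1)` guesses each give the time bound.

Correctness has two halves of different strength. Every finite entry is the cost of some placement
of the covered positions (`Env.Sound`), and no entry exceeds the cost of a complete placement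
restricted to them (`Env.Optimal`). In the last row a feasible placement with the right code is
complete, so the halves meet (`dpCmd_spec`).

The order is found by reachability. Layer `r` holds the sets that `r` marks can produce with at most
`2 * k` changes throughout; each pair of a recorded set and a further position is tried in `O(n)`
steps, which costs the same time again. Recorded predecessors give an order (`searchCmd_spec`). For
`k = 0` there are no variables, and the pattern is compared with the word directly.

The algorithms are written in a small language whose loops have limits `(n + 2) ^ a * m ^ b`, so
that running times can be read off the nesting (`Cmd.Fits.cost_le`), and compiled
(`Cmd.comp_reach`). Sums and products are reduced modulo `M = (n + 2) ^ c`, which keeps all numbers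
below `M * M`; the specifications show that no relevant value is changed by this. -/

namespace PatternMatching

open RAM

/-! ## A structured language with statically bounded loops -/

/-- Read-only data of a run: `n`, `m`, the modulus `M` of additions and multiplications, and the
input string. -/
structure Env where
  n : ℕ
  m : ℕ
  M : ℕ
  inp : ℕ → ℕ

/-- The limit of a loop. -/
def Env.lim (E : Env) (a b : ℕ) : ℕ := (E.n + 2) ^ a * E.m ^ b

/-- Variables and arrays. -/
structure St where
  v : ℕ → ℕ
  A : Fin 16 → ℕ → ℕ

def St.setV (s : St) (x a : ℕ) : St := { s with v := Function.update s.v x a }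

def St.setA (s : St) (r : Fin 16) (i a : ℕ) : St :=
  { s with A := Function.update s.A r (Function.update (s.A r) i a) }

@[simp] theorem St.setV_v (s : St) (x a y : ℕ) :
    (s.setV x a).v y = if y = x then a else s.v y := by
  simp [St.setV, Function.update_apply]

@[simp] theorem St.setV_A (s : St) (x a : ℕ) : (s.setV x a).A = s.A := (rfl)

@[simp] theorem St.setA_v (s : St) (r : Fin 16) (i a : ℕ) : (s.setA r i a).v = s.v := (rfl)

@[simp] theorem St.setA_A (s : St) (r : Fin 16) (i a : ℕ) (r' : Fin 16) :
    (s.setA r i a).A r' = if r' = r then Function.update (s.A r) i a else s.A r' := by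
  simp only [St.setA, Function.update_apply]

inductive BOp
  | add | sub | mul | div | mod

def BOp.toOp : BOp → Op
  | .add => .add
  | .sub => .sub
  | .mul => .mul
  | .div => .div
  | .mod => .mod

/-- Only sums and products can leave the range below `M`, so only they are reduced; the other
results are at most the first operand. -/
def BOp.ev (M : ℕ) : BOp → ℕ → ℕ → ℕ
  | .add, a, b => (a + b) % M
  | .sub, a, b => a - b
  | .mul, a, b => (a * b) % M
  | .div, a, b => a / b
  | .mod, a, b => a % b

inductive Exp
  | const (v : ℕ)
  | n
  | m
  | base
  | var (x : ℕ)
  | arr (r : Fin 16) (e : Exp)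
  | inp (e : Exp)
  | bin (o : BOp) (e f : Exp)

instance : Add Exp := ⟨.bin .add⟩
instance : Sub Exp := ⟨.bin .sub⟩
instance : Mul Exp := ⟨.bin .mul⟩
instance : Div Exp := ⟨.bin .div⟩
instance : Mod Exp := ⟨.bin .mod⟩

/-- The index into the input is reduced modulo `2 * n`: the input, padded with zeros, occupies the
addresses below `2 * n`, and the arrays begin there. -/
def Exp.ev (E : Env) (s : St) : Exp → ℕ
  | .const v => v
  | .n => E.n
  | .m => E.m
  | .base => E.n + 2
  | .var x => s.v x
  | .arr r e => s.A r (e.ev E s)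
  | .inp e => E.inp (e.ev E s % (2 * E.n))
  | .bin o e f => o.ev E.M (e.ev E s) (f.ev E s)

/-- Assignments, sequences, conditionals, and loops: `loop x a b c` runs `c` for
`x = 0, 1, …` up to `(n + 2) ^ a * m ^ b - 1`. -/
inductive Cmd
  | skip
  | assign (x : ℕ) (e : Exp)
  | store (r : Fin 16) (e f : Exp)
  | seq (c d : Cmd)
  | ite (e f : Exp) (c d : Cmd)
  | loop (x a b : ℕ) (c : Cmd)

def iter (f : ℕ → St → St) (s : St) : ℕ → St
  | 0 => s
  | j + 1 => f j (iter f s j)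

def Cmd.den (E : Env) : Cmd → St → St
  | .skip, s => s
  | .assign x e, s => s.setV x (e.ev E s)
  | .store r e f, s => s.setA r (e.ev E s) (f.ev E s)
  | .seq c d, s => d.den E (c.den E s)
  | .ite e f c d, s => if e.ev E s < f.ev E s then c.den E s else d.den E s
  | .loop x a b c, s => iter (fun j s => c.den E (s.setV x j)) s (E.lim a b)

def block : List Cmd → Cmd
  | [] => .skip
  | c :: l => .seq c (block l)

def Cmd.when (e f : Exp) (c : Cmd) : Cmd := .ite e f c .skip

/-! ## Compilation -/

/-- Registers `0, 1, 2, 3` hold `n + 2`, `M`, `n`, `m`. The registers above are dealt out by residue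
modulo 3: `3 * x + 4` for the variable `x`, `3 * t + 5` for the temporary `t`, `3 * r + 6` for loop
data. Entry `i` of the array `r` has the address `2 * n + 16 * i + r`. The result is left in the
temporary `t`; `or` of a register with itself serves as a copy. -/
def Exp.comp (t : ℕ) : Exp → List Instr
  | .const v => [.const (3 * t + 5) v]
  | .n => [.arith .or (3 * t + 5) 2 2]
  | .m => [.arith .or (3 * t + 5) 3 3]
  | .base => [.arith .or (3 * t + 5) 0 0]
  | .var x => [.arith .or (3 * t + 5) (3 * x + 4) (3 * x + 4)]
  | .arr r e => e.comp t ++ [.const (3 * (t + 1) + 5) 16,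
      .arith .mul (3 * t + 5) (3 * t + 5) (3 * (t + 1) + 5), .const (3 * (t + 1) + 5) r,
      .arith .add (3 * t + 5) (3 * t + 5) (3 * (t + 1) + 5), .arith .add (3 * t + 5) (3 * t + 5) 2,
      .arith .add (3 * t + 5) (3 * t + 5) 2, .load (3 * t + 5) (3 * t + 5)]
  | .inp e => e.comp t ++ [.arith .add (3 * (t + 1) + 5) 2 2,
      .arith .mod (3 * t + 5) (3 * t + 5) (3 * (t + 1) + 5), .load (3 * t + 5) (3 * t + 5)]
  | .bin o e f => e.comp t ++ f.comp (t + 1) ++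
      [.arith o.toOp (3 * t + 5) (3 * t + 5) (3 * (t + 1) + 5),
       .arith .mod (3 * t + 5) (3 * t + 5) 1]

def compLim (r a b : ℕ) : List Instr :=
  .const r 1 :: (List.replicate a (.arith .mul r r 0) ++ List.replicate b (.arith .mul r r 3))

/-- `o` is the address of the first instruction and `d` the number of enclosing loops. A loop at
depth `d` owns the loop registers `2 * d` (counter) and `2 * d + 1` (limit); the counter is only
copied into `x`, so the body may overwrite `x`. -/
def Cmd.comp (o d : ℕ) : Cmd → List Instr
  | .skip => []
  | .assign x e => e.comp 0 ++ [.arith .or (3 * x + 4) 5 5]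
  | .store r e f => e.comp 0 ++ f.comp 1 ++ [.const 11 16, .arith .mul 5 5 11, .const 11 r,
      .arith .add 5 5 11, .arith .add 5 5 2, .arith .add 5 5 2, .store 5 8]
  | .seq c c' => c.comp o d ++ c'.comp (o + (c.comp o d).length) d
  | .ite e f c c' =>
      let p := e.comp 0 ++ f.comp 1
      let q := c'.comp (o + p.length + 1) d
      let l := o + p.length + 1 + q.length + 1
      let r := c.comp l d
      p ++ [.jumpLt 5 8 l] ++ q ++ [.jump (l + r.length)] ++ r
  | .loop x a b c =>
      let p := compLim (3 * (2 * d + 1) + 6) a b ++ [.const (3 * (2 * d) + 6) 0]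
      let l := o + p.length
      let q := c.comp (l + 3) (d + 1)
      p ++ [.jumpLt (3 * (2 * d) + 6) (3 * (2 * d + 1) + 6) (l + 2), .jump (l + 3 + q.length + 3),
        .arith .or (3 * x + 4) (3 * (2 * d) + 6) (3 * (2 * d) + 6)] ++ q ++
      [.const 5 1, .arith .add (3 * (2 * d) + 6) (3 * (2 * d) + 6) 5, .jump l]

/-- An upper bound for the running time of the compiled command. -/
def Cmd.cost (n m : ℕ) : Cmd → ℕ
  | .skip => 0
  | .assign _ e => (e.comp 0).length + 1
  | .store _ e f => (e.comp 0).length + (f.comp 1).length + 7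
  | .seq c c' => c.cost n m + c'.cost n m
  | .ite e f c c' => (e.comp 0).length + (f.comp 1).length + 2 + c.cost n m + c'.cost n m
  | .loop _ a b c => a + b + 4 + (n + 2) ^ a * m ^ b * (c.cost n m + 5)

/-- A bound for the constants and exponents in an expression or a command. -/
def Exp.maxc : Exp → ℕ
  | .const v => v
  | .arr _ e => e.maxc
  | .inp e => e.maxc
  | .bin _ e f => max e.maxc f.maxc
  | _ => 0

def Cmd.maxc : Cmd → ℕ
  | .skip => 0
  | .assign _ e => e.maxc
  | .store _ e f => max e.maxc f.maxc
  | .seq c c' => max c.maxc c'.maxc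
  | .ite e f c c' => max (max e.maxc f.maxc) (max c.maxc c'.maxc)
  | .loop _ a b c => max (a + b) c.maxc

/-! ## Correctness of the compilation -/

/-- The code stands in the program from position `o` on. -/
def At (P : Program) (o : ℕ) (l : List Instr) : Prop :=
  ∀ i (h : i < l.length), P[o + i]? = some l[i]

@[simp] theorem at_append (P : Program) (o : ℕ) (l l' : List Instr) :
    At P o (l ++ l') ↔ At P o l ∧ At P (o + l.length) l' := by
  constructor
  · intro h
    refine ⟨fun i hi => ?_, fun i hi => ?_⟩
    · rw [h i (by simp; omega), List.getElem_append_left hi]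
    · rw [add_assoc, h (l.length + i) (by simp; omega), List.getElem_append_right (by omega)]
      simp
  · rintro ⟨h, h'⟩ i hi
    by_cases hl : i < l.length
    · rw [h i hl, List.getElem_append_left hl]
    · have := h' (i - l.length) (by simp at hi; omega)
      rw [List.getElem_append_right (by omega), ← this]
      congr 1
      omega

@[simp] theorem at_cons (P : Program) (o : ℕ) (i : Instr) (l : List Instr) :
    At P o (i :: l) ↔ P[o]? = some i ∧ At P (o + 1) l := by
  rw [← List.singleton_append, at_append]
  simp [At]

def Bd (B : ℕ) (c : Config) : Prop := ∀ i, c.reg i < B ∧ c.mem i < B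

/-- The bound is required at all intermediate times, since the word size restricts every moment of a
run. -/
def Reach (P : Program) (B T : ℕ) (c c' : Config) : Prop :=
  ∃ t ≤ T, (step P)^[t] c = c' ∧ ∀ s ≤ t, Bd B ((step P)^[s] c)

namespace Reach

variable {P : Program} {B T T' : ℕ} {c c' c'' : Config}

theorem refl (h : Bd B c) : Reach P B 0 c c :=
  ⟨0, le_rfl, rfl, fun s hs => by simpa [Nat.le_zero.1 hs] using h⟩

theorem bd (h : Reach P B T c c') : Bd B c' := by
  obtain ⟨t, -, rfl, h⟩ := h
  exact h t le_rfl

theorem mono (h : Reach P B T c c') (hT : T ≤ T') : Reach P B T' c c' := by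
  obtain ⟨t, ht, h⟩ := h
  exact ⟨t, ht.trans hT, h⟩

theorem trans (h : Reach P B T c c') (h' : Reach P B T' c' c'') : Reach P B (T + T') c c'' := by
  obtain ⟨t, ht, rfl, hb⟩ := h
  obtain ⟨t', ht', rfl, hb'⟩ := h'
  refine ⟨t' + t, by omega, Function.iterate_add_apply _ _ _ _, fun s hs => ?_⟩
  by_cases hst : s ≤ t
  · exact hb s hst
  · obtain ⟨u, rfl⟩ : ∃ u, s = u + t := ⟨s - t, by omega⟩
    rw [Function.iterate_add_apply]
    exact hb' u (by omega)

theorem one {i : Instr} (hi : P[c.pc]? = some i) (hb : Bd B c) (hb' : Bd B (i.exec c)) :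
    Reach P B 1 c (i.exec c) := by
  have : step P c = i.exec c := by simp [step, hi]
  refine ⟨1, le_rfl, by simpa using this, fun s hs => ?_⟩
  interval_cases s
  · simpa using hb
  · simpa [this] using hb'

end Reach

theorem Bd.update {B : ℕ} {c : Config} (h : Bd B c) (r x pc : ℕ) (hx : x < B) :
    Bd B { c with pc := pc, reg := Function.update c.reg r x } := by
  intro i
  refine ⟨?_, (h i).2⟩
  simp only [Function.update_apply]
  split_ifs
  · exact hx
  · exact (h i).1

/-- A run of `T` steps that changes only temporary registers from number `t` on. -/
structure TReach (P : Program) (B t T : ℕ) (c c' : Config) : Prop where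
  reach : Reach P B T c c'
  pc : c'.pc = c.pc + T
  mem : c'.mem = c.mem
  reg : ∀ r, (∀ t' ≥ t, r ≠ 3 * t' + 5) → c'.reg r = c.reg r

namespace TReach

variable {P : Program} {B t T T' : ℕ} {c c' c'' : Config}

theorem trans {t' : ℕ} (h : TReach P B t T c c') (h' : TReach P B t' T' c' c'') (ht : t ≤ t') :
    TReach P B t (T + T') c c'' where
  reach := h.reach.trans h'.reach
  pc := by rw [h'.pc, h.pc, add_assoc]
  mem := by rw [h'.mem, h.mem]
  reg r hr := by rw [h'.reg r fun u hu => hr u (by omega), h.reg r hr]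

theorem one {i : Instr} {x y t' : ℕ} (hb : Bd B c) (hi : P[c.pc]? = some i)
    (he : i.exec c = { c with pc := c.pc + 1, reg := Function.update c.reg (3 * t' + 5) y })
    (hy : y = x) (hx : x < B) (ht : t ≤ t') :
    ∃ c', TReach P B t 1 c c' ∧ c'.reg (3 * t' + 5) = x ∧
      ∀ r, r ≠ 3 * t' + 5 → c'.reg r = c.reg r := by
  subst hy
  refine ⟨i.exec c, ⟨.one hi hb ?_, ?_, ?_, ?_⟩, ?_, ?_⟩ <;> rw [he]
  · exact hb.update _ _ _ hx
  · intro r hr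
    exact Function.update_of_ne (hr t' ht) _ _
  · exact Function.update_self _ _ _
  · intro r hr
    exact Function.update_of_ne hr _ _

end TReach

/-- `64 ≤ M` leaves room for addresses: `2 * n + 16 * i + r` with `i < M` stays below `64 * M ≤ M *
M`. -/
structure Env.Ok (E : Env) : Prop where
  pos : 1 ≤ E.n
  base : E.n + 2 < E.M
  big : 64 ≤ E.M
  m : E.m ≤ E.n
  m_pos : 1 ≤ E.m
  inp : ∀ i, E.inp i < E.M

def St.Bdd (M : ℕ) (s : St) : Prop := (∀ x, s.v x < M) ∧ ∀ r i, s.A r i < M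

/-- The configuration `c` represents the state `s`. -/
structure Sim (E : Env) (s : St) (c : Config) : Prop where
  r0 : c.reg 0 = E.n + 2
  r1 : c.reg 1 = E.M
  r2 : c.reg 2 = E.n
  r3 : c.reg 3 = E.m
  rv : ∀ x, c.reg (3 * x + 4) = s.v x
  mi : ∀ i < 2 * E.n, c.mem i = E.inp i
  ma : ∀ (r : Fin 16) i, c.mem (2 * E.n + 16 * i + r) = s.A r i
  bd : Bd (E.M * E.M) c

theorem Sim.tmp {E : Env} {s : St} {c c' : Config} {P : Program} {t T : ℕ} (h : Sim E s c)
    (h' : TReach P (E.M * E.M) t T c c') : Sim E s c' where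
  r0 := by rw [h'.reg _ (by omega), h.r0]
  r1 := by rw [h'.reg _ (by omega), h.r1]
  r2 := by rw [h'.reg _ (by omega), h.r2]
  r3 := by rw [h'.reg _ (by omega), h.r3]
  rv x := by rw [h'.reg _ (by omega), h.rv]
  mi := by rw [h'.mem]; exact h.mi
  ma := by rw [h'.mem]; exact h.ma
  bd := h'.reach.bd

theorem BOp.mod_eq {M : ℕ} (o : BOp) {a b : ℕ} (ha : a < M) :
    o.toOp.eval a b % M = o.ev M a b := by
  cases o <;> simp only [BOp.toOp, Op.eval, BOp.ev]
  · exact Nat.mod_eq_of_lt (by omega)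
  · exact Nat.mod_eq_of_lt ((Nat.div_le_self _ _).trans_lt ha)
  · exact Nat.mod_eq_of_lt ((Nat.mod_le _ _).trans_lt ha)

theorem BOp.raw_lt {M : ℕ} (o : BOp) {a b : ℕ} (hM : 2 ≤ M) (ha : a < M) (hb : b < M) :
    o.toOp.eval a b < M * M := by
  have h2 : 2 * M ≤ M * M := Nat.mul_le_mul_right _ hM
  cases o <;> simp only [BOp.toOp, Op.eval]
  · omega
  · omega
  · exact Nat.mul_lt_mul'' ha hb
  · have := Nat.div_le_self a b
    omega
  · have := Nat.mod_le a b
    omega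

theorem BOp.ev_lt {M : ℕ} (o : BOp) {a b : ℕ} (ha : a < M) : o.ev M a b < M := by
  rw [← o.mod_eq ha]
  exact Nat.mod_lt _ (by omega)

theorem Exp.ev_lt {E : Env} (hE : E.Ok) {s : St} (hs : s.Bdd E.M) {K : ℕ}
    (hK : ∀ v ≤ K, v < E.M) (e : Exp) (he : e.maxc ≤ K) : e.ev E s < E.M := by
  have hb := hE.base
  induction e with
  | const v => exact hK v he
  | n => simp only [Exp.ev]; omega
  | m =>
    have := hE.m
    simp only [Exp.ev]
    omega
  | base =>
    simp only [Exp.ev]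
    exact hb
  | var x => exact hs.1 x
  | arr r e ih => exact hs.2 _ _
  | inp e ih => exact hE.inp _
  | bin o e f ihe ihf =>
    simp only [Exp.maxc, max_le_iff] at he
    exact o.ev_lt (ihe he.1)

end PatternMatching

/-! ### Execution of compiled expressions -/

namespace PatternMatching

open RAM

theorem Env.Ok.lt_sq {E : Env} (hE : E.Ok) {a : ℕ} (h : a < 64 * E.M) : a < E.M * E.M :=
  h.trans_le (Nat.mul_le_mul_right _ hE.big)

theorem nat_lor_self (a : ℕ) : Nat.lor a a = a := Nat.or_self a

/-- The second operand of a binary operation uses temporaries from `t + 1` on, so the first one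
survives in the temporary `t`. Compiled expressions are straight-line code, hence their length is
the exact running time. -/
theorem Exp.comp_reach {E : Env} (hE : E.Ok) {s : St} (hs : s.Bdd E.M) {K : ℕ}
    (hK : ∀ v ≤ K, v < E.M) {P : Program} (e : Exp) (he : e.maxc ≤ K) (t o : ℕ) (c : Config)
    (hP : At P o (e.comp t)) (hc : Sim E s c) (ho : c.pc = o) :
    ∃ c', TReach P (E.M * E.M) t (e.comp t).length c c' ∧ c'.reg (3 * t + 5) = e.ev E s := by
  have hbase := hE.base
  induction e generalizing t o c with
  | const v =>
    simp only [Exp.comp, at_cons, ← ho] at hP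
    obtain ⟨c', h, hr, -⟩ := TReach.one (t := t) hc.bd hP.1 rfl rfl
      (hE.lt_sq (by have := hK v he; omega)) le_rfl
    exact ⟨c', h, hr⟩
  | n =>
    simp only [Exp.comp, at_cons, ← ho] at hP
    obtain ⟨c', h, hr, -⟩ := TReach.one (t := t) hc.bd hP.1 rfl (nat_lor_self _) (hc.bd _).1 le_rfl
    exact ⟨c', h, hr.trans hc.r2⟩
  | m =>
    simp only [Exp.comp, at_cons, ← ho] at hP
    obtain ⟨c', h, hr, -⟩ := TReach.one (t := t) hc.bd hP.1 rfl (nat_lor_self _) (hc.bd _).1 le_rfl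
    exact ⟨c', h, hr.trans hc.r3⟩
  | base =>
    simp only [Exp.comp, at_cons, ← ho] at hP
    obtain ⟨c', h, hr, -⟩ := TReach.one (t := t) hc.bd hP.1 rfl (nat_lor_self _) (hc.bd _).1 le_rfl
    exact ⟨c', h, hr.trans hc.r0⟩
  | var x =>
    simp only [Exp.comp, at_cons, ← ho] at hP
    obtain ⟨c', h, hr, -⟩ := TReach.one (t := t) hc.bd hP.1 rfl (nat_lor_self _) (hc.bd _).1 le_rfl
    exact ⟨c', h, hr.trans (hc.rv x)⟩
  | arr r e ih =>
    simp only [Exp.comp, at_append, at_cons] at hP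
    obtain ⟨hPe, h1, h2, h3, h4, h5, h6, h7, -⟩ := hP
    obtain ⟨c0, t0, v0⟩ := ih he t o c hPe hc ho
    have hv := Exp.ev_lt hE hs hK e he
    have p0 := t0.pc
    rw [ho] at p0
    rw [← p0] at h1
    obtain ⟨c1, t1, v1, k1⟩ := TReach.one (t := t) t0.reach.bd h1 rfl rfl
      (hE.lt_sq (by omega)) (Nat.le_succ _)
    have p1 := t1.pc
    rw [p0] at p1
    rw [← p1] at h2
    obtain ⟨c2, t2, v2, k2⟩ := TReach.one (t := t) (x := 16 * e.ev E s) t1.reach.bd h2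
      rfl
      (by simp only [Op.eval]; rw [v1, k1 _ (by omega), v0, mul_comm]) (hE.lt_sq (by omega)) le_rfl
    have p2 := t2.pc
    rw [p1] at p2
    rw [← p2] at h3
    obtain ⟨c3, t3, v3, k3⟩ := TReach.one (t := t) t2.reach.bd h3 rfl rfl
      (hE.lt_sq (by omega)) (Nat.le_succ _)
    have p3 := t3.pc
    rw [p2] at p3
    rw [← p3] at h4
    obtain ⟨c4, t4, v4, k4⟩ := TReach.one (t := t) (x := 16 * e.ev E s + r) t3.reach.bd h4
      rfl
      (by simp only [Op.eval]; rw [v3, k3 _ (by omega), v2]) (hE.lt_sq (by omega)) le_rfl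
    have p4 := t4.pc
    rw [p3] at p4
    rw [← p4] at h5
    have s4 := (((((hc.tmp t0).tmp t1).tmp t2).tmp t3).tmp t4)
    obtain ⟨c5, t5, v5, k5⟩ := TReach.one (t := t) (x := E.n + 16 * e.ev E s + r) t4.reach.bd h5
      rfl
      (by simp only [Op.eval, v4, s4.r2]; omega)
      (hE.lt_sq (by omega)) le_rfl
    have p5 := t5.pc
    rw [p4] at p5
    rw [← p5] at h6
    have s5 := s4.tmp t5
    obtain ⟨c6, t6, v6, k6⟩ := TReach.one (t := t) (x := 2 * E.n + 16 * e.ev E s + r)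
      t5.reach.bd h6
      rfl
      (by simp only [Op.eval, v5, s5.r2]; omega)
      (hE.lt_sq (by omega)) le_rfl
    have p6 := t6.pc
    rw [p5] at p6
    rw [← p6] at h7
    have s6 := s5.tmp t6
    obtain ⟨c7, t7, v7, k7⟩ := TReach.one (t := t) (x := s.A r (e.ev E s))
      t6.reach.bd h7
      rfl
      (by simp only [v6, s6.ma])
      (hE.lt_sq (by have := hs.2 r (e.ev E s); omega)) le_rfl
    refine ⟨c7, ?_, v7⟩
    have := ((((((t0.trans t1 le_rfl).trans t2 le_rfl).trans t3 le_rfl).trans t4 le_rfl).trans t5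
      le_rfl).trans t6 le_rfl).trans t7 le_rfl
    simpa [Exp.comp, add_assoc] using this
  | inp e ih =>
    simp only [Exp.comp, at_append, at_cons] at hP
    obtain ⟨hPe, h1, h2, h3, -⟩ := hP
    obtain ⟨c0, t0, v0⟩ := ih he t o c hPe hc ho
    have hv := Exp.ev_lt hE hs hK e he
    have p0 := t0.pc
    rw [ho] at p0
    rw [← p0] at h1
    have s0 := hc.tmp t0
    obtain ⟨c1, t1, v1, k1⟩ := TReach.one (t := t) (x := 2 * E.n) t0.reach.bd h1
      rfl
      (by simp [Op.eval, s0.r2, two_mul])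
      (hE.lt_sq (by omega)) (Nat.le_succ _)
    have p1 := t1.pc
    rw [p0] at p1
    rw [← p1] at h2
    obtain ⟨c2, t2, v2, k2⟩ := TReach.one (t := t) (x := e.ev E s % (2 * E.n)) t1.reach.bd h2
      rfl
      (by simp only [Op.eval]; rw [v1, k1 _ (by omega), v0])
      (hE.lt_sq (by have := Nat.mod_le (e.ev E s) (2 * E.n); omega)) le_rfl
    have p2 := t2.pc
    rw [p1] at p2
    rw [← p2] at h3
    have s2 := (s0.tmp t1).tmp t2
    obtain ⟨c3, t3, v3, k3⟩ := TReach.one (t := t) (x := E.inp (e.ev E s % (2 * E.n)))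
      t2.reach.bd h3 rfl
      (by rw [v2]; exact s2.mi _ (Nat.mod_lt _ (by have := hE.pos; omega)))
      (hE.lt_sq (by have := hE.inp (e.ev E s % (2 * E.n)); omega)) le_rfl
    refine ⟨c3, ?_, v3⟩
    have := ((t0.trans t1 le_rfl).trans t2 le_rfl).trans t3 le_rfl
    simpa [Exp.comp, add_assoc] using this
  | bin o' e f ihe ihf =>
    simp only [Exp.maxc, max_le_iff] at he
    simp only [Exp.comp, at_append, at_cons] at hP
    obtain ⟨⟨hPe, hPf⟩, h1, h2, -⟩ := hP
    obtain ⟨c0, t0, v0⟩ := ihe he.1 t o c hPe hc ho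
    have p0 := t0.pc
    rw [ho] at p0
    obtain ⟨c1, t1, v1⟩ := ihf he.2 (t + 1) _ c0 hPf (hc.tmp t0) p0
    have p1 := t1.pc
    rw [p0] at p1
    rw [List.length_append, ← add_assoc, ← p1] at h1
    have hv := Exp.ev_lt hE hs hK e he.1
    have hw := Exp.ev_lt hE hs hK f he.2
    have v0' : c1.reg (3 * t + 5) = e.ev E s := by rw [t1.reg _ (by omega), v0]
    obtain ⟨c2, t2, v2, k2⟩ := TReach.one (t := t) (x := o'.toOp.eval (e.ev E s) (f.ev E s))
      t1.reach.bd h1 rfl (by rw [v1, v0'])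
      (o'.raw_lt (by have := hE.big; omega) hv hw) le_rfl
    have p2 := t2.pc
    rw [p1] at p2
    rw [List.length_append, ← add_assoc, ← p2] at h2
    have s2 := ((hc.tmp t0).tmp t1).tmp t2
    obtain ⟨c3, t3, v3, k3⟩ := TReach.one (t := t) (x := o'.ev E.M (e.ev E s) (f.ev E s))
      t2.reach.bd h2 rfl (by rw [v2, s2.r1, ← o'.mod_eq hv]; rfl)
      (hE.lt_sq (by have := o'.ev_lt (b := f.ev E s) hv; omega)) le_rfl
    refine ⟨c3, ?_, v3⟩
    have := ((t0.trans t1 (Nat.le_succ _)).trans t2 le_rfl).trans t3 le_rfl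
    simpa [Exp.comp, add_assoc] using this

end PatternMatching

/-! ### Single updates of represented states, and bounds on states -/

namespace PatternMatching

open RAM

theorem Sim.pc {E : Env} {s : St} {c : Config} (h : Sim E s c) (pc : ℕ) :
    Sim E s { c with pc := pc } :=
  ⟨h.r0, h.r1, h.r2, h.r3, h.rv, h.mi, h.ma, h.bd⟩

theorem Sim.setV {E : Env} {s : St} {c : Config} (h : Sim E s c) (x pc : ℕ) {a : ℕ}
    (ha : a < E.M * E.M) :
    Sim E (s.setV x a) { c with pc := pc, reg := Function.update c.reg (3 * x + 4) a } where
  r0 := by simpa using h.r0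
  r1 := by simpa using h.r1
  r2 := by simpa using h.r2
  r3 := by
    have : 3 ≠ 3 * x + 4 := by omega
    simpa [this] using h.r3
  rv y := by
    by_cases hy : y = x
    · simp [hy]
    · have : 3 * y + 4 ≠ 3 * x + 4 := by omega
      simp [hy, h.rv]
  mi := h.mi
  ma := h.ma
  bd := h.bd.update _ _ _ ha

theorem Sim.hidden {E : Env} {s : St} {c : Config} (h : Sim E s c) (r pc : ℕ) {a : ℕ}
    (ha : a < E.M * E.M) :
    Sim E s { c with pc := pc, reg := Function.update c.reg (3 * r + 6) a } where
  r0 := by simpa using h.r0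
  r1 := by simpa using h.r1
  r2 := by simpa using h.r2
  r3 := by
    have : 3 ≠ 3 * r + 6 := by omega
    simpa [this] using h.r3
  rv y := by
    exact (Function.update_of_ne (by omega) _ _).trans (h.rv y)
  mi := h.mi
  ma := h.ma
  bd := h.bd.update _ _ _ ha

theorem Sim.setA {E : Env} {s : St} {c : Config} (h : Sim E s c) (r : Fin 16) (i pc : ℕ) {a : ℕ}
    (ha : a < E.M * E.M) :
    Sim E (s.setA r i a)
      { c with pc := pc, mem := Function.update c.mem (2 * E.n + 16 * i + r) a } where
  r0 := h.r0
  r1 := h.r1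
  r2 := h.r2
  r3 := h.r3
  rv := h.rv
  mi j hj := by
    have : j ≠ 2 * E.n + 16 * i + r := by omega
    simp [this, h.mi j hj]
  ma r' j := by
    simp only [St.setA_A, Function.update_apply]
    have := r.isLt
    have := r'.isLt
    by_cases hr : r' = r
    · subst hr
      by_cases hj : j = i
      · simp [hj]
      · have : 2 * E.n + 16 * j + (r' : ℕ) ≠ 2 * E.n + 16 * i + r' := by omega
        simp [hj, h.ma]
    · have : 2 * E.n + 16 * j + (r' : ℕ) ≠ 2 * E.n + 16 * i + r := by
        intro h
        exact hr (Fin.ext (by omega))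
      simp [hr, this, h.ma]
  bd j := by
    refine ⟨(h.bd j).1, ?_⟩
    simp only [Function.update_apply]
    split_ifs
    · exact ha
    · exact (h.bd j).2

theorem St.Bdd.setV {M : ℕ} {s : St} (h : s.Bdd M) (x : ℕ) {a : ℕ} (ha : a < M) :
    (s.setV x a).Bdd M := by
  refine ⟨fun y => ?_, h.2⟩
  simp only [St.setV_v]
  split_ifs
  · exact ha
  · exact h.1 y

theorem St.Bdd.setA {M : ℕ} {s : St} (h : s.Bdd M) (r : Fin 16) (i : ℕ) {a : ℕ} (ha : a < M) :
    (s.setA r i a).Bdd M := by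
  refine ⟨h.1, fun r' j => ?_⟩
  simp only [St.setA_A]
  split_ifs
  · simp only [Function.update_apply]
    split_ifs
    · exact ha
    · exact h.2 _ _
  · exact h.2 _ _

theorem iter_inv {f : ℕ → St → St} {s : St} {n : ℕ} (I : ℕ → St → Prop) (h0 : I 0 s)
    (h : ∀ j < n, ∀ s, I j s → I (j + 1) (f j s)) : I n (iter f s n) := by
  suffices ∀ j ≤ n, I j (iter f s j) from this n le_rfl
  intro j hj
  induction j with
  | zero => exact h0
  | succ j ih => exact h j hj _ (ih (by omega))

/-- Loop variables run up to `(n + 2) ^ (a + b)`, so `M` has to exceed this power and not only the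
constants. -/
theorem Cmd.den_bdd {E : Env} (hE : E.Ok) {K : ℕ} (hK : ∀ v ≤ K, (E.n + 2) ^ v < E.M) (c : Cmd)
    (hc : c.maxc ≤ K) {s : St} (hs : s.Bdd E.M) : (c.den E s).Bdd E.M := by
  have hK' : ∀ v ≤ K, v < E.M := fun v hv =>
    (Nat.lt_pow_self (by omega : 1 < E.n + 2)).trans (hK v hv)
  induction c generalizing s with
  | skip => exact hs
  | assign x e => exact hs.setV x (e.ev_lt hE hs hK' hc)
  | store r e f =>
    simp only [Cmd.maxc, max_le_iff] at hc
    exact hs.setA r _ (f.ev_lt hE hs hK' hc.2)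
  | seq c d ihc ihd =>
    simp only [Cmd.maxc, max_le_iff] at hc
    exact ihd hc.2 (ihc hc.1 hs)
  | ite e f c d ihc ihd =>
    simp only [Cmd.maxc, max_le_iff] at hc
    simp only [Cmd.den]
    split_ifs
    · exact ihc hc.2.1 hs
    · exact ihd hc.2.2 hs
  | loop x a b c ih =>
    simp only [Cmd.maxc, max_le_iff] at hc
    refine iter_inv (fun _ s => s.Bdd E.M) hs fun j hj s hs => ih hc.2 (hs.setV x ?_)
    refine hj.trans ((?_ : E.lim a b ≤ (E.n + 2) ^ (a + b)).trans_lt (hK _ hc.1))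
    have := hE.m
    rw [Env.lim, pow_add]
    gcongr
    omega

/-- Since `1 ≤ v`, the partial products increase, and the bound on the last one bounds them all. -/
theorem run_replicate {E : Env} {s : St} {P : Program} {r q v : ℕ}
    (hq : q < 4) (hv : 1 ≤ v) :
    ∀ (a o x : ℕ) (c : Config),
    At P o (List.replicate a (.arith .mul (3 * r + 6) (3 * r + 6) q)) → Sim E s c → c.pc = o →
    c.reg (3 * r + 6) = x → c.reg q = v → x * v ^ a < E.M * E.M →
    ∃ c', Reach P (E.M * E.M) a c c' ∧ c'.pc = o + a ∧ Sim E s c' ∧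
      c'.reg (3 * r + 6) = x * v ^ a ∧ ∀ u, u ≠ 3 * r + 6 → c'.reg u = c.reg u := by
  intro a
  induction a with
  | zero =>
    intro o x c hP hc ho hx hqv hb
    exact ⟨c, .refl hc.bd, ho, hc, by simpa using hx, fun _ _ => rfl⟩
  | succ a ih =>
    intro o x c hP hc ho hx hqv hb
    simp only [List.replicate_succ, at_cons] at hP
    have hb' : x * v * v ^ a < E.M * E.M := by rwa [pow_succ', ← mul_assoc] at hb
    have hlt : x * v < E.M * E.M :=
      (Nat.le_mul_of_pos_right _ (Nat.pow_pos (by omega))).trans_lt hb'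
    have s1 := hc.hidden r (c.pc + 1) (a := x * v) hlt
    obtain ⟨c', h1, h2, h3, h4, h5⟩ := ih (o + 1) (x * v) _ hP.2 s1 (by rw [ho])
      (by simp) (by simp only [Function.update_apply]; rw [if_neg (by omega), hqv]) hb'
    refine ⟨c', ?_, by omega, h3, by rw [h4, pow_succ', mul_assoc], fun u hu => ?_⟩
    · rw [add_comm]
      refine Reach.trans ?_ h1
      rw [← ho] at hP
      have he : Instr.exec (.arith .mul (3 * r + 6) (3 * r + 6) q) c =
        { c with pc := c.pc + 1, reg := Function.update c.reg (3 * r + 6) (x * v) } := by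
        simp only [Instr.exec, Op.eval, hx, hqv]
      have := Reach.one hP.1 hc.bd (by rw [he]; exact s1.bd)
      rwa [he] at this
    · rw [h5 u hu]
      exact Function.update_of_ne hu _ _

end PatternMatching

/-! ### Execution of compiled commands -/

namespace PatternMatching

open RAM

/-- One step of a single instruction between configurations that represent states. -/
theorem Sim.step {E : Env} {s s' : St} {c : Config} {P : Program} {i : Instr} (h : Sim E s c)
    (hi : P[c.pc]? = some i) (h' : Sim E s' (i.exec c)) :
    Reach P (E.M * E.M) 1 c (i.exec c) :=
  .one hi h.bd h'.bd

/-- The last clause carries nested loops through the induction: a body runs at depth `d + 1` and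
leaves the counter and the limit of its own loop and of the outer ones alone. -/
theorem Cmd.comp_reach {E : Env} (hE : E.Ok) {K : ℕ} (hK : ∀ v ≤ K, (E.n + 2) ^ v < E.M)
    {P : Program} (cmd : Cmd) (hcmd : cmd.maxc ≤ K) (o d : ℕ) (s : St) (hs : s.Bdd E.M)
    (c : Config) (hP : At P o (cmd.comp o d)) (hc : Sim E s c) (ho : c.pc = o) :
    ∃ c', Reach P (E.M * E.M) (cmd.cost E.n E.m) c c' ∧ c'.pc = o + (cmd.comp o d).length ∧
      Sim E (cmd.den E s) c' ∧ ∀ r < 2 * d, c'.reg (3 * r + 6) = c.reg (3 * r + 6) := by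
  have hbase := hE.base
  have hK' : ∀ v ≤ K, v < E.M := fun v hv =>
    (Nat.lt_pow_self (by omega : 1 < E.n + 2)).trans (hK v hv)
  have hlt : ∀ {a}, a < E.M → a < E.M * E.M := fun h => hE.lt_sq (by omega)
  induction cmd generalizing o d s c with
  | skip => exact ⟨c, .refl hc.bd, by simp [Cmd.comp, ho], hc, fun _ _ => rfl⟩
  | assign x e =>
    simp only [Cmd.comp, at_append, at_cons] at hP
    obtain ⟨c0, t0, v0⟩ := e.comp_reach hE hs hK' hcmd 0 o c hP.1 hc ho
    have p0 := t0.pc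
    rw [ho] at p0
    have s0 := hc.tmp t0
    have h1 := hP.2.1
    rw [← p0] at h1
    have he : Instr.exec (.arith .or (3 * x + 4) 5 5) c0 =
        { c0 with pc := c0.pc + 1, reg := Function.update c0.reg (3 * x + 4) (e.ev E s) } := by
      simp only [Instr.exec, Op.eval, nat_lor_self]
      rw [← v0]
    have s1 := s0.setV x (c0.pc + 1) (hlt (e.ev_lt hE hs hK' hcmd))
    have r1 := s0.step h1 (by rw [he]; exact s1)
    rw [he] at r1
    refine ⟨_, t0.reach.trans r1, ?_, s1, fun r hr => ?_⟩
    · simp [Cmd.comp, p0, add_assoc]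
    · exact (Function.update_of_ne (by omega) _ _).trans (t0.reg _ (by omega))
  | store r e f =>
    simp only [Cmd.maxc, max_le_iff] at hcmd
    simp only [Cmd.comp, at_append, at_cons, List.length_append] at hP
    obtain ⟨⟨hPe, hPf⟩, h1, h2, h3, h4, h5, h6, h7, -⟩ := hP
    obtain ⟨c0, t0, v0⟩ := e.comp_reach hE hs hK' hcmd.1 0 o c hPe hc ho
    have he := Exp.ev_lt hE hs hK' e hcmd.1
    have hf := Exp.ev_lt hE hs hK' f hcmd.2
    have p0 := t0.pc
    rw [ho] at p0
    have s0 := hc.tmp t0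
    obtain ⟨c1, t1, v1⟩ := f.comp_reach hE hs hK' hcmd.2 1 _ c0 hPf s0 p0
    have p1 := t1.pc
    rw [p0, add_assoc] at p1
    rw [← p1] at h1
    have v0' : c1.reg 5 = e.ev E s := by rw [t1.reg _ (by omega), ← v0]
    obtain ⟨c2, t2, v2, k2⟩ := TReach.one (t := 0) (t' := 2) (x := 16) t1.reach.bd h1 rfl rfl
      (hE.lt_sq (by omega)) (by omega)
    have p2 := t2.pc
    rw [p1] at p2
    rw [← p2] at h2
    obtain ⟨c3, t3, v3, k3⟩ := TReach.one (t := 0) (t' := 0) (x := 16 * e.ev E s) t2.reach.bd h2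
      rfl (by simp only [Op.eval]; rw [v2, k2 _ (by omega), v0', mul_comm])
      (hE.lt_sq (by omega)) (by omega)
    have p3 := t3.pc
    rw [p2] at p3
    rw [← p3] at h3
    obtain ⟨c4, t4, v4, k4⟩ := TReach.one (t := 0) (t' := 2) (x := r) t3.reach.bd h3 rfl rfl
      (hE.lt_sq (by omega)) (by omega)
    have p4 := t4.pc
    rw [p3] at p4
    rw [← p4] at h4
    obtain ⟨c5, t5, v5, k5⟩ := TReach.one (t := 0) (t' := 0) (x := 16 * e.ev E s + r)
      t4.reach.bd h4 rfl (by simp only [Op.eval]; rw [v4, k4 _ (by omega), v3])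
      (hE.lt_sq (by omega)) (by omega)
    have p5 := t5.pc
    rw [p4] at p5
    rw [← p5] at h5
    have s5 := (((((s0.tmp t1).tmp t2).tmp t3).tmp t4).tmp t5)
    obtain ⟨c6, t6, v6, k6⟩ := TReach.one (t := 0) (t' := 0) (x := E.n + 16 * e.ev E s + r)
      t5.reach.bd h5 rfl (by simp only [Op.eval]; rw [v5, s5.r2]; omega)
      (hE.lt_sq (by omega)) (by omega)
    have p6 := t6.pc
    rw [p5] at p6
    rw [← p6] at h6
    have s6 := s5.tmp t6
    obtain ⟨c7, t7, v7, k7⟩ := TReach.one (t := 0) (t' := 0) (x := 2 * E.n + 16 * e.ev E s + r)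
      t6.reach.bd h6 rfl (by simp only [Op.eval]; rw [v6, s6.r2]; omega)
      (hE.lt_sq (by omega)) (by omega)
    have p7 := t7.pc
    rw [p6] at p7
    rw [← p7] at h7
    have s7 := s6.tmp t7
    have v8 : c7.reg 8 = f.ev E s := by
      rw [k7 _ (by omega), k6 _ (by omega), k5 _ (by omega), k4 _ (by omega), k3 _ (by omega),
        k2 _ (by omega), ← v1]
    have hx : Instr.exec (.store 5 8) c7 = { c7 with
        pc := c7.pc + 1
        mem := Function.update c7.mem (2 * E.n + 16 * e.ev E s + r) (f.ev E s) } := by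
      simp only [Instr.exec]
      rw [v7, v8]
    have s8 := s7.setA r (e.ev E s) (c7.pc + 1) (hlt hf)
    have r8 := s7.step h7 (by rw [hx]; exact s8)
    rw [hx] at r8
    have tt := ((((((t0.trans t1 (by omega)).trans t2 le_rfl).trans t3 le_rfl).trans t4
      le_rfl).trans t5 le_rfl).trans t6 le_rfl).trans t7 le_rfl
    refine ⟨_, (tt.reach.trans r8).mono (by simp only [Cmd.cost]; omega), ?_, s8, fun r hr => ?_⟩
    · simp only [Cmd.comp, p7, List.length_append, List.length_cons, List.length_nil]
      omega
    · exact tt.reg _ (by omega)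
  | seq c1 c2 ih1 ih2 =>
    simp only [Cmd.maxc, max_le_iff] at hcmd
    simp only [Cmd.comp, at_append] at hP
    obtain ⟨c', a1, a2, a3, a4⟩ := ih1 hcmd.1 o d s hs c hP.1 hc ho
    obtain ⟨c'', b1, b2, b3, b4⟩ := ih2 hcmd.2 _ d _ (c1.den_bdd hE hK hcmd.1 hs) c' hP.2 a3 a2
    refine ⟨c'', a1.trans b1, ?_, b3, fun r hr => (b4 r hr).trans (a4 r hr)⟩
    rw [b2, Cmd.comp, List.length_append, add_assoc]
  | ite e f c1 c2 ih1 ih2 =>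
    simp only [Cmd.maxc, max_le_iff] at hcmd
    obtain ⟨⟨hme, hmf⟩, hm1, hm2⟩ := hcmd
    simp only [Cmd.comp, at_append, at_cons, List.length_append, List.length_cons,
      List.length_nil] at hP
    set q := c2.comp (o + ((e.comp 0).length + (f.comp 1).length) + 1) d with hq
    set l := o + ((e.comp 0).length + (f.comp 1).length) + 1 + q.length + 1 with hl
    set r := c1.comp l d with hr
    obtain ⟨⟨⟨⟨⟨hPe, hPf⟩, h1, -⟩, h2⟩, h3, -⟩, h4⟩ := hP
    obtain ⟨c0, t0, v0⟩ := e.comp_reach hE hs hK' hme 0 o c hPe hc ho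
    have he := Exp.ev_lt hE hs hK' e hme
    have hf := Exp.ev_lt hE hs hK' f hmf
    have p0 := t0.pc
    rw [ho] at p0
    have s0 := hc.tmp t0
    obtain ⟨cc, t1, v1⟩ := f.comp_reach hE hs hK' hmf 1 _ c0 hPf s0 p0
    have p1 := t1.pc
    rw [p0, add_assoc] at p1
    rw [← p1] at h1
    have s1 := s0.tmp t1
    have v0' : cc.reg 5 = e.ev E s := by rw [t1.reg _ (by omega), ← v0]
    have tt := t0.trans t1 (by omega)
    have hlen : (Cmd.comp o d (.ite e f c1 c2)).length =
        (e.comp 0).length + (f.comp 1).length + 1 + q.length + 1 + r.length := by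
      simp only [Cmd.comp, List.length_append, List.length_cons, List.length_nil, ← hq, ← hl, ← hr]
    rw [hlen]
    have v1' : cc.reg 8 = f.ev E s := v1
    simp only [Cmd.den]
    split_ifs with hcond
    · have hx : Instr.exec (.jumpLt 5 8 l) cc = { cc with pc := l } := by
        simp only [Instr.exec, v0', v1', if_pos hcond]
      have s2 := s1.pc l
      have r2 := s1.step h1 (by rw [hx]; exact s2)
      rw [hx] at r2
      have h4' : At P l r := by
        convert h4 using 1
        omega
      obtain ⟨c', a1, a2, a3, a4⟩ := ih1 hm1 l d s hs _ h4' s2 rfl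
      refine ⟨c', ((tt.reach.trans r2).trans a1).mono ?_, ?_, a3, fun u hu => ?_⟩
      · simp only [Cmd.cost]
        omega
      · rw [a2, ← hr]
        omega
      · rw [a4 u hu]
        exact tt.reg _ (by omega)
    · have hx : Instr.exec (.jumpLt 5 8 l) cc = { cc with pc := cc.pc + 1 } := by
        simp only [Instr.exec, v0', v1', if_neg hcond]
      have s2 := s1.pc (cc.pc + 1)
      have r2 := s1.step h1 (by rw [hx]; exact s2)
      rw [hx] at r2
      have h2' : At P (o + ((e.comp 0).length + (f.comp 1).length) + 1) q := by
        convert h2 using 1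
        omega
      obtain ⟨c', a1, a2, a3, a4⟩ := ih2 hm2 _ d s hs _ h2' s2 (by rw [p1])
      have h3' : P[c'.pc]? = some (.jump (l + r.length)) := by
        rw [a2, ← h3]
        congr 1
        simp only [← hq]
        omega
      have s3 := a3.pc (l + r.length)
      have r3 := a3.step h3' s3
      refine ⟨_, (((tt.reach.trans r2).trans a1).trans r3).mono ?_, ?_, s3, fun u hu => ?_⟩
      · simp only [Cmd.cost]
        omega
      · simp only [Instr.exec]
        omega
      · simp only [Instr.exec]
        rw [a4 u hu]
        exact tt.reg _ (by omega)
  | loop x a b cmd ih =>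
    simp only [Cmd.maxc, max_le_iff] at hcmd
    simp only [Cmd.comp, compLim, at_append, at_cons, List.length_append, List.length_cons,
      List.length_nil, List.length_replicate] at hP
    set l := o + (a + b + 1 + (0 + 1)) with hl
    set q := cmd.comp (l + 3) (d + 1) with hq
    obtain ⟨⟨⟨⟨⟨h1, h2, h3⟩, h4, -⟩, h5, h6, h7, -⟩, h8⟩, h9, h10, h11, -⟩ := hP
    have hlim : E.lim a b ≤ (E.n + 2) ^ (a + b) := by
      have := hE.m
      rw [Env.lim, pow_add]
      gcongr
      omega
    have hlt' := hlim.trans_lt (hK _ hcmd.1)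
    have hlen : (Cmd.comp o d (.loop x a b cmd)).length = a + b + 2 + 3 + q.length + 3 := by
      simp only [Cmd.comp, compLim, List.length_append, List.length_cons, List.length_nil,
        List.length_replicate, ← hl, ← hq]
    -- the limit
    have s1 := hc.hidden (2 * d + 1) (c.pc + 1) (a := 1) (hE.lt_sq (by omega))
    have r1 := hc.step (by rw [ho]; exact h1) s1
    simp only [Instr.exec] at r1
    have hpa : (E.n + 2) ^ a < E.M := hK a (by omega)
    obtain ⟨c2, r2, p2, s2, v2, k2⟩ := run_replicate (by omega) (by omega : 1 ≤ E.n + 2) a _ 1 _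
      h2 s1 (by simp only [ho]) (by simp) (by simp [hc.r0])
      (by rw [one_mul]; exact hlt hpa)
    obtain ⟨c3, r3, p3, s3, v3, k3⟩ := run_replicate (by omega) hE.m_pos b _ _ _ h3 s2
      p2 v2 s2.r3 (by rw [one_mul]; exact hlt hlt')
    have v3' : c3.reg (3 * (2 * d + 1) + 6) = E.lim a b := by rw [v3, Env.lim, one_mul]
    have s4 := s3.hidden (2 * d) (c3.pc + 1) (a := 0) (hE.lt_sq (by omega))
    have r4 := s3.step (by rw [p3, ← h4]; congr 1; omega) s4
    simp only [Instr.exec] at r4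
    have k4 : ∀ u < 2 * d, Function.update c3.reg (3 * (2 * d) + 6) 0 (3 * u + 6) =
        c.reg (3 * u + 6) := by
      intro u hu
      rw [Function.update_of_ne (by omega), k3 _ (by omega), k2 _ (by omega)]
      exact Function.update_of_ne (by omega) _ _
    -- The state at the loop test after `j` rounds. A round costs the body and five instructions:
    -- test, copy, two for the increment, jump.
    have key : ∀ j ≤ E.lim a b, ∃ c',
        Reach P (E.M * E.M) (j * (cmd.cost E.n E.m + 5))
          { c3 with pc := c3.pc + 1, reg := Function.update c3.reg (3 * (2 * d) + 6) 0 } c' ∧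
        c'.pc = l ∧ c'.reg (3 * (2 * d) + 6) = j ∧ c'.reg (3 * (2 * d + 1) + 6) = E.lim a b ∧
        Sim E (iter (fun j s => cmd.den E (s.setV x j)) s j) c' ∧
        (∀ u < 2 * d, c'.reg (3 * u + 6) = c.reg (3 * u + 6)) ∧
        (iter (fun j s => cmd.den E (s.setV x j)) s j).Bdd E.M := by
      intro j hj
      induction j with
      | zero =>
        refine ⟨_, (Reach.refl s4.bd).mono (by omega), ?_, ?_, ?_, s4, k4, hs⟩
        · simp only [p3]
          omega
        · simp
        · simp only
          rw [Function.update_of_ne (by omega), v3']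
      | succ j ihj =>
        obtain ⟨c5, a1, a2, a3, a4, a5, a6, a7⟩ := ihj (by omega)
        have hx6 : Instr.exec (.jumpLt (3 * (2 * d) + 6) (3 * (2 * d + 1) + 6) (l + 2)) c5 =
            { c5 with pc := l + 2 } := by
          simp only [Instr.exec, a3, a4, if_pos (show j < E.lim a b by omega)]
        have s6 := a5.pc (l + 2)
        have r6 := a5.step (by rw [a2, ← h5]) (by rw [hx6]; exact s6)
        rw [hx6] at r6
        have hjM : j < E.M := by omega
        have hx7 : Instr.exec (.arith .or (3 * x + 4) (3 * (2 * d) + 6) (3 * (2 * d) + 6))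
            { c5 with pc := l + 2 } =
            { c5 with pc := l + 3, reg := Function.update c5.reg (3 * x + 4) j } := by
          simp only [Instr.exec, Op.eval, nat_lor_self, a3]
        have s7 := a5.setV x (l + 3) (hlt hjM)
        have r7 := s6.step (by simp only; rw [← h7]) (by rw [hx7]; exact s7)
        rw [hx7] at r7
        obtain ⟨c8, b1, b2, b3, b4⟩ := ih hcmd.2 (l + 3) (d + 1) _ (a7.setV x hjM) _
          (by rw [← hq]; convert h8 using 1; omega) s7 rfl
        rw [← hq] at b2
        have k8 : c8.reg (3 * (2 * d) + 6) = j := by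
          rw [b4 _ (by omega)]
          simp only
          rw [Function.update_of_ne (by omega), a3]
        have k8' : c8.reg (3 * (2 * d + 1) + 6) = E.lim a b := by
          rw [b4 _ (by omega)]
          simp only
          rw [Function.update_of_ne (by omega), a4]
        obtain ⟨c9, t9, v9, k9⟩ := TReach.one (t := 0) (t' := 0) (x := 1) b1.bd
          (by rw [b2, ← h9]; congr 1; omega) rfl rfl (hE.lt_sq (by omega)) le_rfl
        have p9 := t9.pc
        rw [b2] at p9
        have s9 := b3.tmp t9
        have hx10 : Instr.exec (.arith .add (3 * (2 * d) + 6) (3 * (2 * d) + 6) 5) c9 =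
            { c9 with pc := c9.pc + 1,
                      reg := Function.update c9.reg (3 * (2 * d) + 6) (j + 1) } := by
          simp only [Instr.exec, Op.eval]
          rw [k9 _ (by omega), k8]
          simp only [v9]
        have s10 := s9.hidden (2 * d) (c9.pc + 1) (a := j + 1) (hE.lt_sq (by omega))
        have r10 := s9.step (by rw [p9, ← h10]; congr 1; omega) (by rw [hx10]; exact s10)
        rw [hx10] at r10
        have s11 := s10.pc l
        have r11 := s10.step (by simp only; rw [p9, ← h11]; congr 1; omega) s11
        simp only [Instr.exec] at r11
        refine ⟨_, ((((((a1.trans r6).trans r7).trans b1).trans t9.reach).trans r10).trans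
          r11).mono ?_, rfl, ?_, ?_, s11, fun u hu => ?_, ?_⟩
        · rw [add_mul, one_mul]
          omega
        · simp
        · simp only
          rw [Function.update_of_ne (by omega), k9 _ (by omega), k8']
        · simp only
          rw [Function.update_of_ne (by omega), k9 _ (by omega), b4 _ (by omega)]
          simp only
          rw [Function.update_of_ne (by omega), a6 u hu]
        · exact cmd.den_bdd hE hK hcmd.2 (a7.setV x hjM)
    obtain ⟨c5, a1, a2, a3, a4, a5, a6, a7⟩ := key _ le_rfl
    have hx6 : Instr.exec (.jumpLt (3 * (2 * d) + 6) (3 * (2 * d + 1) + 6) (l + 2)) c5 =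
        { c5 with pc := c5.pc + 1 } := by
      simp only [Instr.exec, a3, a4, if_neg (lt_irrefl _)]
    have s6 := a5.pc (c5.pc + 1)
    have r6 := a5.step (by rw [a2, ← h5]) (by rw [hx6]; exact s6)
    rw [hx6] at r6
    have s7 := s6.pc (l + 3 + q.length + 3)
    have r7 := s6.step (by simp only; rw [a2, ← h6]) s7
    simp only [Instr.exec] at r7
    refine ⟨_, ((((((r1.trans r2).trans r3).trans r4).trans a1).trans r6).trans r7).mono ?_, ?_,
      s7, a6⟩
    · simp only [Cmd.cost]
      rw [← Env.lim]
      omega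
    · rw [hlen]
      simp only
      omega

end PatternMatching

namespace PatternMatching

open RAM

/-! ## Programs for inputs -/

/-- Sets up registers, then runs the compiled command, then copies a variable to register `0`. -/
def Cmd.program (c : ℕ) (cmd : Cmd) (out : ℕ) : Program :=
  [.arith .or 4 3 3, .arith .or 3 1 1, .arith .or 2 0 0, .const 0 2, .arith .add 0 0 2,
    .const 1 1] ++ List.replicate c (.arith .mul 1 1 0) ++ cmd.comp (6 + c) 0 ++
    [.arith .or 0 (3 * out + 4) (3 * out + 4)]

def Input.env (I : Input) (c : ℕ) : Env where
  n := I.n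
  m := I.m
  M := (I.n + 2) ^ c
  inp i := I.code.getD i 0

def startSt (Δ : ℕ) : St where
  v x := if x = 0 then Δ else 0
  A _ _ := 0

theorem Input.length_code (I : Input) : I.code.length = I.n + I.m := by
  simp [Input.code, I.word_length, Input.m]

theorem Input.m_pos (I : Input) : 1 ≤ I.m := List.length_pos_iff.2 I.pattern_ne_nil

theorem Input.m_le (I : Input) : I.m ≤ I.n := I.pattern_length_le

theorem Input.code_le (I : Input) (i : ℕ) : I.code.getD i 0 ≤ 2 * I.n := by
  rw [List.getD_eq_getElem?_getD]
  rcases h : I.code[i]? with _ | a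
  · simp
  · have ha := List.mem_of_getElem? h
    simp only [Input.code, List.mem_append, List.mem_map] at ha
    have := I.alphabet_le
    simp only [Option.getD_some]
    rcases ha with ⟨b, -, rfl⟩ | ⟨b | b, -, rfl⟩
    · omega
    · simp only [Sum.elim_inl]
      omega
    · simp only [Sum.elim_inr]
      omega

theorem Input.env_ok (I : Input) {c : ℕ} (hc : 6 ≤ c) : (I.env c).Ok := by
  have h1 := I.m_pos
  have h2 := I.m_le
  have h6 : (I.n + 2) ^ 6 ≤ (I.n + 2) ^ c := Nat.pow_le_pow_right (by omega) hc
  have h7 : (I.n + 2) * 2 ^ 5 ≤ (I.n + 2) ^ 6 := by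
    rw [pow_succ' (I.n + 2) 5]
    gcongr
    omega
  refine ⟨by simp only [Input.env]; omega, ?_, ?_, h2, h1, fun i => ?_⟩
  · simp only [Input.env]
    omega
  · simp only [Input.env]
    omega
  · have := I.code_le i
    simp only [Input.env]
    omega

theorem run_power {P : Program} {B N : ℕ} :
    ∀ (a o x : ℕ) (c : Config), At P o (List.replicate a (.arith .mul 1 1 0)) → Bd B c →
      c.pc = o → c.reg 0 = N → c.reg 1 = x → 1 ≤ N → x * N ^ a < B →
      Reach P B a c { c with pc := o + a, reg := Function.update c.reg 1 (x * N ^ a) } := by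
  intro a
  induction a with
  | zero =>
    intro o x c hP hc ho hN hx h1 hb
    have : { c with pc := o + 0, reg := Function.update c.reg 1 (x * N ^ 0) } = c := by
      subst ho
      simp [← hx]
    rw [this]
    exact .refl hc
  | succ a ih =>
    intro o x c hP hc ho hN hx h1 hb
    simp only [List.replicate_succ, at_cons] at hP
    have hb' : x * N * N ^ a < B := by rwa [pow_succ', ← mul_assoc] at hb
    have hlt : x * N < B :=
      (Nat.le_mul_of_pos_right _ (Nat.pow_pos (by omega))).trans_lt hb'
    have he : Instr.exec (.arith .mul 1 1 0) c =
        { c with pc := o + 1, reg := Function.update c.reg 1 (x * N) } := by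
      simp only [Instr.exec, Op.eval, hx, hN, ho]
    have b1 := hc.update 1 (x * N) (o + 1) hlt
    have h2 := ih (o + 1) (x * N) _ hP.2 b1 rfl (by simp [hN]) (by simp) h1 hb'
    have h3 := Reach.one (P := P) (by rw [ho]; exact hP.1) hc (by rw [he]; exact b1)
    rw [he] at h3
    have := h3.trans h2
    rw [add_comm 1 a] at this
    convert this using 2
    · omega
    · simp [pow_succ', mul_assoc]

theorem Reach.update {P : Program} {B : ℕ} {c : Config} {i : Instr} {r x y o : ℕ} (ho : c.pc = o)
    (hi : P[o]? = some i) (hb : Bd B c)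
    (he : i.exec c = { c with pc := c.pc + 1, reg := Function.update c.reg r y }) (hy : y = x)
    (hx : x < B) :
    ∃ c', Reach P B 1 c c' ∧ c'.pc = o + 1 ∧ c'.mem = c.mem ∧
      c'.reg = Function.update c.reg r x := by
  subst hy ho
  refine ⟨i.exec c, .one hi hb ?_, ?_, ?_, ?_⟩ <;> rw [he]
  exact hb.update _ _ _ hx

/-- Six steps arrange the parameters, `c` multiplications form `M = (n + 2) ^ c`, and one step
copies the output. The bound on numbers is `M * M`. -/
theorem Cmd.outputs_program (cmd : Cmd) (out : ℕ) {c : ℕ} (h6 : 6 ≤ c) (hc : cmd.maxc < c)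
    (I : Input) (Δ : ℕ) (hΔ : Δ ≤ I.n) :
    Outputs (cmd.program c out) (I.init Δ) (cmd.cost I.n I.m + c + 7) ((I.n + 2) ^ (2 * c))
      ((cmd.den (I.env c) (startSt Δ)).v out) := by
  have hE := I.env_ok h6
  have hm := I.m_pos
  have hmn := I.m_le
  have hbase := hE.base
  have hσ := I.alphabet_le
  set E := I.env c with hEdef
  have hEn : E.n = I.n := rfl
  have hEm : E.m = I.m := rfl
  have hEM : E.M = (I.n + 2) ^ c := rfl
  have hB : (I.n + 2) ^ (2 * c) = E.M * E.M := by rw [hEM, two_mul, pow_add]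
  rw [hB]
  have hlt : ∀ {a}, a < E.M → a < E.M * E.M := fun h => hE.lt_sq (by omega)
  set P := cmd.program c out with hPdef
  have hP : At P 0 P := fun i h => by simp [h]
  conv at hP => rw [hPdef]; arg 3; unfold Cmd.program
  simp only [← hPdef, at_append, at_cons, List.length_append, List.length_cons, List.length_nil,
    List.length_replicate] at hP
  obtain ⟨⟨⟨⟨h0, h1, h2, h3, h4, h5, -⟩, hpow⟩, hcmd⟩, hout, -⟩ := hP
  have b0 : Bd (E.M * E.M) (I.init Δ) := by
    intro i
    refine ⟨hlt ?_, hlt (hE.inp i)⟩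
    simp only [Input.init]
    rcases i with _ | _ | _ | _ | i
    · simp
      omega
    · simp
      omega
    · simp
      omega
    · simp
      omega
    · simp
      omega
  have q0 : (I.init Δ).reg 0 = I.n := rfl
  have q1 : (I.init Δ).reg 1 = I.m := rfl
  have q3 : (I.init Δ).reg 3 = Δ := rfl
  have q4 : ∀ i, (I.init Δ).reg (i + 4) = 0 := fun i => rfl
  obtain ⟨c1, r1, p1, m1, g1⟩ := Reach.update (r := 4) (x := Δ) rfl h0 b0 rfl
    ((nat_lor_self _).trans q3) (hlt (by omega))
  obtain ⟨c2, r2, p2, m2, g2⟩ := Reach.update (r := 3) (x := I.m) p1 h1 r1.bd rfl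
    ((nat_lor_self _).trans (by simp [g1, q1])) (hlt (by omega))
  obtain ⟨c3, r3, p3, m3, g3⟩ := Reach.update (r := 2) (x := I.n) p2 h2 r2.bd rfl
    ((nat_lor_self _).trans (by simp [g2, g1, q0])) (hlt (by omega))
  obtain ⟨c4, r4, p4, m4, g4⟩ := Reach.update (r := 0) (x := 2) p3 h3 r3.bd rfl
    rfl (hlt (by omega))
  obtain ⟨c5, r5, p5, m5, g5⟩ := Reach.update (r := 0) (x := I.n + 2) p4 h4 r4.bd rfl
    (by simp [Op.eval, g4, g3, add_comm]) (hlt (by omega))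
  obtain ⟨c6, r6, p6, m6, g6⟩ := Reach.update (r := 1) (x := 1) p5 h5 r5.bd rfl
    rfl (hlt (by omega))
  have hpow' := run_power (B := E.M * E.M) (N := I.n + 2) c _ 1 c6 hpow r6.bd p6
    (by simp [g6, g5]) (by simp [g6]) (by omega) (by rw [one_mul, ← hEM]; exact hE.lt_sq (by omega))
  rw [one_mul, ← hEM] at hpow'
  have hmem : c6.mem = (I.init Δ).mem := by rw [m6, m5, m4, m3, m2, m1]
  set c7 : Config := { c6 with
    pc := 0 + (0 + 1 + 1 + 1 + 1 + 1 + 1) + c, reg := Function.update c6.reg 1 E.M } with hc7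
  have hsim : Sim E (startSt Δ) c7 := by
    refine ⟨?_, ?_, ?_, ?_, fun x => ?_, fun i hi => ?_, fun r i => ?_, hpow'.bd⟩
    · simp [hc7, g6, g5, hEn]
    · simp [hc7]
    · simp [hc7, g6, g5, g4, g3, hEn]
    · simp [hc7, g6, g5, g4, g3, g2, hEm]
    · simp only [hc7, g6, g5, g4, g3, g2, g1, startSt]
      rcases x with _ | x
      · simp
      · simp [q4 (3 * (x + 1))]
    · simp only [hc7, hmem]
      rfl
    · simp only [hc7, hmem, startSt, Input.init]
      rw [List.getD_eq_default _ _ (by rw [I.length_code]; omega)]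
  have hK : ∀ v ≤ cmd.maxc, (E.n + 2) ^ v < E.M := fun v hv =>
    Nat.pow_lt_pow_right (by omega) (by omega)
  have hst : (startSt Δ).Bdd E.M := by
    refine ⟨fun x => ?_, fun r i => by simp only [startSt]; omega⟩
    simp only [startSt]
    split_ifs <;> omega
  obtain ⟨c8, r8, p8, s8, -⟩ := cmd.comp_reach hE hK le_rfl (6 + c) 0 (startSt Δ) hst c7
    (by convert hcmd using 1; omega) hsim (by simp only [hc7])
  have hv := s8.rv out
  obtain ⟨c9, r9, p9, m9, g9⟩ := Reach.update (r := 0)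
    (x := (cmd.den (I.env c) (startSt Δ)).v out) p8
    (by rw [← hout]; congr 1; omega) r8.bd rfl ((nat_lor_self _).trans hv)
    (hv ▸ (r8.bd _).1)
  obtain ⟨t, ht, h, hbd⟩ := (((((((r1.trans r2).trans r3).trans r4).trans r5).trans r6).trans
    hpow').trans r8).trans r9
  refine ⟨t, ?_, ?_, ?_, hbd⟩
  · rw [hEn, hEm] at ht
    omega
  · rw [h, p9, hPdef]
    simp only [Cmd.program, List.length_append, List.length_cons, List.length_nil,
      List.length_replicate]
    omega
  · rw [h, g9, Function.update_self]

end PatternMatching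

namespace PatternMatching

/-! ## Sets of positions and their codes -/

section Sets

/-- The value at the position before `j`, or `0`. -/
def prev (S : ℕ → ℕ) : ℕ → ℕ
  | 0 => 0
  | j + 1 => S j

theorem prev_succ (S : ℕ → ℕ) (j : ℕ) : prev S (j + 1) = S j := rfl

/-- The number of positions below `J` where the indicator `S` changes. -/
def togCount (S : ℕ → ℕ) : ℕ → ℕ
  | 0 => 0
  | J + 1 => if S J ≠ prev S J then togCount S J + 1 else togCount S J

/-- The number with base-`N` digits `P j`, for the `j < J` where `S` changes. -/
def horner (N : ℕ) (S P : ℕ → ℕ) : ℕ → ℕ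
  | 0 => 0
  | J + 1 => if S J ≠ prev S J then horner N S P J * N + P J else horner N S P J

def mark (b S : ℕ → ℕ) (x : ℕ) : ℕ → ℕ := fun j => if b j = x then 1 else S j

/-- The positions covered by the first `i` entries of `ord`. -/
def cover (b ord : ℕ → ℕ) : ℕ → ℕ → ℕ
  | 0 => 0
  | i + 1 => mark b (cover b ord i) (ord i)

theorem prev_le {S : ℕ → ℕ} (h : ∀ j, S j ≤ 1) (j : ℕ) : prev S j ≤ 1 := by
  cases j
  · simp [prev]
  · exact h _

theorem mark_le {b S : ℕ → ℕ} {x : ℕ} (h : ∀ j, S j ≤ 1) (j : ℕ) : mark b S x j ≤ 1 := by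
  unfold mark
  split_ifs
  · exact le_rfl
  · exact h j

theorem le_mark {b S : ℕ → ℕ} {x : ℕ} (h : ∀ j, S j ≤ 1) (j : ℕ) : S j ≤ mark b S x j := by
  unfold mark
  split_ifs
  · exact h j
  · exact le_rfl

theorem cover_eq_one_iff {b ord : ℕ → ℕ} {i j : ℕ} :
    cover b ord i j = 1 ↔ ∃ i' < i, b j = ord i' := by
  induction i with
  | zero => simp [cover]
  | succ i ih =>
    simp only [cover, mark, Nat.lt_succ_iff_lt_or_eq]
    split_ifs with h
    · simp only [true_iff]
      exact ⟨i, Or.inr rfl, h⟩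
    · rw [ih]
      constructor
      · rintro ⟨i', h1, h2⟩
        exact ⟨i', Or.inl h1, h2⟩
      · rintro ⟨i', h1 | rfl, h2⟩
        · exact ⟨i', h1, h2⟩
        · exact absurd h2 h

/-- There is one digit for each change of `S`, so a set with few changes has small codes whatever
`P` does elsewhere. -/
theorem horner_lt {N : ℕ} {S P : ℕ → ℕ} {J : ℕ}
    (hP : ∀ j < J, S j ≠ prev S j → P j < N) : horner N S P J < N ^ togCount S J := by
  induction J with
  | zero => simp [horner, togCount]
  | succ J ih =>
    have ih := ih fun j hj => hP j (by omega)
    simp only [horner, togCount]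
    split_ifs with h
    · have := hP J (by omega) h
      rw [pow_succ]
      nlinarith
    · exact ih

theorem togCount_mono (S : ℕ → ℕ) {J J' : ℕ} (h : J ≤ J') : togCount S J ≤ togCount S J' := by
  induction J', h using Nat.le_induction with
  | base => exact le_rfl
  | succ J' _ ih =>
    simp only [togCount]
    split_ifs <;> omega

theorem horner_congr {N : ℕ} {S P P' : ℕ → ℕ} {J : ℕ}
    (h : ∀ j < J, S j ≠ prev S j → P j = P' j) : horner N S P J = horner N S P' J := by
  induction J with
  | zero => rfl
  | succ J ih =>
    simp only [horner]
    rw [ih fun j hj => h j (by omega)]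
    split_ifs with hJ
    · rw [h J (by omega) hJ]
    · rfl

/-- For a fixed `S` the number of digits is known, so leading zeros do no harm and the digits can be
read off. -/
theorem horner_inj {N : ℕ} {S P P' : ℕ → ℕ} {J : ℕ}
    (hP : ∀ j < J, S j ≠ prev S j → P j < N) (hP' : ∀ j < J, S j ≠ prev S j → P' j < N)
    (h : horner N S P J = horner N S P' J) : ∀ j < J, S j ≠ prev S j → P j = P' j := by
  induction J with
  | zero => intro j hj; omega
  | succ J ih =>
    have ih := ih (fun j hj => hP j (by omega)) (fun j hj => hP' j (by omega))
    simp only [horner] at h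
    intro j hj hS
    by_cases hJ : S J ≠ prev S J
    · have h1 := hP J (by omega) hJ
      have h2 := hP' J (by omega) hJ
      rw [if_pos hJ, if_pos hJ] at h
      have hN : 0 < N := by omega
      have e1 : P J = P' J := by
        have := congrArg (· % N) h
        simpa [Nat.add_mod, Nat.mod_eq_of_lt h1, Nat.mod_eq_of_lt h2] using this
      rcases Nat.lt_succ_iff_lt_or_eq.1 hj with hj' | rfl
      · exact ih (Nat.eq_of_mul_eq_mul_right hN (by omega)) j hj' hS
      · exact e1
    · rw [if_neg hJ, if_neg hJ] at h
      rcases Nat.lt_succ_iff_lt_or_eq.1 hj with hj' | rfl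
      · exact ih h j hj' hS
      · exact absurd hS hJ

/-- The last digit of the code of a set by its changes. -/
theorem horner_pos_mod (N : ℕ) (S : ℕ → ℕ) {J : ℕ} (hJ : J < N) :
    horner N S (· + 1) J % N ≤ J := by
  induction J with
  | zero => simp [horner]
  | succ J ih =>
    simp only [horner]
    split_ifs
    · simp [Nat.add_mod, Nat.mod_eq_of_lt hJ]
    · exact (ih (by omega)).trans (by omega)

/-- Here the set itself is recovered from the code. The digits `j + 1` increase, so the last digit
tells whether there is a change at the last position `J`: it is `J + 1` then, and at most `J`
otherwise. -/
theorem horner_pos_inj {N : ℕ} {S S' : ℕ → ℕ} (hS : ∀ j, S j ≤ 1) (hS' : ∀ j, S' j ≤ 1) {J : ℕ}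
    (hJ : J < N) (h : horner N S (· + 1) J = horner N S' (· + 1) J) : ∀ j < J, S j = S' j := by
  -- The values follow from the changes, beginning with `prev S 0 = 0`.
  suffices ∀ j < J, (S j ≠ prev S j ↔ S' j ≠ prev S' j) by
    intro j
    induction j with
    | zero =>
      intro hj
      have := this 0 hj
      have := hS 0
      have := hS' 0
      simp only [prev] at *
      omega
    | succ j ih =>
      intro hj
      have := this (j + 1) hj
      have := hS (j + 1)
      have := hS' (j + 1)
      have := ih (by omega)
      have := hS j
      simp only [prev] at *
      omega
  induction J with
  | zero => intro j hj; omega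
  | succ J ih =>
    have m1 := horner_pos_mod N S (J := J) (by omega)
    have m2 := horner_pos_mod N S' (J := J) (by omega)
    simp only [horner] at h
    have hlast : S J ≠ prev S J ↔ S' J ≠ prev S' J := by
      by_cases h1 : S J ≠ prev S J <;> by_cases h2 : S' J ≠ prev S' J
      · simp [h1, h2]
      · rw [if_pos h1, if_neg h2] at h
        rw [← h] at m2
        simp [Nat.add_mod, Nat.mod_eq_of_lt hJ] at m2
      · rw [if_neg h1, if_pos h2] at h
        rw [h] at m1
        simp [Nat.add_mod, Nat.mod_eq_of_lt hJ] at m1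
      · simp [h1, h2]
    intro j hj
    rcases Nat.lt_succ_iff_lt_or_eq.1 hj with hj' | rfl
    · refine ih (by omega) ?_ j hj'
      by_cases h1 : S J ≠ prev S J
      · rw [if_pos h1, if_pos (hlast.1 h1)] at h
        exact Nat.eq_of_mul_eq_mul_right (by omega : 0 < N) (by omega)
      · rw [if_neg h1, if_neg (fun h2 => h1 (hlast.2 h2))] at h
        exact h
    · exact hlast

/-- The numbers of positions below `J` where a block of `S` starts, or has just ended. -/
def startCount (S : ℕ → ℕ) (J : ℕ) : ℕ := ∑ j ∈ Finset.range J, (S j - prev S j)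

def endCount (S : ℕ → ℕ) (J : ℕ) : ℕ := ∑ j ∈ Finset.range J, (prev S j - S j)

/-- The differences telescope, and truncated subtraction separates them into starts and ends. -/
theorem startCount_eq (S : ℕ → ℕ) (J : ℕ) : startCount S J = endCount S J + prev S J := by
  induction J with
  | zero => simp [startCount, endCount, prev]
  | succ J ih =>
    simp only [startCount, endCount, Finset.sum_range_succ] at *
    rw [prev_succ]
    omega

theorem togCount_eq {S : ℕ → ℕ} (hS : ∀ j, S j ≤ 1) (J : ℕ) :
    togCount S J = startCount S J + endCount S J := by
  induction J with
  | zero => simp [startCount, endCount, togCount]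
  | succ J ih =>
    have := hS J
    have := prev_le hS J
    simp only [startCount, endCount, Finset.sum_range_succ, togCount] at *
    split_ifs <;> omega

end Sets

end PatternMatching

namespace PatternMatching

/-! ## Placements of patterns, and guessed walks along a pattern -/

/-- The code of the pattern's letter at position `j`. -/
def Env.pat (E : Env) (j : ℕ) : ℕ := E.inp (E.n + j)

/-- The length of the image of the pattern's letter at position `j`. -/
def Env.len (E : Env) (L : ℕ → ℕ) (j : ℕ) : ℕ := if E.n < E.pat j then L (E.pat j) else 1

/-- The number of mismatches at the pattern position `j`, whose image starts at `p`. -/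
def Env.err (E : Env) (L : ℕ → ℕ) (h : ℕ → ℕ → ℕ) (j p : ℕ) : ℕ :=
  if E.n < E.pat j then ∑ o ∈ Finset.range (L (E.pat j)), if E.inp (p + o) ≠ h (E.pat j) o then 1 else 0
  else if E.inp p ≠ E.pat j then 1 else 0

/-- `P` places the images of the pattern positions in `S` one after the other. -/
def Env.Feas (E : Env) (S L P : ℕ → ℕ) : Prop :=
  ∀ j, S j = 1 → P (j + 1) = P j + E.len L j ∧ P (j + 1) ≤ E.n

structure Env.Full (E : Env) (L P : ℕ → ℕ) : Prop where
  zero : P 0 = 0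
  last : P E.m = E.n
  succ : ∀ j < E.m, P (j + 1) = P j + E.len L j

def Env.costOn (E : Env) (S L : ℕ → ℕ) (h : ℕ → ℕ → ℕ) (P : ℕ → ℕ) : ℕ :=
  ∑ j ∈ Finset.range E.m, if S j = 1 then E.err L h j (P j) else 0

/-- The state of a walk along the pattern. -/
structure Walk where
  pos : ℕ
  guess : ℕ
  oc : ℕ
  nc : ℕ
  cost : ℕ
  t : ℕ
  ok : ℕ
  occ : ℕ → ℕ

/-- Here the walk takes its next position from the guess. -/
def Jumps (S S' : ℕ → ℕ) (j : ℕ) : Prop := 0 < (S' j - prev S' j) + (prev S j - S j)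

instance (S S' : ℕ → ℕ) (j : ℕ) : Decidable (Jumps S S' j) := by unfold Jumps; infer_instance

/-- The guess is a sequence of digits in base `n + 2`, consumed from the lowest one. -/
def Walk.jump (n : ℕ) (S S' : ℕ → ℕ) (j : ℕ) (W : Walk) : Walk :=
  if Jumps S S' j then { W with pos := W.guess % (n + 2), guess := W.guess / (n + 2) } else W

/-- An overrun is remembered in `ok`; the reset to `0` keeps the position a legal digit on invalid
walks too. -/
def Walk.clip (n : ℕ) (W : Walk) : Walk :=
  if n < W.pos then { W with ok := 0, pos := 0 } else W

def Walk.codeNew (n : ℕ) (S' : ℕ → ℕ) (j : ℕ) (W : Walk) : Walk :=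
  if S' j ≠ prev S' j then { W with nc := W.nc * (n + 2) + W.pos } else W

def Walk.codeOld (n : ℕ) (S : ℕ → ℕ) (j : ℕ) (W : Walk) : Walk :=
  if S j ≠ prev S j then { W with oc := W.oc * (n + 2) + W.pos } else W

/-- A newly covered terminal is charged at once. For a variable only the start of the occurrence is
kept, because its cost depends on all occurrences together. -/
def Walk.visit (E : Env) (L : ℕ) (S S' : ℕ → ℕ) (j : ℕ) (W : Walk) : Walk :=
  if S j < S' j then
    if E.n < E.pat j then
      { W with occ := Function.update W.occ W.t W.pos, t := W.t + 1, pos := W.pos + L }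
    else { W with cost := W.cost + (if E.inp W.pos ≠ E.pat j then 1 else 0), pos := W.pos + 1 }
  else W

def Walk.mid (E : Env) (S S' : ℕ → ℕ) (j : ℕ) (W : Walk) : Walk :=
  (W.jump E.n S S' j).clip E.n

def Walk.step (E : Env) (L : ℕ) (S S' : ℕ → ℕ) (j : ℕ) (W : Walk) : Walk :=
  (((W.mid E S S' j).codeNew E.n S' j).codeOld E.n S j).visit E L S S' j

/-- The walk that starts with the guess `g`. -/
def walk (E : Env) (S S' : ℕ → ℕ) (g : ℕ) (occ : ℕ → ℕ) : ℕ → Walk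
  | 0 => ⟨0, g / (E.n + 2), 0, 0, 0, 0, 1, occ⟩
  | j + 1 => (walk E S S' g occ j).step E (g % (E.n + 2)) S S' j

/-- The position of the walk at the boundary `j`. -/
def walkPos (E : Env) (S S' : ℕ → ℕ) (g : ℕ) (occ : ℕ → ℕ) (j : ℕ) : ℕ :=
  ((walk E S S' g occ j).mid E S S' j).pos

section Walk

theorem Walk.codeNew_proj (n : ℕ) (S' : ℕ → ℕ) (j : ℕ) (W : Walk) :
    (W.codeNew n S' j).t = W.t ∧ (W.codeNew n S' j).occ = W.occ ∧ (W.codeNew n S' j).pos = W.pos ∧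
      (W.codeNew n S' j).cost = W.cost ∧ (W.codeNew n S' j).guess = W.guess ∧
      (W.codeNew n S' j).ok = W.ok ∧ (W.codeNew n S' j).oc = W.oc := by
  unfold Walk.codeNew
  split_ifs <;> simp

theorem Walk.codeOld_proj (n : ℕ) (S : ℕ → ℕ) (j : ℕ) (W : Walk) :
    (W.codeOld n S j).t = W.t ∧ (W.codeOld n S j).occ = W.occ ∧ (W.codeOld n S j).pos = W.pos ∧
      (W.codeOld n S j).cost = W.cost ∧ (W.codeOld n S j).guess = W.guess ∧
      (W.codeOld n S j).ok = W.ok ∧ (W.codeOld n S j).nc = W.nc := by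
  unfold Walk.codeOld
  split_ifs <;> simp

theorem Walk.visit_proj (E : Env) (L : ℕ) (S S' : ℕ → ℕ) (j : ℕ) (W : Walk) :
    (W.visit E L S S' j).guess = W.guess ∧ (W.visit E L S S' j).oc = W.oc ∧
      (W.visit E L S S' j).nc = W.nc ∧ (W.visit E L S S' j).ok = W.ok := by
  unfold Walk.visit
  split_ifs <;> simp

theorem Walk.mid_proj (E : Env) (S S' : ℕ → ℕ) (j : ℕ) (W : Walk) :
    (W.mid E S S' j).t = W.t ∧ (W.mid E S S' j).occ = W.occ ∧ (W.mid E S S' j).cost = W.cost ∧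
      (W.mid E S S' j).oc = W.oc ∧ (W.mid E S S' j).nc = W.nc := by
  unfold Walk.mid Walk.clip Walk.jump
  split_ifs <;> simp

variable {E : Env} {S S' : ℕ → ℕ} {g : ℕ} {occ : ℕ → ℕ}

theorem walk_nc (J : ℕ) :
    (walk E S S' g occ J).nc = horner (E.n + 2) S' (walkPos E S S' g occ) J := by
  induction J with
  | zero => rfl
  | succ J ih =>
    simp only [horner, ← ih, walk, Walk.step, Walk.visit_proj, Walk.codeOld_proj, walkPos]
    unfold Walk.codeNew
    split_ifs <;> simp only [Walk.mid_proj]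

theorem walk_oc (J : ℕ) :
    (walk E S S' g occ J).oc = horner (E.n + 2) S (walkPos E S S' g occ) J := by
  induction J with
  | zero => rfl
  | succ J ih =>
    simp only [horner, ← ih, walk, Walk.step, Walk.visit_proj, walkPos]
    unfold Walk.codeOld
    split_ifs <;> simp only [Walk.codeNew_proj, Walk.mid_proj]

theorem walkPos_le (j : ℕ) : walkPos E S S' g occ j ≤ E.n := by
  simp only [walkPos, Walk.mid, Walk.clip]
  split_ifs
  · exact Nat.zero_le _
  · omega

theorem walk_t_le (J : ℕ) : (walk E S S' g occ J).t ≤ J := by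
  induction J with
  | zero => exact le_rfl
  | succ J ih =>
    simp only [walk, Walk.step]
    unfold Walk.visit
    split_ifs <;> simp only [Walk.codeNew_proj, Walk.codeOld_proj, Walk.mid_proj] <;> omega

theorem walk_cost_le (J : ℕ) : (walk E S S' g occ J).cost ≤ J := by
  induction J with
  | zero => exact le_rfl
  | succ J ih =>
    simp only [walk, Walk.step]
    unfold Walk.visit
    split_ifs <;> simp only [Walk.codeNew_proj, Walk.codeOld_proj, Walk.mid_proj] <;> omega

theorem walk_succ_pos (J : ℕ) : (walk E S S' g occ (J + 1)).pos =
    if S J < S' J then walkPos E S S' g occ J + (if E.n < E.pat J then g % (E.n + 2) else 1)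
    else walkPos E S S' g occ J := by
  simp only [walk, walkPos, Walk.step]
  unfold Walk.visit
  split_ifs <;> simp only [Walk.codeNew_proj, Walk.codeOld_proj]

theorem walk_ok_succ (J : ℕ) : (walk E S S' g occ (J + 1)).ok =
    if E.n < ((walk E S S' g occ J).jump E.n S S' J).pos then 0 else (walk E S S' g occ J).ok := by
  simp only [walk, Walk.step, Walk.visit_proj, Walk.codeOld_proj, Walk.codeNew_proj]
  unfold Walk.mid Walk.clip Walk.jump
  split_ifs <;> rfl

theorem walk_ok_le (J : ℕ) : (walk E S S' g occ J).ok ≤ 1 := by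
  induction J with
  | zero => exact le_rfl
  | succ J ih =>
    rw [walk_ok_succ]
    split_ifs
    · exact Nat.zero_le _
    · exact ih

/-- For arbitrary `f`, because the recorded starts enter three sums: the errors of the image, the
total length, and the number of occurrences that overrun the word. -/
theorem walk_sum_occ (f : ℕ → ℕ) (J : ℕ) :
    ∑ s ∈ Finset.range (walk E S S' g occ J).t, f ((walk E S S' g occ J).occ s) =
    ∑ j ∈ Finset.range J, if S j < S' j ∧ E.n < E.pat j then f (walkPos E S S' g occ j) else 0 := by
  induction J with
  | zero => simp [walk]
  | succ J ih =>
    rw [Finset.sum_range_succ, ← ih]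
    simp only [walk, Walk.step]
    unfold Walk.visit
    by_cases hc : S J < S' J
    · by_cases hv : E.n < E.pat J
      · rw [if_pos hc, if_pos hv, if_pos ⟨hc, hv⟩]
        simp only [Walk.codeNew_proj, Walk.codeOld_proj, Walk.mid_proj]
        rw [Finset.sum_range_succ, Function.update_self]
        congr 1
        refine Finset.sum_congr rfl fun s hs => ?_
        rw [Function.update_of_ne (Finset.mem_range.1 hs).ne]
      · have hcv : ¬ (S J < S' J ∧ E.n < E.pat J) := fun h => hv h.2
        rw [if_pos hc, if_neg hv, if_neg hcv]
        simp only [Walk.codeNew_proj, Walk.codeOld_proj, Walk.mid_proj, add_zero]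
    · rw [if_neg hc, if_neg (fun h => hc h.1)]
      simp only [Walk.codeNew_proj, Walk.codeOld_proj, Walk.mid_proj, add_zero]

theorem walk_cost (J : ℕ) : (walk E S S' g occ J).cost = ∑ j ∈ Finset.range J,
    if S j < S' j ∧ ¬ E.n < E.pat j then
      (if E.inp (walkPos E S S' g occ j) ≠ E.pat j then 1 else 0) else 0 := by
  induction J with
  | zero => simp [walk]
  | succ J ih =>
    rw [Finset.sum_range_succ, ← ih]
    simp only [walk, Walk.step]
    unfold Walk.visit
    by_cases hc : S J < S' J
    · by_cases hv : E.n < E.pat J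
      · have hcv : ¬ (S J < S' J ∧ ¬ E.n < E.pat J) := fun h => h.2 hv
        rw [if_pos hc, if_pos hv, if_neg hcv]
        simp only [Walk.codeNew_proj, Walk.codeOld_proj, Walk.mid_proj, add_zero]
      · have hcv : S J < S' J ∧ ¬ E.n < E.pat J := ⟨hc, hv⟩
        rw [if_pos hc, if_neg hv]
        simp only [Walk.codeNew_proj, Walk.codeOld_proj, Walk.mid_proj, walkPos]
        simp only [hc, hv, not_false_eq_true, and_self, if_true]
        congr
    · rw [if_neg hc, if_neg (fun h => hc h.1)]
      simp only [Walk.codeNew_proj, Walk.codeOld_proj, Walk.mid_proj, add_zero]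

theorem walk_ok_antitone {J J' : ℕ} (hJ : J ≤ J') (h : (walk E S S' g occ J').ok = 1) :
    (walk E S S' g occ J).ok = 1 := by
  induction J', hJ using Nat.le_induction with
  | base => exact h
  | succ J' _ ih =>
    rw [walk_ok_succ] at h
    split_ifs at h
    exact ih h

/-- Along a valid walk the images of newly covered positions are placed one after the other. -/
theorem walkPos_succ {J : ℕ} (hok : (walk E S S' g occ J).ok = 1) {j : ℕ} (hj : j + 1 < J)
    (hS : S j = 0) (hS' : S' j = 1) (hle : ∀ j, S' j ≤ 1) :
    walkPos E S S' g occ (j + 1) =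
      walkPos E S S' g occ j + (if E.n < E.pat j then g % (E.n + 2) else 1) := by
  have h1 := walk_ok_antitone (J := j + 2) hj hok
  rw [walk_ok_succ] at h1
  have hnj : ¬ Jumps S S' (j + 1) := by
    have := hle (j + 1)
    simp only [Jumps, prev_succ]
    omega
  have h2 := walk_succ_pos (E := E) (S := S) (S' := S') (g := g) (occ := occ) j
  rw [if_pos (by omega)] at h2
  rw [← h2, walkPos, Walk.mid, Walk.clip]
  simp only [Walk.jump, if_neg hnj] at h1 ⊢
  split_ifs at h1 ⊢ with h3
  rfl

end Walk

end PatternMatching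

/-! ### Soundness and completeness of the guessed walks -/

namespace PatternMatching

/-- `b` extends the assignment of variables to pattern positions to the positions of terminals. -/
structure Env.Owner (E : Env) (b : ℕ → ℕ) : Prop where
  le : E.m ≤ E.n
  pat : ∀ j < E.m, E.n < E.pat j → b j = E.pat j
  out : ∀ j, E.m ≤ j → b j = 0

/-- A set of pattern positions that is a union of classes of `b`. -/
structure Env.Closed (E : Env) (b S : ℕ → ℕ) : Prop where
  le : ∀ j, S j ≤ 1
  congr : ∀ j j', b j = b j' → S j = S j'
  out : ∀ j, E.m ≤ j → S j = 0

/-- The mismatches of the word `u` at position `p`. -/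
def Env.wordErr (E : Env) (L : ℕ) (u : ℕ → ℕ) (p : ℕ) : ℕ :=
  ∑ o ∈ Finset.range L, if E.inp (p + o) ≠ u o then 1 else 0

theorem Env.Closed.mark {E : Env} {b S : ℕ → ℕ} {x : ℕ} (hb : E.Owner b) (hS : E.Closed b S)
    (hx : x ≠ 0) : E.Closed b (mark b S x) where
  le := mark_le hS.le
  congr j j' h := by simp only [PatternMatching.mark, h, hS.congr j j' h]
  out j hj := by
    simp only [PatternMatching.mark, hb.out j hj, if_neg hx.symm, hS.out j hj]

theorem mark_new {b S : ℕ → ℕ} {x j : ℕ} (h : S j < mark b S x j) : b j = x := by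
  by_contra hb
  simp [mark, hb] at h

/-- At the start of a block, `P j` is at most the end `P (j + 1)` of a covered letter; at the end of
a block it is itself such an end. -/
theorem Env.Feas.le_of_toggle {E : Env} {b S L P : ℕ → ℕ} (hS : E.Closed b S) (h : E.Feas S L P)
    {j : ℕ} (hj : S j ≠ prev S j) : P j ≤ E.n := by
  have h1 := hS.le j
  have h2 := prev_le hS.le j
  rcases Nat.lt_or_gt_of_ne hj with h3 | h3
  · cases j with
    | zero => simp [prev] at h3
    | succ j =>
      rw [prev_succ] at h3 h2
      exact (h j (by omega)).2
  · obtain ⟨h4, h5⟩ := h j (by omega)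
    omega

/-- A placement of `S` and a walk with the same old code can be glued, since by `horner_inj` they
agree at the starts and ends of the blocks of `S`. Inside these blocks the old placement is kept, at
the new positions the walk decides. The image `u` is left free, so that a best one can be inserted
later. -/
theorem walk_sound {E : Env} {b S : ℕ → ℕ} {x g : ℕ} {occ : ℕ → ℕ} (hb : E.Owner b)
    (hS : E.Closed b S) (hx : x ≠ 0)
    (hok : (walk E S (mark b S x) g occ (E.n + 2)).ok = 1) {L P : ℕ → ℕ} {h : ℕ → ℕ → ℕ}
    (hF : E.Feas S L P)
    (hoc : (walk E S (mark b S x) g occ (E.n + 2)).oc = horner (E.n + 2) S P (E.n + 2))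
    (u : ℕ → ℕ) :
    ∃ L' h' P', E.Feas (mark b S x) L' P' ∧
      horner (E.n + 2) (mark b S x) P' (E.n + 2) =
        (walk E S (mark b S x) g occ (E.n + 2)).nc ∧
      E.costOn (mark b S x) L' h' P' = E.costOn S L h P +
        ((walk E S (mark b S x) g occ (E.n + 2)).cost +
        ∑ s ∈ Finset.range (walk E S (mark b S x) g occ (E.n + 2)).t,
          E.wordErr (g % (E.n + 2)) u ((walk E S (mark b S x) g occ (E.n + 2)).occ s)) := by
  have hS' := hS.mark hb hx
  have hmn := hb.le
  have hle := le_mark (b := b) (x := x) hS.le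
  have hnew := @mark_new b S x
  set S' := mark b S x with hS'def
  set L₀ := g % (E.n + 2) with hL₀
  set pt := walkPos E S S' g occ with hpt
  rw [walk_oc] at hoc
  have heq : ∀ j < E.n + 2, S j ≠ prev S j → pt j = P j :=
    horner_inj (fun j _ _ => Nat.lt_succ_of_le ((walkPos_le j).trans (Nat.le_succ _)))
      (fun j _ hj => by have := hF.le_of_toggle hS hj; omega) hoc
  -- the new placement
  obtain ⟨L', h', hold, hnewx⟩ : ∃ L' : ℕ → ℕ, ∃ h' : ℕ → ℕ → ℕ,
      (∀ j < E.m, S j = 1 → E.n < E.pat j → L' (E.pat j) = L (E.pat j) ∧ h' (E.pat j) = h (E.pat j)) ∧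
      (∀ j < E.m, S j < S' j → E.n < E.pat j → L' (E.pat j) = L₀ ∧ h' (E.pat j) = u) := by
    -- If `x` is covered already, no position is new, and its length and image must stay as they
    -- are.
    by_cases hex : ∃ j < E.m, S j = 1 ∧ b j = x
    · obtain ⟨j₀, hj₀, h1, h2⟩ := hex
      refine ⟨L, h, fun _ _ _ _ => ⟨rfl, rfl⟩, fun j hj hlt hv => ?_⟩
      have := hS.congr j j₀ ((hnew hlt).trans h2.symm)
      have := hS'.le j
      omega
    · push Not at hex
      refine ⟨Function.update L x L₀, Function.update h x u, fun j hj h1 hv => ?_,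
        fun j hj hlt hv => ?_⟩
      · have : E.pat j ≠ x := by
          rw [← hb.pat j hj hv]
          exact hex j hj h1
        simp [this]
      · have : E.pat j = x := by
          rw [← hb.pat j hj hv]
          exact hnew hlt
        simp [this]
  -- The end of an old block belongs to the old placement too, hence the clause on `prev S j`.
  let P' : ℕ → ℕ := fun j => if S j = 1 ∨ prev S j = 1 then P j else pt j
  have hP'new : ∀ j, S j < S' j → P' j = pt j := by
    intro j hj
    have h1 := hS'.le j
    simp only [P']
    split_ifs with h2
    · have hjm : j < E.m := by
        by_contra hjm
        have := hS'.out j (by omega)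
        omega
      exact (heq j (by omega) (by omega)).symm
    · rfl
  have hP'old : ∀ j, S j = 1 → P' j = P j := fun j hj => if_pos (Or.inl hj)
  have hP'old' : ∀ j, S j = 1 → P' (j + 1) = P (j + 1) := fun j hj => if_pos (Or.inr hj)
  refine ⟨L', h', P', ?_, ?_, ?_⟩
  · intro j hj
    have hjm : j < E.m := by
      by_contra hjm
      have := hS'.out j (by omega)
      omega
    have hlej := hS.le j
    by_cases h1 : S j = 1
    · rw [hP'old j h1, hP'old' j h1]
      obtain ⟨h2, h3⟩ := hF j h1
      refine ⟨?_, h3⟩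
      rw [h2]
      congr 1
      unfold Env.len
      split_ifs with hv
      · exact (hold j hjm h1 hv).1.symm
      · rfl
    · have hlt : S j < S' j := by omega
      have h2 := walkPos_succ hok (j := j) (by omega) (by omega) hj hS'.le
      have h3 : P' (j + 1) = pt (j + 1) := by
        simp only [P']
        split_ifs with h4
        · rw [prev_succ] at h4
          exact (heq (j + 1) (by omega) (by rw [prev_succ]; omega)).symm
        · rfl
      rw [hP'new j hlt, h3]
      refine ⟨?_, walkPos_le _⟩
      rw [hpt, h2]
      congr 1
      unfold Env.len
      split_ifs with hv
      · exact (hnewx j hjm hlt hv).1.symm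
      · rfl
  · rw [walk_nc]
    refine horner_congr fun j hj htog => ?_
    simp only [P']
    split_ifs with h2
    · refine (heq j hj ?_).symm
      have h3 := hle j
      have h4 := hS'.le j
      have h5 := hS.le j
      have h6 := prev_le hS.le j
      have h7 : prev S j ≤ prev S' j := by
        cases j
        · exact le_rfl
        · exact hle _
      have h8 := prev_le hS'.le j
      omega
    · rfl
  · rw [walk_cost, walk_sum_occ, ← Finset.sum_add_distrib]
    -- Positions from `m` on are never covered; the walk goes to `n + 2` only because loop limits
    -- have a fixed form.
    have hext : ∀ f : ℕ → ℕ, (∀ j, E.m ≤ j → f j = 0) →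
        ∑ j ∈ Finset.range (E.n + 2), f j = ∑ j ∈ Finset.range E.m, f j := by
      intro f hf
      symm
      refine Finset.sum_subset (Finset.range_subset_range.2 (by omega)) fun j _ hj => ?_
      exact hf j (by simpa using hj)
    rw [hext, Env.costOn, Env.costOn, ← Finset.sum_add_distrib]
    · refine Finset.sum_congr rfl fun j hj => ?_
      have hjm := Finset.mem_range.1 hj
      have h4 := hS'.le j
      have h5 := hS.le j
      have h6 := hle j
      by_cases h1 : S j = 1
      · have h7 : S' j = 1 := by omega
        have h8 : ¬ S j < S' j := by omega
        simp only [h1, h7, lt_irrefl, false_and, if_false, if_true, add_zero]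
        rw [hP'old j h1]
        unfold Env.err
        split_ifs with hv
        · rw [(hold j hjm h1 hv).1, (hold j hjm h1 hv).2]
        · rfl
        · rfl
      · by_cases h7 : S' j = 1
        · have h8 : S j < S' j := by omega
          rw [if_pos h7, if_neg h1, hP'new j h8, zero_add]
          unfold Env.err
          by_cases hv : E.n < E.pat j
          · rw [if_pos hv, if_neg (fun h => h.2 hv), if_pos ⟨h8, hv⟩, zero_add,
              (hnewx j hjm h8 hv).1, (hnewx j hjm h8 hv).2]
            rfl
          · have hc1 : S j < S' j ∧ ¬ E.n < E.pat j := ⟨h8, hv⟩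
            have hc2 : ¬ (S j < S' j ∧ E.n < E.pat j) := fun h => hv h.2
            rw [if_neg hv, if_pos hc1, if_neg hc2, add_zero]
        · have h8 : ¬ S j < S' j := by omega
          rw [if_neg h7, if_neg h1, if_neg (fun h => h8 h.1), if_neg (fun h => h8 h.1), add_zero]
    · intro j hj
      have h8 : ¬ S j < S' j := by
        rw [hS'.out j hj]
        omega
      rw [if_neg (fun h => h8 h.1), if_neg (fun h => h8 h.1)]

/-- The guess whose digits are the positions `P j` where the walk jumps, for the last `r`
boundaries. -/
def guessFor (N : ℕ) (S S' P : ℕ → ℕ) : ℕ → ℕ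
  | 0 => 0
  | r + 1 => if Jumps S S' (N - (r + 1)) then P (N - (r + 1)) + N * guessFor N S S' P r
      else guessFor N S S' P r

theorem guessFor_lt {N : ℕ} {S S' P : ℕ → ℕ} (hP : ∀ j < N, Jumps S S' j → P j < N) {r : ℕ}
    (hr : r ≤ N) : guessFor N S S' P r <
      N ^ (∑ j ∈ Finset.Ico (N - r) N, ((S' j - prev S' j) + (prev S j - S j))) := by
  induction r with
  | zero => simp [guessFor]
  | succ r ih =>
    have ih := ih (by omega)
    rw [← Finset.sum_Ico_consecutive _ (show N - (r + 1) ≤ N - r by omega) (by omega),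
      show N - r = N - (r + 1) + 1 by omega, Nat.Ico_succ_singleton, Finset.sum_singleton, pow_add]
    rw [show N - r = N - (r + 1) + 1 by omega] at ih
    simp only [guessFor]
    split_ifs with h
    · have h1 := hP _ (by omega) h
      refine lt_of_lt_of_le ?_ (Nat.mul_le_mul_right _ (Nat.pow_le_pow_right (by omega) h))
      simp only [Nat.succ_eq_add_one, zero_add, pow_one]
      nlinarith
    · exact ih.trans_le (Nat.le_mul_of_pos_left _ (Nat.pow_pos (by omega)))

theorem Env.Full.le {E : Env} {L P : ℕ → ℕ} (h : E.Full L P) {j : ℕ} (hj : j ≤ E.m) :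
    P j ≤ E.n := by
  rw [← h.last]
  induction hj using Nat.decreasingInduction with
  | self => exact le_rfl
  | of_succ j hj ih =>
    have := h.succ j hj
    omega

theorem Env.Full.sum_len {E : Env} {L P : ℕ → ℕ} (h : E.Full L P) :
    ∑ j ∈ Finset.range E.m, E.len L j = E.n := by
  rw [← h.last]
  suffices ∀ J ≤ E.m, ∑ j ∈ Finset.range J, E.len L j = P J from this _ le_rfl
  intro J hJ
  induction J with
  | zero => simp [h.zero]
  | succ J ih => rw [Finset.sum_range_succ, ih (by omega), h.succ J (by omega)]

/-- Every complete placement is traced by a guess: take as digits the length of the image of `x` and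
the positions `P j` at the jumps. One guess serves all `occ`, as the initial content of that array
is irrelevant. -/
theorem walk_complete {E : Env} {b S : ℕ → ℕ} {x k : ℕ} (hb : E.Owner b)
    (hS : E.Closed b S) (hx : x ≠ 0) (htS : togCount S (E.n + 2) ≤ 2 * k)
    (htS' : togCount (mark b S x) (E.n + 2) ≤ 2 * k) {L P : ℕ → ℕ} (hF : E.Full L P)
    (h : ℕ → ℕ → ℕ) :
    ∃ g < (E.n + 2) ^ (2 * k + 1), ∀ occ,
      (walk E S (mark b S x) g occ (E.n + 2)).ok = 1 ∧
      (walk E S (mark b S x) g occ (E.n + 2)).oc = horner (E.n + 2) S P (E.n + 2) ∧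
      (walk E S (mark b S x) g occ (E.n + 2)).nc = horner (E.n + 2) (mark b S x) P (E.n + 2) ∧
      (walk E S (mark b S x) g occ (E.n + 2)).t * (g % (E.n + 2)) ≤ E.n ∧
      E.costOn (mark b S x) L h P = E.costOn S L h P +
        ((walk E S (mark b S x) g occ (E.n + 2)).cost +
        ∑ s ∈ Finset.range (walk E S (mark b S x) g occ (E.n + 2)).t,
          E.wordErr (g % (E.n + 2)) (h x) ((walk E S (mark b S x) g occ (E.n + 2)).occ s)) := by
  have hS' := hS.mark hb hx
  have hmn := hb.le
  have hle := le_mark (b := b) (x := x) hS.le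
  have hnew := @mark_new b S x
  set S' := mark b S x with hS'def
  set N := E.n + 2 with hN
  have hjump : ∀ j, Jumps S S' j → j ≤ E.m := by
    intro j hj
    by_contra hjm
    obtain ⟨j, rfl⟩ : ∃ j', j = j' + 1 := ⟨j - 1, by omega⟩
    simp only [Jumps, prev_succ] at hj
    have := hS'.out (j + 1) (by omega)
    have := hS.out j (by omega)
    omega
  -- If `L x` exceeds `n`, no newly covered letter is the variable `x`, and any digit will do.
  set L₀ := if L x ≤ E.n then L x else 0 with hL₀
  have hL₀lt : L₀ < N := by
    simp only [hL₀]
    split_ifs <;> omega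
  have hnewm : ∀ j, S j < S' j → j < E.m := by
    intro j hj
    by_contra hjm
    have := hS'.out j (by omega)
    omega
  have hlen : ∀ j, S j < S' j → E.n < E.pat j → L (E.pat j) = L₀ ∧ E.pat j = x := by
    intro j hj hv
    have hjm := hnewm j hj
    have h1 : E.pat j = x := by
      rw [← hb.pat j hjm hv]
      exact hnew hj
    have h2 := hF.succ j hjm
    have h3 := hF.le (j := j + 1) (by omega)
    rw [Env.len, if_pos hv, h1] at h2
    rw [h1, hL₀, if_pos (by omega)]
    exact ⟨rfl, rfl⟩
  have hg := guessFor_lt (N := N) (S := S) (S' := S') (P := P) (r := N)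
    (fun j _ hj => by have := hF.le (hjump j hj); omega) le_rfl
  set g₁ := guessFor N S S' P N with hg₁
  -- Starts of blocks of `S'` and ends of blocks of `S` are each half of the changes of their set,
  -- so at most `k`.
  have hcount : ∑ j ∈ Finset.Ico (N - N) N, ((S' j - prev S' j) + (prev S j - S j)) ≤ 2 * k := by
    rw [Nat.sub_self, ← Finset.range_eq_Ico, Finset.sum_add_distrib]
    have h1 := togCount_eq hS.le N
    have h2 := togCount_eq hS'.le N
    have h3 := startCount_eq S N
    have h4 := startCount_eq S' N
    have h5 : prev S N = 0 := by
      rw [hN, prev_succ]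
      exact hS.out _ (by omega)
    have h6 : prev S' N = 0 := by
      rw [hN, prev_succ]
      exact hS'.out _ (by omega)
    simp only [startCount, endCount] at *
    omega
  have hg' : g₁ < N ^ (2 * k) := hg.trans_le (Nat.pow_le_pow_right (by omega) hcount)
  have e1 : (L₀ + N * g₁) % N = L₀ := by
    rw [Nat.add_mul_mod_self_left, Nat.mod_eq_of_lt hL₀lt]
  have e2 : (L₀ + N * g₁) / N = g₁ := by
    rw [Nat.add_mul_div_left _ _ (by omega), Nat.div_eq_of_lt hL₀lt, zero_add]
  refine ⟨L₀ + N * g₁, ?_, fun occ => ?_⟩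
  · rw [pow_succ]
    nlinarith
  set W := walk E S S' (L₀ + N * g₁) occ with hW
  set pt := walkPos E S S' (L₀ + N * g₁) occ with hpt
  -- the walk follows `P`
  have key : ∀ j ≤ N, (W j).guess = guessFor N S S' P (N - j) ∧ (W j).ok = 1 ∧
      (W j).pos ≤ E.n ∧ (prev S j < prev S' j → (W j).pos = P j) ∧
      ∀ j' < j, (S j' ≠ prev S j' ∨ S' j' ≠ prev S' j' ∨ S j' < S' j') → pt j' = P j' := by
    intro j hj
    induction j with
    | zero => exact ⟨e2, rfl, Nat.zero_le _, fun h => by simp [prev] at h, fun _ h => by omega⟩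
    | succ j ih =>
      obtain ⟨i1, i2, i3, i4, i5⟩ := ih (by omega)
      have hr : N - j = (N - (j + 1)) + 1 := by omega
      have hj' : N - ((N - (j + 1)) + 1) = j := by omega
      rw [hr, guessFor, hj'] at i1
      have hmid : ((W j).jump E.n S S' j).pos ≤ E.n ∧
          ((W j).jump E.n S S' j).guess = guessFor N S S' P (N - (j + 1)) ∧
          ((S j ≠ prev S j ∨ S' j ≠ prev S' j ∨ S j < S' j) →
            ((W j).jump E.n S S' j).pos = P j) := by
        unfold Walk.jump
        split_ifs with hc
        · rw [if_pos hc] at i1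
          have hPj := hF.le (hjump j hc)
          have hPlt : P j < N := by omega
          have f1 : (W j).guess % (E.n + 2) = P j := by
            rw [i1, ← hN, Nat.add_mul_mod_self_left, Nat.mod_eq_of_lt hPlt]
          have f2 : (W j).guess / (E.n + 2) = guessFor N S S' P (N - (j + 1)) := by
            rw [i1, ← hN, Nat.add_mul_div_left _ _ (by omega), Nat.div_eq_of_lt hPlt, zero_add]
          exact ⟨by simp only [f1]; exact hPj, f2, fun _ => f1⟩
        -- Without a jump, a boundary that matters comes right after a newly covered letter, so the
        -- walk already stands at `P j`.
        · rw [if_neg hc] at i1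
          refine ⟨i3, i1, fun ht => i4 ?_⟩
          have a1 := hS.le j
          have a2 := hS'.le j
          have a3 := prev_le hS.le j
          have a4 := prev_le hS'.le j
          have a5 := hle j
          have a6 : prev S j ≤ prev S' j := by
            cases j
            · exact le_rfl
            · exact hle _
          simp only [Jumps] at hc
          omega
      obtain ⟨m1, m2, m3⟩ := hmid
      have hptj : pt j = ((W j).jump E.n S S' j).pos := by
        rw [hpt, walkPos, Walk.mid, Walk.clip, if_neg (by rw [← hW]; omega)]
      have hokj : (W (j + 1)).ok = 1 := by
        rw [hW, walk_ok_succ, if_neg (by rw [← hW]; omega), ← hW, i2]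
      have hgj : (W (j + 1)).guess = ((W j).jump E.n S S' j).guess := by
        simp only [hW, walk, Walk.step, Walk.visit_proj, Walk.codeOld_proj, Walk.codeNew_proj]
        unfold Walk.mid Walk.clip
        split_ifs <;> rfl
      have hpos : (W (j + 1)).pos = if S j < S' j then P (j + 1) else pt j := by
        rw [hW, walk_succ_pos, ← hpt]
        by_cases hlt : S j < S' j
        · rw [if_pos hlt, if_pos hlt, hptj, m3 (Or.inr (Or.inr hlt)), hF.succ j (hnewm j hlt),
            Env.len, ← hN, e1]
          by_cases hv : E.n < E.pat j
          · rw [if_pos hv, if_pos hv, (hlen j hlt hv).1]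
          · rw [if_neg hv, if_neg hv]
        · rw [if_neg hlt, if_neg hlt]
      refine ⟨hgj.trans m2, hokj, ?_, fun hlt => ?_, fun j' hlt' ht => ?_⟩
      · rw [hpos]
        split_ifs with hlt
        · exact hF.le (hnewm j hlt)
        · omega
      · rw [prev_succ, prev_succ] at hlt
        rw [hpos, if_pos hlt]
      · rcases Nat.lt_succ_iff_lt_or_eq.1 hlt' with h1 | rfl
        · exact i5 j' h1 ht
        · exact hptj.trans (m3 ht)
  obtain ⟨-, k2, -, -, k5⟩ := key N le_rfl
  refine ⟨k2, ?_, ?_, ?_, ?_⟩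
  · rw [hW, walk_oc]
    exact horner_congr fun j hj ht => k5 j hj (Or.inl ht)
  · rw [hW, walk_nc]
    exact horner_congr fun j hj ht => k5 j hj (Or.inr (Or.inl ht))
  -- The new occurrences of `x` contribute `t` times their length to the sum of all lengths, which
  -- is `n`.
  · rw [e1]
    have h1 := walk_sum_occ (E := E) (S := S) (S' := S') (g := L₀ + N * g₁) (occ := occ)
      (fun _ => L₀) N
    rw [Finset.sum_const, Finset.card_range, smul_eq_mul, ← hW] at h1
    rw [h1]
    have : ∑ j ∈ Finset.range N, (if S j < S' j ∧ E.n < E.pat j then L₀ else 0) =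
        ∑ j ∈ Finset.range E.m, (if S j < S' j ∧ E.n < E.pat j then L₀ else 0) := by
      symm
      refine Finset.sum_subset (Finset.range_subset_range.2 (by omega)) fun j _ hj => ?_
      rw [if_neg]
      rintro ⟨h2, -⟩
      exact hj (Finset.mem_range.2 (hnewm j h2))
    rw [this]
    refine (Finset.sum_le_sum fun j _ => ?_).trans hF.sum_len.le
    split_ifs with hc
    · rw [Env.len, if_pos hc.2, (hlen j hc.1 hc.2).1]
    · exact Nat.zero_le _
  · rw [hW, walk_cost, walk_sum_occ, ← Finset.sum_add_distrib]
    have : ∀ f : ℕ → ℕ, (∀ j, E.m ≤ j → f j = 0) →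
        ∑ j ∈ Finset.range N, f j = ∑ j ∈ Finset.range E.m, f j := by
      intro f hf
      symm
      refine Finset.sum_subset (Finset.range_subset_range.2 (by omega)) fun j _ hj => ?_
      exact hf j (by simpa using hj)
    rw [this, Env.costOn, Env.costOn, ← Finset.sum_add_distrib]
    · refine Finset.sum_congr rfl fun j hj => ?_
      have hjm := Finset.mem_range.1 hj
      have h4 := hS'.le j
      have h5 := hS.le j
      have h6 := hle j
      by_cases h8 : S j < S' j
      · have hp := k5 j (by omega) (Or.inr (Or.inr h8))
        rw [if_pos (show S' j = 1 by omega), if_neg (show ¬ S j = 1 by omega), zero_add]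
        rw [hpt] at hp
        unfold Env.err
        by_cases hv : E.n < E.pat j
        · rw [if_pos hv, if_neg (fun h => h.2 hv), if_pos ⟨h8, hv⟩, zero_add, hp,
            (hlen j h8 hv).2, ← (hlen j h8 hv).2, (hlen j h8 hv).1, e1]
          rfl
        · have hc1 : S j < S' j ∧ ¬ E.n < E.pat j := ⟨h8, hv⟩
          have hc2 : ¬ (S j < S' j ∧ E.n < E.pat j) := fun h => hv h.2
          rw [if_neg hv, if_pos hc1, if_neg hc2, add_zero, hp]
      · have h9 : S j = S' j := by omega
        have hc1 : ¬ (S j < S' j ∧ ¬ E.n < E.pat j) := fun h => h8 h.1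
        have hc2 : ¬ (S j < S' j ∧ E.n < E.pat j) := fun h => h8 h.1
        rw [if_neg hc1, if_neg hc2, h9, add_zero, add_zero]
    · intro j hj
      have h8 : ¬ S j < S' j := fun h => by
        have := hnewm j h
        omega
      rw [if_neg (fun h => h8 h.1), if_neg (fun h => h8 h.1)]

end PatternMatching

namespace PatternMatching

/-! ## The Hamming distance of a pattern in terms of codes -/

section Lists

/-- The mismatches between `u` and the factor of `w` that starts at position `p`. -/
def misAt {A : Type} [DecidableEq A] (u w : List A) (p : ℕ) : ℕ :=
  ∑ i ∈ Finset.range u.length, if u[i]? ≠ w[p + i]? then 1 else 0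

theorem mismatches_eq {A : Type} [DecidableEq A] (u w : List A) : mismatches u w = misAt u w 0 := by
  simp [mismatches, misAt, Finset.card_filter]

theorem misAt_append {A : Type} [DecidableEq A] (u v w : List A) (p : ℕ) :
    misAt (u ++ v) w p = misAt u w p + misAt v w (p + u.length) := by
  simp only [misAt, List.length_append, Finset.sum_range_add]
  congr 1
  · refine Finset.sum_congr rfl fun i hi => ?_
    rw [List.getElem?_append_left (Finset.mem_range.1 hi)]
  · refine Finset.sum_congr rfl fun i _ => ?_
    rw [List.getElem?_append_right (by omega), Nat.add_sub_cancel_left, add_assoc]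

def letterImage {A X : Type} (h : X → List A) : A ⊕ X → List A := Sum.elim (fun a => [a]) h

theorem Pattern.subst_cons {A X : Type} (h : X → List A) (a : A ⊕ X) (α : Pattern A X) :
    Pattern.subst h (a :: α) = letterImage h a ++ Pattern.subst h α := rfl

theorem Pattern.length_subst_take_succ {A X : Type} (h : X → List A) (α : Pattern A X) {j : ℕ}
    (hj : j < α.length) :
    (Pattern.subst h (α.take (j + 1))).length =
      (Pattern.subst h (α.take j)).length + (letterImage h α[j]).length := by
  rw [List.take_succ_eq_append_getElem hj, Pattern.subst, List.flatMap_append, List.length_append]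
  simp [Pattern.subst, letterImage]

theorem misAt_subst {A X : Type} [DecidableEq A] (h : X → List A) (w : List A) (α : Pattern A X) (p : ℕ) :
    misAt (α.subst h) w p = ∑ j : Fin α.length,
      misAt (letterImage h α[j]) w (p + (Pattern.subst h (α.take j)).length) := by
  induction α generalizing p with
  | nil => simp [misAt, Pattern.subst]
  | cons a α ih =>
    rw [Pattern.subst_cons, misAt_append, ih]
    simp only [List.length_cons]
    rw [Fin.sum_univ_succ]
    congr 1
    refine Finset.sum_congr rfl fun j _ => ?_
    simp [Pattern.subst_cons, add_assoc]

end Lists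

theorem indicator_le_indicator {p q : Prop} [Decidable p] [Decidable q] (h : p → q) :
    (if p then 1 else 0) ≤ if q then 1 else 0 := by
  by_cases hp : p
  · rw [if_pos hp, if_pos (h hp)]
  · rw [if_neg hp]
    exact Nat.zero_le _

def Env.total (E : Env) (L : ℕ → ℕ) (h : ℕ → ℕ → ℕ) (P : ℕ → ℕ) : ℕ :=
  ∑ j ∈ Finset.range E.m, E.err L h j (P j)

theorem Input.inp_word (I : Input) (c : ℕ) {p : ℕ} (hp : p < I.n) :
    (I.env c).inp p = (I.word[p]'(by rw [I.word_length]; exact hp)).val + 1 := by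
  have h1 : p < I.word.length := by rw [I.word_length]; exact hp
  simp [Input.env, Input.code, List.getElem?_append, h1]

theorem Input.pat_eq (I : Input) (c : ℕ) {j : ℕ} (hj : j < I.m) :
    (I.env c).pat j = Sum.elim (fun a => a.val + 1) (fun x => I.n + 1 + x.val)
      (I.pattern[j]'hj) := by
  have h1 : j < I.pattern.length := hj
  simp [Env.pat, Input.env, Input.code, List.getElem?_append, I.word_length, h1]
  rfl

/-- A substitution gives lengths and images on the codes of variables, with `P j` the length of the
image of the first `j` letters. Conversely, images are sequences of arbitrary numbers here, and
decoding them to letters can only remove mismatches. -/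
theorem Input.dist_le_iff (I : Input) (c d : ℕ) :
    I.pattern.dist I.word ≤ d ↔
      ∃ L h P, (I.env c).Full L P ∧ (I.env c).total L h P ≤ d := by
  set E := I.env c with hE
  have hEn : E.n = I.n := rfl
  have hEm : E.m = I.m := rfl
  have hword : ∀ {p : ℕ}, p < I.n → ∀ a : Fin I.σ, (E.inp p = a.val + 1 ↔ some a = I.word[p]?) := by
    intro p hp a
    have h1 : p < I.word.length := by rw [I.word_length]; exact hp
    rw [I.inp_word c hp, List.getElem?_eq_getElem h1, Option.some_inj, Fin.ext_iff]
    omega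
  have h1 : I.pattern.dist I.word ≤ d ↔ ∃ h : Fin I.n → List (Fin I.σ),
      (I.pattern.subst h).length = I.word.length ∧ misAt (I.pattern.subst h) I.word 0 ≤ d := by
    -- The strict form lets `iInf_lt_iff` produce a substitution.
    have h2 : I.pattern.dist I.word ≤ d ↔ I.pattern.dist I.word < (d : ℕ∞) + 1 := by
      rw [ENat.lt_add_one_iff (ENat.natCast_ne_top d)]
    rw [h2, Pattern.dist, iInf_lt_iff]
    simp only [ENat.lt_add_one_iff (ENat.natCast_ne_top d), Nat.cast_le, mismatches_eq, Subtype.exists,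
      exists_prop]
  rw [h1]
  have hmpos := I.m_pos
  have hmn := I.m_le
  have hσn := I.alphabet_le
  have hσ : 0 < I.σ := by
    have h0 : 0 < I.word.length := by rw [I.word_length]; omega
    exact (I.word[0]).pos
  have hsum : ∀ h : Fin I.n → List (Fin I.σ), misAt (I.pattern.subst h) I.word 0 =
      ∑ j : Fin I.m, misAt (letterImage h (I.pattern[j]'j.2)) I.word
        (Pattern.subst h (I.pattern.take j)).length := by
    intro h
    rw [misAt_subst]
    simp only [zero_add]
    rfl
  constructor
  · rintro ⟨h, hlen, hmis⟩
    let hX : ℕ → List (Fin I.σ) := fun v =>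
      if hv : v - (I.n + 1) < I.n then h ⟨v - (I.n + 1), hv⟩ else []
    have hXx : ∀ x : Fin I.n, hX (I.n + 1 + x) = h x := by
      intro x
      have : I.n + 1 + (x : ℕ) - (I.n + 1) < I.n := by omega
      simp only [hX, dif_pos this]
      congr
      omega
    let hh : ℕ → ℕ → ℕ := fun v o => ((hX v)[o]?).elim 0 (fun a => a.val + 1)
    let P : ℕ → ℕ := fun j => (Pattern.subst h (I.pattern.take j)).length
    have hP : ∀ j < I.m, P (j + 1) = P j + E.len (fun v => (hX v).length) j := by
      intro j hj
      simp only [P]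
      rw [Pattern.length_subst_take_succ h _ hj, Env.len, I.pat_eq c hj, hEn]
      rcases I.pattern[j] with a | x
      · have : ¬ I.n < a.val + 1 := by omega
        simp [letterImage, this]
      · have : I.n < I.n + 1 + x.val := by omega
        simp [letterImage, this, hXx]
    have hfull : E.Full (fun v => (hX v).length) P := by
      refine ⟨by simp [P, Pattern.subst], ?_, hP⟩
      simp only [P, hEm]
      have hall : I.pattern.take I.m = I.pattern := List.take_length
      rw [hall, hlen, I.word_length]
      rfl
    refine ⟨fun v => (hX v).length, hh, P, hfull, ?_⟩
    refine le_trans (le_of_eq ?_) hmis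
    rw [hsum, Env.total, Finset.sum_range]
    refine Finset.sum_congr rfl fun j _ => ?_
    have hle := hfull.le (j := j + 1) j.2
    rw [hP j j.2, hEn] at hle
    rw [Env.len, I.pat_eq c j.2, hEn] at hle
    rw [Env.err, I.pat_eq c j.2, hEn]
    change _ = misAt _ _ (P j)
    rcases hj : I.pattern[j.val]'j.2 with a | x
    · rw [hj] at hle
      have h3 : ¬ I.n < a.val + 1 := by omega
      simp only [Sum.elim_inl, h3, if_false] at hle ⊢
      simp only [misAt, letterImage, Sum.elim_inl, List.length_singleton, Finset.sum_range_one]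
      refine if_congr (not_congr ?_) rfl rfl
      rw [hword (by omega) a]
      simp
    · rw [hj] at hle
      have h3 : I.n < I.n + 1 + x.val := by omega
      simp only [Sum.elim_inr, h3, if_true, hXx] at hle ⊢
      simp only [misAt, letterImage, Sum.elim_inr]
      refine Finset.sum_congr rfl fun o ho => ?_
      have ho' := Finset.mem_range.1 ho
      simp only [hh, hXx, List.getElem?_eq_getElem ho', Option.elim_some]
      exact if_congr (not_congr (hword (by omega) _)) rfl rfl
  · rintro ⟨L, hh, P, hfull, htot⟩
    -- A number that encodes no letter is decoded to the letter `0`; as a number it mismatched every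
    -- letter of the word anyway.
    let dec : ℕ → Fin I.σ := fun v => if hv : v - 1 < I.σ then ⟨v - 1, hv⟩ else ⟨0, hσ⟩
    have hdec : ∀ a : Fin I.σ, dec (a.val + 1) = a := by
      intro a
      have : a.val + 1 - 1 < I.σ := by omega
      simp only [dec, dif_pos this]
      rfl
    let h : Fin I.n → List (Fin I.σ) := fun x =>
      (List.range (L (I.n + 1 + x))).map fun o => dec (hh (I.n + 1 + x) o)
    have hP : ∀ j ≤ I.m, (Pattern.subst h (I.pattern.take j)).length = P j := by
      intro j hj
      induction j with
      | zero => simp [Pattern.subst, hfull.zero]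
      | succ j ih =>
        rw [Pattern.length_subst_take_succ h _ hj, ih (by omega), hfull.succ j hj, Env.len,
          I.pat_eq c hj, hEn]
        rcases I.pattern[j] with a | x
        · have : ¬ I.n < a.val + 1 := by omega
          simp [letterImage, this]
        · have : I.n < I.n + 1 + x.val := by omega
          simp [letterImage, this, h]
    refine ⟨h, ?_, ?_⟩
    · have := hP I.m le_rfl
      rw [Input.m, List.take_length] at this
      rw [this, I.word_length]
      exact hfull.last
    · refine le_trans ?_ htot
      rw [hsum, Env.total, Finset.sum_range]
      refine Finset.sum_le_sum fun j _ => ?_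
      have hle := hfull.le (j := j + 1) j.2
      rw [hfull.succ j j.2, Env.len, I.pat_eq c j.2, hEn] at hle
      rw [Env.err, I.pat_eq c j.2, hEn, hP j j.2.le]
      rcases hj : I.pattern[j.val]'j.2 with a | x
      · rw [hj] at hle
        have h3 : ¬ I.n < a.val + 1 := by omega
        simp only [Sum.elim_inl, h3, if_false] at hle ⊢
        simp only [misAt, letterImage, Sum.elim_inl, List.length_singleton,
          Finset.sum_range_one]
        refine le_of_eq (if_congr (not_congr ?_) rfl rfl)
        rw [hword (by omega) a]
        simp
      · rw [hj] at hle
        have h3 : I.n < I.n + 1 + x.val := by omega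
        simp only [Sum.elim_inr, h3, if_true] at hle ⊢
        simp only [misAt, letterImage, Sum.elim_inr, h, List.length_map, List.length_range]
        refine Finset.sum_le_sum fun o ho => ?_
        have ho' := Finset.mem_range.1 ho
        have h5 : P j + o < I.word.length := by rw [I.word_length]; omega
        have h6 := I.inp_word c (p := P j + o) (by omega)
        refine indicator_le_indicator fun h7 h8 => h7 ?_
        rw [← hE, h8] at h6
        rw [List.getElem?_eq_getElem h5]
        simp [ho', h6, hdec]

end PatternMatching

namespace PatternMatching

/-! ## Locality in terms of pattern positions -/

/-- The first variable at the positions below `j`, or `1`. -/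
def Env.firstVar (E : Env) : ℕ → ℕ
  | 0 => 1
  | j + 1 => if E.firstVar j < 2 then (if E.n < E.pat j then E.pat j else E.firstVar j)
      else E.firstVar j

/-- The last variable at the positions below `j`, or else the first variable, or `1`. -/
def Env.lastVar (E : Env) : ℕ → ℕ
  | 0 => E.firstVar E.m
  | j + 1 => if E.n < E.pat j then E.pat j else E.lastVar j

/-- With terminals attached to variables in this way, a set of variables covers at most as many
blocks of pattern positions as it marks blocks of the skeleton. Without variables the only owner is
`1`, which is no code of a variable; `0` is reserved for positions outside the pattern. -/
def Env.owner (E : Env) (j : ℕ) : ℕ := if j < E.m then E.lastVar (j + 1) else 0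

theorem Env.one_le_firstVar (E : Env) (j : ℕ) : 1 ≤ E.firstVar j := by
  induction j with
  | zero => exact le_rfl
  | succ j ih =>
    simp only [Env.firstVar]
    split_ifs <;> omega

theorem Env.one_le_lastVar (E : Env) (j : ℕ) : 1 ≤ E.lastVar j := by
  induction j with
  | zero => exact E.one_le_firstVar _
  | succ j ih =>
    simp only [Env.lastVar]
    split_ifs <;> omega

theorem Env.owner_ne_zero (E : Env) {j : ℕ} (hj : j < E.m) : E.owner j ≠ 0 := by
  have := E.one_le_lastVar (j + 1)
  rw [Env.owner, if_pos hj]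
  omega

theorem Env.owner_isOwner (E : Env) (h : E.m ≤ E.n) : E.Owner E.owner where
  le := h
  pat j hj hv := by rw [Env.owner, if_pos hj, Env.lastVar, if_pos hv]
  out j hj := if_neg (by omega)

theorem cover_closed {E : Env} {b : ℕ → ℕ} (hb : E.Owner b) {ord : ℕ → ℕ}
    {i : ℕ} (hord : ∀ i' < i, ord i' ≠ 0) : E.Closed b (cover b ord i) := by
  induction i with
  | zero => exact ⟨fun _ => Nat.zero_le _, fun _ _ _ => rfl, fun _ _ => rfl⟩
  | succ i ih => exact (ih fun i' h => hord i' (by omega)).mark hb (hord i (by omega))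

/-- The number of variables at positions below `j`. -/
def Input.varsBelow (I : Input) (j : ℕ) : ℕ := (Pattern.skeleton (I.pattern.take j)).length

section Local

variable (I : Input) (c : ℕ)

theorem skeleton_take_succ {A X : Type} (α : Pattern A X) {j : ℕ} (hj : j < α.length) :
    Pattern.skeleton (α.take (j + 1)) =
      Pattern.skeleton (α.take j) ++ (Sum.getRight? α[j]).toList := by
  rw [List.take_succ_eq_append_getElem hj, Pattern.skeleton, List.filterMap_append]
  rcases α[j] with a | x <;> rfl

theorem skeleton_take_prefix {A X : Type} (α : Pattern A X) (j : ℕ) :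
    Pattern.skeleton (α.take j) <+: α.skeleton :=
  (List.take_prefix j α).filterMap _

theorem Input.varsBelow_succ_inl {j : ℕ} (hj : j < I.m) {a : Fin I.σ}
    (h : I.pattern[j]'hj = Sum.inl a) : I.varsBelow (j + 1) = I.varsBelow j := by
  simp [Input.varsBelow, skeleton_take_succ I.pattern hj, h]

theorem Input.varsBelow_succ_inr {j : ℕ} (hj : j < I.m) {x : Fin I.n}
    (h : I.pattern[j]'hj = Sum.inr x) : I.varsBelow (j + 1) = I.varsBelow j + 1 ∧
      I.pattern.skeleton[I.varsBelow j]? = some x := by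
  have h1 := skeleton_take_succ I.pattern hj
  rw [h] at h1
  refine ⟨by simp [Input.varsBelow, h1], ?_⟩
  obtain ⟨l, hl⟩ := skeleton_take_prefix I.pattern (j + 1)
  rw [← hl, h1]
  simp [Input.varsBelow]

theorem Input.varsBelow_succ_le {j : ℕ} (hj : j < I.m) : I.varsBelow j ≤ I.varsBelow (j + 1) ∧
    I.varsBelow (j + 1) ≤ I.varsBelow j + 1 := by
  rcases h : I.pattern[j]'hj with a | x
  · rw [I.varsBelow_succ_inl hj h]
    omega
  · rw [(I.varsBelow_succ_inr hj h).1]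
    omega

theorem Input.firstVar_eq {j : ℕ} (hj : j ≤ I.m) :
    (I.varsBelow j = 0 ∧ (I.env c).firstVar j = 1) ∨
    (0 < I.varsBelow j ∧ ∃ x, I.pattern.skeleton[0]? = some x ∧
      (I.env c).firstVar j = I.n + 1 + x.val) := by
  induction j with
  | zero => exact Or.inl ⟨by simp [Input.varsBelow, Pattern.skeleton], rfl⟩
  | succ j ih =>
    have hσ := I.alphabet_le
    have hn : (I.env c).n = I.n := rfl
    have hpos := I.m_pos
    have hmn := I.m_le
    simp only [Env.firstVar, I.pat_eq c hj]
    rcases h : I.pattern[j]'hj with a | x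
    · rw [I.varsBelow_succ_inl hj h]
      have h2 : ¬ (I.env c).n < a.val + 1 := by omega
      rw [Sum.elim_inl, if_neg h2, ite_self]
      exact ih (by omega)
    · obtain ⟨h1, h2⟩ := I.varsBelow_succ_inr hj h
      right
      refine ⟨by omega, ?_⟩
      rw [Sum.elim_inr]
      rcases ih (by omega) with ⟨h3, h4⟩ | ⟨h3, y, h4, h5⟩
      · rw [h4, if_pos (by omega), if_pos (by omega)]
        exact ⟨x, by rw [← h2, h3], rfl⟩
      · rw [h5, if_neg (by omega)]
        exact ⟨y, h4, rfl⟩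

/-- The truncated subtraction is intended: before the first variable it gives the index `0`, that of
the variable which owns the leading terminals. -/
theorem Input.lastVar_eq (hv : I.pattern.skeleton ≠ []) {j : ℕ} (hj : j ≤ I.m) :
    ∃ x, I.pattern.skeleton[I.varsBelow j - 1]? = some x ∧
      (I.env c).lastVar j = I.n + 1 + x.val := by
  induction j with
  | zero =>
    have h0 : I.varsBelow 0 - 1 = 0 := by simp [Input.varsBelow, Pattern.skeleton]
    rw [h0]
    rcases I.firstVar_eq c (le_refl I.m) with ⟨h1, -⟩ | ⟨-, h1⟩
    · have hall : I.pattern.take I.m = I.pattern := List.take_length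
      rw [Input.varsBelow, hall, List.length_eq_zero_iff] at h1
      exact absurd h1 hv
    · exact h1
  | succ j ih =>
    have hσ := I.alphabet_le
    have hn : (I.env c).n = I.n := rfl
    simp only [Env.lastVar, I.pat_eq c hj]
    rcases h : I.pattern[j]'hj with a | x
    · rw [I.varsBelow_succ_inl hj h, Sum.elim_inl, if_neg (by omega)]
      exact ih (by omega)
    · obtain ⟨h1, h2⟩ := I.varsBelow_succ_inr hj h
      rw [Sum.elim_inr, if_pos (by omega), h1, Nat.add_sub_cancel]
      exact ⟨x, h2, rfl⟩

/-- The block of marked positions that starts at an unmarked boundary. -/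
theorem exists_block {X : Type} (v M : List X) {u : ℕ} (hu : IsMarked v M u)
    (h : u = 0 ∨ ¬ IsMarked v M (u - 1)) : ∃ b, (u, b) ∈ markedBlocks v M := by
  classical
  have hex : ∃ b, u < b ∧ ¬ IsMarked v M b := by
    refine ⟨u + v.length + 1, by omega, ?_⟩
    rintro ⟨x, -, hx⟩
    rw [List.getElem?_eq_none (by omega)] at hx
    simp at hx
  have hb := Nat.find_spec hex
  have hmin := @Nat.find_min _ _ hex
  set b := Nat.find hex
  have hmk : ∀ j, u ≤ j → j < b → IsMarked v M j := by
    intro j h1 h2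
    rcases h1.eq_or_lt with rfl | h1
    · exact hu
    · by_contra h3
      exact hmin h2 ⟨h1, h3⟩
  refine ⟨b, hb.1, ?_, hmk, h, hb.2⟩
  obtain ⟨x, -, hx⟩ := hmk (b - 1) (by omega) (by omega)
  have := (List.getElem?_eq_some_iff.1 hx).1
  simp only
  omega

theorem startCount_eq_card {S : ℕ → ℕ} (hS : ∀ j, S j ≤ 1) (J : ℕ) :
    startCount S J = ((Finset.range J).filter fun j => S j = 1 ∧ prev S j = 0).card := by
  rw [startCount, Finset.card_filter]
  refine Finset.sum_congr rfl fun j _ => ?_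
  have := hS j
  have := prev_le hS j
  split_ifs <;> omega

/-- Nothing is covered at the end, so each block that starts also ends. -/
theorem togCount_of_closed {E : Env} {b S : ℕ → ℕ} (hS : E.Closed b S) (hE : E.m ≤ E.n) :
    togCount S (E.n + 2) = 2 * startCount S (E.n + 2) := by
  have h1 := togCount_eq hS.le (E.n + 2)
  have h2 := startCount_eq S (E.n + 2)
  rw [prev_succ, hS.out _ (by omega)] at h2
  omega

/-- The number of blocks of pattern positions whose owner is marked. -/
theorem Input.startCount_le {S : ℕ → ℕ} (hS : ∀ j, S j ≤ 1) {k : ℕ} {M : List (Fin I.n)}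
    (hM : ∀ j, S j = 1 ↔ j < I.m ∧ IsMarked I.pattern.skeleton M (I.varsBelow (j + 1) - 1))
    (hk : (markedBlocks I.pattern.skeleton M).encard ≤ k) (J : ℕ) : startCount S J ≤ k := by
  classical
  rw [startCount_eq_card hS]
  set F := (Finset.range J).filter fun j => S j = 1 ∧ prev S j = 0 with hF
  -- The index in the skeleton of the occurrence that owns the position `j`.
  let e : ℕ → ℕ := fun j => I.varsBelow (j + 1) - 1
  have hmono : ∀ j < I.m, ∀ j' ≤ j, I.varsBelow (j' + 1) ≤ I.varsBelow (j + 1) := by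
    intro j hj j' hj'
    induction j, hj' using Nat.le_induction with
    | base => exact le_rfl
    | succ j _ ih => exact (ih (by omega)).trans (I.varsBelow_succ_le hj).1
  have h0 : I.varsBelow 0 = 0 := by simp [Input.varsBelow, Pattern.skeleton]
  -- At the start of a covered block the owner changes. This happens only at an occurrence of a
  -- variable, so the index rises by exactly one, and the preceding occurrence is unmarked.
  have hstep : ∀ j ∈ F, ∀ j', j = j' + 1 → e j = e j' + 1 := by
    rintro j hj j' rfl
    rw [hF, Finset.mem_filter, prev_succ] at hj
    obtain ⟨-, h1, h2⟩ := hj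
    obtain ⟨h3, h4⟩ := (hM _).1 h1
    have h5 : ¬ IsMarked I.pattern.skeleton M (e j') := fun h =>
      absurd ((hM j').2 ⟨by omega, h⟩) (by omega)
    have h6 : e (j' + 1) ≠ e j' := fun h => h5 (by rw [← h]; exact h4)
    have := I.varsBelow_succ_le h3
    simp only [e] at h6 ⊢
    omega
  have hblock : ∀ j ∈ F, ∃ b, (e j, b) ∈ markedBlocks I.pattern.skeleton M := by
    intro j hj
    have hj' := hj
    rw [hF, Finset.mem_filter] at hj
    obtain ⟨-, h1, h2⟩ := hj
    obtain ⟨h3, h4⟩ := (hM j).1 h1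
    refine exists_block _ _ h4 ?_
    cases j with
    | zero =>
      left
      have := (I.varsBelow_succ_le h3).2
      change I.varsBelow (0 + 1) - 1 = 0
      omega
    | succ j =>
      right
      rw [hstep _ hj' j rfl, Nat.add_sub_cancel]
      intro h
      rw [prev_succ] at h2
      exact absurd ((hM j).2 ⟨by omega, h⟩) (by omega)
  choose! f hf using hblock
  -- Distinct starts have distinct indices, since `e` never decreases and rises at each start other
  -- than position `0`.
  have hinj : Set.InjOn (fun j => (e j, f j)) F := by
    have hlt : ∀ j ∈ F, ∀ j' ∈ F, j < j' → e j < e j' := by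
      intro j hj j' hj' h
      obtain ⟨i, rfl⟩ : ∃ i, j' = i + 1 := ⟨j' - 1, by omega⟩
      rw [hstep _ hj' i rfl]
      rw [hF, Finset.mem_filter] at hj'
      have := ((hM _).1 hj'.2.1).1
      have := hmono i (by omega) j (by omega)
      simp only [e]
      omega
    intro j hj j' hj' h
    have h1 : e j = e j' := congrArg Prod.fst h
    rcases lt_trichotomy j j' with h2 | h2 | h2
    · exact absurd (hlt j hj j' hj' h2) (by omega)
    · exact h2
    · exact absurd (hlt j' hj' j hj h2) (by omega)
  have := Set.encard_le_encard_of_injOn (s := (F : Set ℕ))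
    (t := markedBlocks I.pattern.skeleton M) (fun j hj => hf j hj) hinj
  rw [Set.encard_coe_eq_coe_finsetCard] at this
  exact_mod_cast this.trans hk

/-- A local pattern has an order in which its positions can be covered with few blocks. -/
theorem Input.exists_order {k : ℕ} (hk : 1 ≤ k) (h : I.pattern.IsLocal k) :
    ∃ ord : ℕ → ℕ, (∀ i, ∃ y < I.m, ord i = (I.env c).owner y) ∧
      (∀ i, togCount (cover (I.env c).owner ord i) (I.n + 2) ≤ 2 * k) ∧
      ∀ j < I.m, cover (I.env c).owner ord I.m j = 1 := by
  set E := I.env c with hE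
  have hb := E.owner_isOwner I.m_le
  have hpos := I.m_pos
  have hmn := I.m_le
  -- Without variables the whole pattern is a single block owned by `1`; this is where `1 ≤ k` is
  -- needed.
  by_cases hv : I.pattern.skeleton = []
  · have hall : ∀ j < I.m, E.owner j = 1 := by
      have hvb : ∀ j, I.varsBelow j = 0 := by
        intro j
        have := (skeleton_take_prefix I.pattern j).length_le
        rw [hv, List.length_nil] at this
        exact Nat.le_zero.1 this
      have hfirst : E.firstVar I.m = 1 := by
        rcases I.firstVar_eq c (le_refl I.m) with ⟨-, h1⟩ | ⟨h1, -⟩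
        · exact h1
        · rw [hvb] at h1
          omega
      have hlast : ∀ j ≤ I.m, E.lastVar j = 1 := by
        intro j hj
        induction j with
        | zero => exact hfirst
        | succ j ih =>
          rw [Env.lastVar, hE, I.pat_eq c hj]
          rcases h1 : I.pattern[j]'hj with a | x
          · have := I.alphabet_le
            have hn : (I.env c).n = I.n := rfl
            rw [Sum.elim_inl, if_neg (by omega)]
            exact ih (by omega)
          · have h2 := (I.varsBelow_succ_inr hj h1).1
            rw [hvb, hvb] at h2
            omega
      intro j hj
      rw [Env.owner, if_pos (show j < E.m from hj)]
      exact hlast _ hj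
    refine ⟨fun _ => 1, fun _ => ⟨0, hpos, (hall 0 hpos).symm⟩, fun i => ?_, fun j hj => ?_⟩
    · have hcl := cover_closed hb (ord := fun _ => 1) (i := i) (fun _ _ => one_ne_zero)
      have h1 := togCount_of_closed hcl I.m_le
      have h2 : E.n = I.n := rfl
      rw [h2] at h1
      rw [h1]
      suffices startCount (cover E.owner (fun _ => 1) i) (I.n + 2) ≤ 1 by omega
      rw [startCount_eq_card hcl.le]
      refine (Finset.card_le_card (t := {0}) fun j hj => ?_).trans (by simp)
      rw [Finset.mem_filter] at hj
      obtain ⟨-, h3, h4⟩ := hj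
      cases j with
      | zero => simp
      | succ j =>
        exfalso
        have hjm : j + 1 < I.m := by
          by_contra hjm
          have := hcl.out (j + 1) (not_lt.1 hjm)
          omega
        rw [prev_succ, hcl.congr j (j + 1) (by rw [hall j (by omega), hall _ hjm])] at h4
        omega
    · rw [cover_eq_one_iff]
      exact ⟨0, hpos, hall j hj⟩
  · obtain ⟨s, ⟨hnd, hmem⟩, hloc⟩ := h
    have hs : 0 < s.length := by
      obtain ⟨x, hx⟩ := List.exists_mem_of_ne_nil _ hv
      exact List.length_pos_of_mem ((hmem x).2 hx)
    have hsm : s.length ≤ I.m := by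
      have h1 := (hnd.subperm fun x hx => (hmem x).1 hx).length_le
      exact h1.trans (List.length_filterMap_le _ _)
    have hidx : ∀ i, min i (s.length - 1) < s.length := fun i => by omega
    -- There are always `m` stages, so the last variable is repeated; marking it again changes
    -- nothing.
    let ord : ℕ → ℕ := fun i => I.n + 1 + (s[min i (s.length - 1)]'(hidx i)).val
    have howner : ∀ j < I.m, ∃ x, I.pattern.skeleton[I.varsBelow (j + 1) - 1]? = some x ∧
        E.owner j = I.n + 1 + x.val := by
      intro j hj
      rw [Env.owner, if_pos (show j < E.m from hj)]
      exact I.lastVar_eq c hv hj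
    have hord : ∀ i, ord i ≠ 0 := fun i => by simp only [ord]; omega
    have htake : ∀ i (x : Fin I.n), (∃ i' < i, I.n + 1 + x.val = ord i') ↔ x ∈ s.take i := by
      intro i x
      rw [List.mem_take_iff_getElem]
      constructor
      · rintro ⟨i', h1, h2⟩
        refine ⟨min i' (s.length - 1), by have := hidx i'; omega, ?_⟩
        apply Fin.ext
        simp only [ord] at h2
        omega
      · rintro ⟨i', h1, rfl⟩
        refine ⟨i', by omega, ?_⟩
        simp only [ord]
        congr 3
        omega
    have hcover : ∀ i j, cover E.owner ord i j = 1 ↔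
        j < I.m ∧ IsMarked I.pattern.skeleton (s.take i) (I.varsBelow (j + 1) - 1) := by
      intro i j
      by_cases hj : j < I.m
      · obtain ⟨x, h1, h2⟩ := howner j hj
        rw [cover_eq_one_iff, h2, htake]
        simp [hj, IsMarked, h1]
      · have := (cover_closed hb (ord := ord) (i := i) fun i' _ => hord i').out j (not_lt.1 hj)
        simp [this, hj]
    refine ⟨ord, fun i => ?_, fun i => ?_, fun j hj => ?_⟩
    · have h1 : s[min i (s.length - 1)]'(hidx i) ∈ I.pattern.skeleton :=
        (hmem _).1 (List.getElem_mem _)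
      rw [Pattern.skeleton, List.mem_filterMap] at h1
      obtain ⟨a, h2, h3⟩ := h1
      obtain ⟨y, hy, rfl⟩ := List.getElem_of_mem h2
      rw [Sum.getRight?_eq_some_iff] at h3
      refine ⟨y, hy, ?_⟩
      have h4 := I.pat_eq c (j := y) hy
      have h5 : E.n = I.n := rfl
      rw [h3, Sum.elim_inr] at h4
      rw [hb.pat y hy (by rw [hE] at h5 ⊢; rw [h4]; omega), hE, h4]
    · have hcl := cover_closed hb (ord := ord) (i := i) fun i' _ => hord i'
      have h1 := togCount_of_closed hcl I.m_le
      have h2 : E.n = I.n := rfl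
      rw [h2] at h1
      rw [h1]
      rcases Nat.eq_zero_or_pos i with rfl | hi
      · have : startCount (cover E.owner ord 0) (I.n + 2) = 0 :=
          Finset.sum_eq_zero fun j _ => by simp [cover]
        omega
      · refine Nat.mul_le_mul_left _ (I.startCount_le hcl.le (hcover i) ?_ _)
        -- Locality speaks of `i ≤ s.length` only, and beyond that `s.take i` no longer changes.
        have h3 := hloc (min i s.length) (by omega) (by omega)
        rwa [show s.take (min i s.length) = s.take i by
          rw [List.take_eq_take_iff]
          omega] at h3
    · rw [hcover]
      obtain ⟨x, h1, -⟩ := howner j hj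
      refine ⟨hj, x, ?_, h1⟩
      rw [List.take_of_length_le hsm, hmem]
      exact List.mem_of_getElem? h1

end Local

end PatternMatching

namespace PatternMatching

/-! ## Rules for the structured language -/

abbrev vr (x : ℕ) : Exp := .var x
abbrev rd (r : Fin 16) (e : Exp) : Exp := .arr r e
abbrev ip (e : Exp) : Exp := .inp e

instance (k : ℕ) : OfNat Exp k := ⟨.const k⟩

section Eval

variable (E : Env) (s : St)

@[simp] theorem ev_zero : Exp.ev E s 0 = 0 := (rfl)
@[simp] theorem ev_one : Exp.ev E s 1 = 1 := (rfl)
@[simp] theorem ev_two : Exp.ev E s 2 = 2 := (rfl)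
@[simp] theorem ev_const (k : ℕ) : Exp.ev E s (.const k) = k := (rfl)
@[simp] theorem ev_n : Exp.ev E s .n = E.n := (rfl)
@[simp] theorem ev_m : Exp.ev E s .m = E.m := (rfl)
@[simp] theorem ev_base : Exp.ev E s .base = E.n + 2 := (rfl)
@[simp] theorem ev_var (x : ℕ) : Exp.ev E s (.var x) = s.v x := (rfl)
@[simp] theorem ev_arr (r : Fin 16) (e : Exp) : Exp.ev E s (.arr r e) = s.A r (e.ev E s) := (rfl)
@[simp] theorem ev_inp (e : Exp) : Exp.ev E s (.inp e) = E.inp (e.ev E s % (2 * E.n)) := (rfl)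
@[simp] theorem ev_add (e f : Exp) : Exp.ev E s (e + f) = (e.ev E s + f.ev E s) % E.M := (rfl)
@[simp] theorem ev_sub (e f : Exp) : Exp.ev E s (e - f) = e.ev E s - f.ev E s := (rfl)
@[simp] theorem ev_mul (e f : Exp) : Exp.ev E s (e * f) = (e.ev E s * f.ev E s) % E.M := (rfl)
@[simp] theorem ev_div (e f : Exp) : Exp.ev E s (e / f) = e.ev E s / f.ev E s := (rfl)
@[simp] theorem ev_mod (e f : Exp) : Exp.ev E s (e % f) = e.ev E s % f.ev E s := (rfl)

/-- The power of `n + 2` with exponent `r`. -/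
def basePow : ℕ → Exp
  | 0 => 1
  | r + 1 => basePow r * .base

theorem ev_basePow {r : ℕ} (h : (E.n + 2) ^ r < E.M) :
    (basePow r).ev E s = (E.n + 2) ^ r := by
  induction r with
  | zero => rfl
  | succ r ih =>
    have h1 : (E.n + 2) ^ r ≤ (E.n + 2) ^ (r + 1) := Nat.pow_le_pow_right (by omega) (by omega)
    rw [basePow, ev_mul, ih (by omega), ev_base, ← pow_succ, Nat.mod_eq_of_lt h]

def Cmd.whenEq (e f : Exp) (c : Cmd) : Cmd := .ite e f .skip (.ite f e .skip c)

def Cmd.whenNe (e f : Exp) (c : Cmd) : Cmd := .ite e f c (.when f e c)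

@[simp] theorem den_skip : Cmd.skip.den E s = s := (rfl)

@[simp] theorem den_assign (x : ℕ) (e : Exp) : (Cmd.assign x e).den E s = s.setV x (e.ev E s) := (rfl)

@[simp] theorem den_store (r : Fin 16) (e f : Exp) :
    (Cmd.store r e f).den E s = s.setA r (e.ev E s) (f.ev E s) := (rfl)

@[simp] theorem den_block_nil : (block []).den E s = s := (rfl)

@[simp] theorem den_block_cons (c : Cmd) (l : List Cmd) :
    (block (c :: l)).den E s = (block l).den E (c.den E s) := (rfl)

theorem den_ite (e f : Exp) (c d : Cmd) :
    (Cmd.ite e f c d).den E s = if e.ev E s < f.ev E s then c.den E s else d.den E s := (rfl)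

theorem den_when (e f : Exp) (c : Cmd) :
    (Cmd.when e f c).den E s = if e.ev E s < f.ev E s then c.den E s else s := (rfl)

theorem den_whenEq (e f : Exp) (c : Cmd) :
    (Cmd.whenEq e f c).den E s = if e.ev E s = f.ev E s then c.den E s else s := by
  simp only [Cmd.whenEq, den_ite, den_skip]
  split_ifs <;> first | rfl | omega

theorem den_whenNe (e f : Exp) (c : Cmd) :
    (Cmd.whenNe e f c).den E s = if e.ev E s ≠ f.ev E s then c.den E s else s := by
  simp only [Cmd.whenNe, den_ite, den_when]
  split_ifs <;> first | rfl | omega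

end Eval

theorem Cmd.loop_inv {E : Env} {x a b : ℕ} {c : Cmd} {s : St} (I : ℕ → St → Prop) (h0 : I 0 s)
    (h : ∀ j < E.lim a b, ∀ s, I j s → I (j + 1) (c.den E (s.setV x j))) :
    I (E.lim a b) ((Cmd.loop x a b c).den E s) :=
  iter_inv I h0 h

theorem Env.lim_m (E : Env) : E.lim 0 1 = E.m := by simp [Env.lim]

theorem Env.lim_pow (E : Env) (a : ℕ) : E.lim a 0 = (E.n + 2) ^ a := by simp [Env.lim]

theorem Env.lim_base (E : Env) : E.lim 1 0 = E.n + 2 := by simp [Env.lim]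

/-- The command may write the variable `x`. -/
def Cmd.wv (x : ℕ) : Cmd → Bool
  | .skip => false
  | .assign y _ => y == x
  | .store _ _ _ => false
  | .seq c d => c.wv x || d.wv x
  | .ite _ _ c d => c.wv x || d.wv x
  | .loop y _ _ c => y == x || c.wv x

/-- The command may write the array `r`. -/
def Cmd.wa (r : Fin 16) : Cmd → Bool
  | .skip => false
  | .assign _ _ => false
  | .store r' _ _ => r' == r
  | .seq c d => c.wa r || d.wa r
  | .ite _ _ c d => c.wa r || d.wa r
  | .loop _ _ _ c => c.wa r

/-- Frame rule. For a concrete command `wv` evaluates by computation, so most uses are closed by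
`rfl`. -/
theorem Cmd.den_v {E : Env} {x : ℕ} {c : Cmd} (h : c.wv x = false) (s : St) :
    (c.den E s).v x = s.v x := by
  induction c generalizing s with
  | skip => rfl
  | assign y e =>
    simp only [Cmd.wv, beq_eq_false_iff_ne] at h
    simp [h.symm]
  | store r e f => rfl
  | seq c d ihc ihd =>
    simp only [Cmd.wv, Bool.or_eq_false_iff] at h
    exact (ihd h.2 _).trans (ihc h.1 _)
  | ite e f c d ihc ihd =>
    simp only [Cmd.wv, Bool.or_eq_false_iff] at h
    simp only [Cmd.den]
    split_ifs
    · exact ihc h.1 _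
    · exact ihd h.2 _
  | loop y a b c ih =>
    simp only [Cmd.wv, Bool.or_eq_false_iff, beq_eq_false_iff_ne] at h
    exact Cmd.loop_inv (fun _ s' => s'.v x = s.v x) rfl fun j _ s' hs => by
      rw [ih h.2, St.setV_v, if_neg h.1.symm, hs]

theorem Cmd.den_A {E : Env} {r : Fin 16} {c : Cmd} (h : c.wa r = false) (s : St) :
    (c.den E s).A r = s.A r := by
  induction c generalizing s with
  | skip => rfl
  | assign y e => rfl
  | store r' e f =>
    simp only [Cmd.wa, beq_eq_false_iff_ne] at h
    simp [h.symm]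
  | seq c d ihc ihd =>
    simp only [Cmd.wa, Bool.or_eq_false_iff] at h
    exact (ihd h.2 _).trans (ihc h.1 _)
  | ite e f c d ihc ihd =>
    simp only [Cmd.wa, Bool.or_eq_false_iff] at h
    simp only [Cmd.den]
    split_ifs
    · exact ihc h.1 _
    · exact ihd h.2 _
  | loop y a b c ih =>
    simp only [Cmd.wa] at h
    exact Cmd.loop_inv (fun _ s' => s'.A r = s.A r) rfl fun j _ s' hs => by
      rw [ih h, St.setV_A, hs]

/-- The nested loops of the command multiply to at most `(n + 2) ^ a * m ^ b`. -/
def Cmd.Fits : ℕ → ℕ → Cmd → Prop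
  | _, _, .skip => True
  | _, _, .assign _ _ => True
  | _, _, .store _ _ _ => True
  | a, b, .seq c d => c.Fits a b ∧ d.Fits a b
  | a, b, .ite _ _ c d => c.Fits a b ∧ d.Fits a b
  | a, b, .loop _ a' b' c => a' ≤ a ∧ b' ≤ b ∧ c.Fits (a - a') (b - b')

/-- The product `(n + 2) ^ a * m ^ b` is at least `1`, so it absorbs the additive constants at every
node. -/
theorem Cmd.Fits.cost_le {c : Cmd} {a b : ℕ} (h : c.Fits a b) :
    ∃ C, ∀ n m, 1 ≤ m → c.cost n m ≤ C * ((n + 2) ^ a * m ^ b) := by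
  have hpos : ∀ n m a b : ℕ, 1 ≤ m → 1 ≤ (n + 2) ^ a * m ^ b := fun n m a b hm =>
    Nat.mul_pos (Nat.pow_pos (by omega)) (Nat.pow_pos hm)
  induction c generalizing a b with
  | skip => exact ⟨0, fun n m _ => by simp [Cmd.cost]⟩
  | assign x e => exact ⟨_, fun n m hm => Nat.le_mul_of_pos_right _ (hpos n m a b hm)⟩
  | store r e f => exact ⟨_, fun n m hm => Nat.le_mul_of_pos_right _ (hpos n m a b hm)⟩
  | seq c d ihc ihd =>
    obtain ⟨C, hC⟩ := ihc h.1
    obtain ⟨D, hD⟩ := ihd h.2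
    refine ⟨C + D, fun n m hm => ?_⟩
    rw [add_mul]
    exact Nat.add_le_add (hC n m hm) (hD n m hm)
  | ite e f c d ihc ihd =>
    obtain ⟨C, hC⟩ := ihc h.1
    obtain ⟨D, hD⟩ := ihd h.2
    refine ⟨(e.comp 0).length + (f.comp 1).length + 2 + C + D, fun n m hm => ?_⟩
    rw [add_mul, add_mul]
    exact Nat.add_le_add (Nat.add_le_add (Nat.le_mul_of_pos_right _ (hpos n m a b hm))
      (hC n m hm)) (hD n m hm)
  | loop x a' b' c ih =>
    obtain ⟨h1, h2, h3⟩ := h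
    obtain ⟨C, hC⟩ := ih h3
    refine ⟨a' + b' + 4 + (C + 5), fun n m hm => ?_⟩
    rw [add_mul]
    refine Nat.add_le_add (Nat.le_mul_of_pos_right _ (hpos n m a b hm)) ?_
    have h4 : c.cost n m + 5 ≤ (C + 5) * ((n + 2) ^ (a - a') * m ^ (b - b')) := by
      rw [add_mul]
      exact Nat.add_le_add (hC n m hm) (Nat.le_mul_of_pos_right _ (hpos n m _ _ hm))
    refine (Nat.mul_le_mul_left _ h4).trans (le_of_eq ?_)
    rw [← Nat.add_sub_of_le h1, ← Nat.add_sub_of_le h2, pow_add, pow_add]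
    simp only [Nat.add_sub_cancel_left]
    ring

end PatternMatching

namespace PatternMatching

/-! ## The walk as a program -/

/-- Take the position from the guess. -/
def takeDigit : Cmd := block [.assign 7 (vr 6 % .base), .assign 6 (vr 6 / .base)]

def jumpCmd : Cmd := .ite (vr 14) (vr 16) takeDigit (.when (vr 15) (vr 13) takeDigit)

def clipCmd : Cmd := .when .n (vr 7) (block [.assign 12 0, .assign 7 0])

def codeNewCmd : Cmd := .whenNe (vr 16) (vr 14) (.assign 9 (vr 9 * .base + vr 7))

def codeOldCmd : Cmd := .whenNe (vr 15) (vr 13) (.assign 8 (vr 8 * .base + vr 7))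

def visitCmd : Cmd :=
  .when (vr 15) (vr 16) (.ite .n (ip (.n + vr 3))
    (block [.store 7 (vr 11) (vr 7), .assign 11 (vr 11 + 1), .assign 7 (vr 7 + vr 5)])
    (block [.whenNe (ip (vr 7)) (ip (.n + vr 3)) (.assign 10 (vr 10 + 1)),
      .assign 7 (vr 7 + 1)]))

/-- Array `0` holds the owners, array `5` the covered set `S`, and variable `4` the new owner `x`;
`S'` is formed on the fly. -/
def readCmd : Cmd :=
  block [.assign 15 (rd 5 (vr 3)), .assign 16 (vr 15),
    .whenEq (rd 0 (vr 3)) (vr 4) (.assign 16 1)]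

def walkBody : Cmd :=
  block [readCmd, jumpCmd, clipCmd, codeNewCmd, codeOldCmd, visitCmd,
    .assign 13 (vr 15), .assign 14 (vr 16)]

def walkCmd : Cmd :=
  block [.assign 5 (vr 2 % .base), .assign 6 (vr 2 / .base), .assign 7 0, .assign 8 0, .assign 9 0,
    .assign 10 0, .assign 11 0, .assign 12 1, .assign 13 0, .assign 14 0, .loop 3 1 0 walkBody]

/-- The variables and the array of the walk have the values in `W`. -/
structure WalkRel (s : St) (W : Walk) : Prop where
  pos : s.v 7 = W.pos
  guess : s.v 6 = W.guess
  oc : s.v 8 = W.oc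
  nc : s.v 9 = W.nc
  cost : s.v 10 = W.cost
  t : s.v 11 = W.t
  ok : s.v 12 = W.ok
  occ : s.A 7 = W.occ

/-- The data that the pieces of a step, from `jumpCmd` to `visitCmd`, only read. -/
structure WalkCtx (L : ℕ) (S S' : ℕ → ℕ) (j : ℕ) (s : St) : Prop where
  step : s.v 3 = j
  length : s.v 5 = L
  ps : s.v 13 = prev S j
  pn : s.v 14 = prev S' j
  cs : s.v 15 = S j
  cn : s.v 16 = S' j

section Walk

variable {E : Env} {L : ℕ} {S S' : ℕ → ℕ} {j : ℕ} {s : St} {W : Walk}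

theorem WalkCtx.den {c : Cmd} (h : WalkCtx L S S' j s)
    (hc : c.wv 3 = false ∧ c.wv 5 = false ∧ c.wv 13 = false ∧ c.wv 14 = false ∧ c.wv 15 = false ∧
      c.wv 16 = false) : WalkCtx L S S' j (c.den E s) :=
  ⟨(Cmd.den_v hc.1 s).trans h.step, (Cmd.den_v hc.2.1 s).trans h.length,
    (Cmd.den_v hc.2.2.1 s).trans h.ps, (Cmd.den_v hc.2.2.2.1 s).trans h.pn,
    (Cmd.den_v hc.2.2.2.2.1 s).trans h.cs, (Cmd.den_v hc.2.2.2.2.2 s).trans h.cn⟩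

theorem WalkRel.takeDigit (h : WalkRel s W) :
    WalkRel (takeDigit.den E s)
      { W with pos := W.guess % (E.n + 2), guess := W.guess / (E.n + 2) } := by
  obtain ⟨h1, h2, h3, h4, h5, h6, h7, h8⟩ := h
  constructor <;> simp [PatternMatching.takeDigit, *]

theorem WalkRel.jump (h : WalkRel s W) (hc : WalkCtx L S S' j s) :
    WalkRel (jumpCmd.den E s) (W.jump E.n S S' j) := by
  simp only [jumpCmd, den_ite, den_when, ev_var, hc.ps, hc.pn, hc.cs, hc.cn, Walk.jump]
  by_cases hJ : Jumps S S' j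
  · rw [if_pos hJ]
    unfold Jumps at hJ
    split_ifs
    · exact h.takeDigit
    · exact h.takeDigit
    · omega
  · rw [if_neg hJ]
    unfold Jumps at hJ
    rw [if_neg (by omega), if_neg (by omega)]
    exact h

theorem WalkRel.clip (h : WalkRel s W) : WalkRel (clipCmd.den E s) (W.clip E.n) := by
  obtain ⟨h1, h2, h3, h4, h5, h6, h7, h8⟩ := h
  simp only [clipCmd, den_when, ev_var, ev_n, h1, Walk.clip]
  split_ifs
  · constructor <;> simp [*]
  · constructor <;> assumption

theorem WalkRel.codeNew (h : WalkRel s W) (hc : WalkCtx L S S' j s)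
    (hM : S' j ≠ prev S' j → W.nc * (E.n + 2) + W.pos < E.M) :
    WalkRel (codeNewCmd.den E s) (W.codeNew E.n S' j) := by
  obtain ⟨h1, h2, h3, h4, h5, h6, h7, h8⟩ := h
  simp only [codeNewCmd, den_whenNe, ev_var, hc.pn, hc.cn, Walk.codeNew]
  split_ifs with hne
  · have h9 := hM hne
    have h10 : W.nc * (E.n + 2) < E.M := by omega
    constructor <;> simp [*, Nat.mod_eq_of_lt h9, Nat.mod_eq_of_lt h10]
  · constructor <;> assumption

theorem WalkRel.codeOld (h : WalkRel s W) (hc : WalkCtx L S S' j s)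
    (hM : S j ≠ prev S j → W.oc * (E.n + 2) + W.pos < E.M) :
    WalkRel (codeOldCmd.den E s) (W.codeOld E.n S j) := by
  obtain ⟨h1, h2, h3, h4, h5, h6, h7, h8⟩ := h
  simp only [codeOldCmd, den_whenNe, ev_var, hc.ps, hc.cs, Walk.codeOld]
  split_ifs with hne
  · have h9 := hM hne
    have h10 : W.oc * (E.n + 2) < E.M := by omega
    constructor <;> simp [*, Nat.mod_eq_of_lt h9, Nat.mod_eq_of_lt h10]
  · constructor <;> assumption

theorem WalkRel.visit (h : WalkRel s W) (hc : WalkCtx L S S' j s) (hE : E.Ok)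
    (hj : S j < S' j → j < E.n) (hpos : W.pos ≤ E.n) (hL : L < E.n + 2) (ht : W.t ≤ j)
    (hcost : W.cost ≤ j) (hM : 2 * (E.n + 2) < E.M) :
    WalkRel (visitCmd.den E s) (W.visit E L S S' j) := by
  obtain ⟨h1, h2, h3, h4, h5, h6, h7, h8⟩ := h
  have hn := hE.pos
  by_cases h9 : S j < S' j
  · have hjn := hj h9
    have e1 : (E.n + j) % E.M = E.n + j := Nat.mod_eq_of_lt (by omega)
    have e2 : (E.n + j) % (2 * E.n) = E.n + j := Nat.mod_eq_of_lt (by omega)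
    have e3 : W.pos % (2 * E.n) = W.pos := Nat.mod_eq_of_lt (by omega)
    have e4 : (W.t + 1) % E.M = W.t + 1 := Nat.mod_eq_of_lt (by omega)
    have e5 : (W.pos + L) % E.M = W.pos + L := Nat.mod_eq_of_lt (by omega)
    have e6 : (W.pos + 1) % E.M = W.pos + 1 := Nat.mod_eq_of_lt (by omega)
    have e7 : (W.cost + 1) % E.M = W.cost + 1 := Nat.mod_eq_of_lt (by omega)
    have e8 : E.inp (E.n + j) = E.pat j := rfl
    simp only [visitCmd, den_when, den_ite, ev_var, ev_n, ev_inp, ev_add, hc.cs, hc.cn, hc.step, e1,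
      e2, e8, Walk.visit, if_pos h9]
    by_cases h10 : E.n < E.pat j
    · rw [if_pos h10, if_pos h10]
      constructor <;> simp [hc.length, *]
    · rw [if_neg h10, if_neg h10]
      simp only [den_block_cons, den_block_nil, den_whenNe, ev_inp, ev_add, ev_n, ev_var, h1, e3,
        hc.step, e1, e2, e8]
      by_cases h11 : E.inp W.pos = E.pat j
      · rw [if_neg (not_not.2 h11), if_neg (not_not.2 h11)]
        constructor <;> simp [*]
      · rw [if_pos h11, if_pos h11]
        constructor <;> simp [*]
  · simp only [visitCmd, den_when, ev_var, hc.cs, hc.cn, Walk.visit, if_neg h9]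
    constructor <;> assumption

end Walk

/-- The walk program computes the walk. -/
theorem walkCmd_spec {E : Env} (hE : E.Ok) {k : ℕ} (hM : (E.n + 2) ^ (2 * k + 2) < E.M)
    {b S : ℕ → ℕ} {x : ℕ} (hb : E.Owner b) (hS : E.Closed b S) (hx : x ≠ 0)
    (htS : togCount S (E.n + 2) ≤ 2 * k) (htS' : togCount (mark b S x) (E.n + 2) ≤ 2 * k)
    (s : St) (hB : s.A 0 = b) (hC : s.A 5 = S) (hsx : s.v 4 = x) :
    WalkRel (walkCmd.den E s) (walk E S (mark b S x) (s.v 2) (s.A 7) (E.n + 2)) ∧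
      (walkCmd.den E s).v 5 = s.v 2 % (E.n + 2) := by
  have hS' := hS.mark hb hx
  have hpow : ∀ t ≤ 2 * k, (E.n + 2) ^ t * (E.n + 2) < E.M := by
    intro t ht
    rw [← pow_succ]
    exact (Nat.pow_le_pow_right (by omega) (by omega)).trans_lt hM
  have hM2 : 2 * (E.n + 2) < E.M := by
    refine lt_of_le_of_lt ?_ hM
    rw [pow_add, pow_two]
    calc 2 * (E.n + 2) ≤ (E.n + 2) * (E.n + 2) := Nat.mul_le_mul_right _ (by omega)
      _ ≤ _ := Nat.le_mul_of_pos_left _ (Nat.pow_pos (by omega))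
  set S' := mark b S x with hS'def
  set g := s.v 2 with hg
  have hmn := hE.m
  have hstep : ∀ j, S j < S' j → j < E.n := by
    intro j hj
    by_contra hjm
    have := hS'.out j (by omega)
    omega
  let I : ℕ → St → Prop := fun j s' =>
    WalkRel s' (walk E S S' g (s.A 7) j) ∧ s'.v 5 = g % (E.n + 2) ∧ s'.v 13 = prev S j ∧
      s'.v 14 = prev S' j ∧ s'.A 0 = b ∧ s'.A 5 = S ∧ s'.v 4 = x
  have hI : I (E.n + 2) (walkCmd.den E s) := by
    simp only [walkCmd, den_block_cons, den_block_nil]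
    rw [← E.lim_base]
    refine Cmd.loop_inv I ?_ ?_
    · refine ⟨⟨?_, ?_, ?_, ?_, ?_, ?_, ?_, ?_⟩, ?_, ?_, ?_, ?_, ?_, ?_⟩ <;> simp [walk, prev, *]
    · rintro j hj s₀ ⟨h1, h2, h3, h4, h5, h6, h7⟩
      rw [E.lim_base] at hj
      simp only [walkBody, den_block_cons, den_block_nil]
      -- reading
      have hread : (readCmd.den E (s₀.setV 3 j)).v 15 = S j ∧
          (readCmd.den E (s₀.setV 3 j)).v 16 = S' j := by
        simp only [readCmd, den_block_cons, den_block_nil, den_whenEq, den_assign, ev_arr, ev_var,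
          St.setV_A, St.setV_v, h5, h6, h7, hS'def, mark, if_true, reduceIte,
          Nat.reduceEqDiff]
        split_ifs <;> simp
      have hrA : ∀ r, (readCmd.den E (s₀.setV 3 j)).A r = s₀.A r := fun r => by
        rw [Cmd.den_A (by rfl)]
        rfl
      have hrv : ∀ y, y ≠ 3 → y ≠ 15 → y ≠ 16 →
          (readCmd.den E (s₀.setV 3 j)).v y = s₀.v y := fun y hy1 hy2 hy3 => by
        rw [Cmd.den_v (by simp [readCmd, block, Cmd.wv, Cmd.whenEq, hy2.symm, hy3.symm])]
        simp [hy1]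
      let W := walk E S S' g (s.A 7) j
      have hW : W = walk E S S' g (s.A 7) j := rfl
      have w0 : WalkRel (readCmd.den E (s₀.setV 3 j)) W := by
        obtain ⟨a1, a2, a3, a4, a5, a6, a7, a8⟩ := h1
        constructor <;> simp [*]
      have c0 : WalkCtx (g % (E.n + 2)) S S' j (readCmd.den E (s₀.setV 3 j)) := by
        refine ⟨?_, ?_, ?_, ?_, hread.1, hread.2⟩
        · rw [Cmd.den_v (by rfl)]
          simp
        · rw [hrv _ (by omega) (by omega) (by omega), h2]
        · rw [hrv _ (by omega) (by omega) (by omega), h3]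
        · rw [hrv _ (by omega) (by omega) (by omega), h4]
      have w1 := w0.jump (E := E) c0
      have c1 := c0.den (E := E) (c := jumpCmd) (by decide)
      have w2 : WalkRel _ (W.mid E S S' j) := w1.clip (E := E)
      have c2 := c1.den (E := E) (c := clipCmd) (by decide)
      have hpos : (W.mid E S S' j).pos ≤ E.n := walkPos_le j
      -- With one more digit the code still has at most `2 * k` digits, hence it does not wrap
      -- around modulo `M`.
      have hdig : ∀ S₀ : ℕ → ℕ, togCount S₀ (E.n + 2) ≤ 2 * k → S₀ j ≠ prev S₀ j →
          horner (E.n + 2) S₀ (walkPos E S S' g (s.A 7)) j * (E.n + 2) +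
            (W.mid E S S' j).pos < E.M := by
        intro S₀ ht hne
        have h8 := horner_lt (N := E.n + 2) (S := S₀) (P := walkPos E S S' g (s.A 7)) (J := j + 1)
          fun i _ _ => by have := walkPos_le (E := E) (S := S) (S' := S') (g := g) (occ := s.A 7) i; omega
        have h9 := (togCount_mono S₀ (show j + 1 ≤ E.n + 2 by omega)).trans ht
        rw [horner, if_pos hne] at h8
        exact h8.trans_le ((Nat.pow_le_pow_right (by omega) (by omega)).trans hM.le)
      have w3 := w2.codeNew (E := E) c2 (fun hne => by
        have := hdig S' htS' hne
        rw [← walk_nc, ← hW] at this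
        simpa only [Walk.mid_proj] using this)
      have c3 := c2.den (E := E) (c := codeNewCmd) (by decide)
      have w4 := w3.codeOld (E := E) c3 (fun hne => by
        have := hdig S htS hne
        rw [← walk_oc, ← hW] at this
        simpa only [Walk.codeNew_proj, Walk.mid_proj] using this)
      have c4 := c3.den (E := E) (c := codeOldCmd) (by decide)
      have w5 : WalkRel _ (walk E S S' g (s.A 7) (j + 1)) := w4.visit (E := E) c4 hE (hstep j)
        (by simpa only [Walk.codeNew_proj, Walk.codeOld_proj] using hpos)
        (Nat.mod_lt _ (by omega))
        (by simpa only [Walk.codeNew_proj, Walk.codeOld_proj, Walk.mid_proj] using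
          walk_t_le (E := E) (S := S) (S' := S') (g := g) (occ := s.A 7) j)
        (by simpa only [Walk.codeNew_proj, Walk.codeOld_proj, Walk.mid_proj] using
          walk_cost_le (E := E) (S := S) (S' := S') (g := g) (occ := s.A 7) j) hM2
      have c5 := c4.den (E := E) (c := visitCmd) (by decide)
      obtain ⟨a1, a2, a3, a4, a5, a6, a7, a8⟩ := w5
      have hA : ∀ r, r ≠ 7 → ∀ s₁, (visitCmd.den E (codeOldCmd.den E (codeNewCmd.den E
          (clipCmd.den E (jumpCmd.den E s₁))))).A r = s₁.A r := fun r hr s₁ => by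
        rw [Cmd.den_A (by simpa [visitCmd, block, Cmd.wa, Cmd.whenNe, Cmd.when] using hr.symm),
          Cmd.den_A (by rfl), Cmd.den_A (by rfl), Cmd.den_A (by rfl), Cmd.den_A (by rfl)]
      refine ⟨⟨?_, ?_, ?_, ?_, ?_, ?_, ?_, ?_⟩, ?_, ?_, ?_, ?_, ?_, ?_⟩
      · simpa using a1
      · simpa using a2
      · simpa using a3
      · simpa using a4
      · simpa using a5
      · simpa using a6
      · simpa using a7
      · simpa using a8
      · simpa using c5.length
      · simpa [prev_succ] using c5.cs
      · simpa [prev_succ] using c5.cn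
      · simpa [hA, hrA] using h5
      · simpa [hA, hrA] using h6
      · simp only [den_assign, St.setV_v, Nat.reduceEqDiff, if_false]
        rw [Cmd.den_v (by rfl), Cmd.den_v (by rfl), Cmd.den_v (by rfl), Cmd.den_v (by rfl),
          Cmd.den_v (by rfl), hrv _ (by omega) (by omega) (by omega), h7]
  exact ⟨hI.1, hI.2.1⟩

end PatternMatching

namespace PatternMatching

/-! ## The best image of a variable, column by column -/

/-- Time `q` (variable `24`) stands for the column `q / t` of the occurrence `q % t`. Variable `19`
numbers the guesses, and each guess has its own counters (array `8`, by column and letter) and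
maxima (array `9`, by column), so nothing is ever reset. Variable `18` is the sum of the maxima. -/
def countBody : Cmd :=
  block [.assign 20 (vr 24 / vr 11), .assign 22 (ip (rd 7 (vr 24 % vr 11) + vr 20)),
    .assign 23 (vr 19 * .base + vr 20), .assign 21 (vr 23 * .base + vr 22),
    .store 8 (vr 21) (rd 8 (vr 21) + 1),
    .when (rd 9 (vr 23)) (rd 8 (vr 21))
      (block [.store 9 (vr 23) (rd 8 (vr 21)), .assign 18 (vr 18 + 1)])]

/-- One loop over all pairs: loops over columns and occurrences with limit `n + 2` each, one inside
the other, would be too slow. -/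
def countCmd : Cmd :=
  block [.assign 18 0, .loop 24 1 0 (.when (vr 24) (vr 11 * vr 5) countBody)]

/-- How often the letter `l` has been seen in the column `o` before time `q`. -/
def seen (w : ℕ → ℕ → ℕ) (t q o l : ℕ) : ℕ :=
  ∑ q' ∈ Finset.range q, if q' / t = o ∧ w (q' % t) o = l then 1 else 0

theorem seen_succ (w : ℕ → ℕ → ℕ) (t q o l : ℕ) :
    seen w t (q + 1) o l = seen w t q o l + if q / t = o ∧ w (q % t) o = l then 1 else 0 :=
  Finset.sum_range_succ _ _

theorem seen_le (w : ℕ → ℕ → ℕ) (t q o l : ℕ) : seen w t q o l ≤ q := by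
  refine (Finset.sum_le_card_nsmul _ _ 1 fun q' _ => ?_).trans (by simp)
  split_ifs <;> simp

/-- The times below `t * L` go through the columns one after the other, each in a full round of `t`
occurrences. -/
theorem seen_mul (w : ℕ → ℕ → ℕ) {t : ℕ} (L : ℕ) {o : ℕ} (ho : o < L) (l : ℕ) :
    seen w t (t * L) o l = ∑ s ∈ Finset.range t, if w s o = l then 1 else 0 := by
  have key : ∀ L', seen w t (t * L') o l =
      if o < L' then ∑ s ∈ Finset.range t, if w s o = l then 1 else 0 else 0 := by
    intro L'
    induction L' with
    | zero => simp [seen]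
    | succ L' ih =>
      rw [seen, Nat.mul_succ, Finset.sum_range_add]
      change seen w t (t * L') o l + _ = _
      have h1 : ∀ s ∈ Finset.range t, (if (t * L' + s) / t = o ∧ w ((t * L' + s) % t) o = l then 1 else 0)
          = if L' = o then (if w s o = l then 1 else 0) else 0 := by
        intro s hs
        have hs := Finset.mem_range.1 hs
        rw [Nat.mul_add_div (by omega), Nat.div_eq_of_lt hs, Nat.mul_add_mod, Nat.mod_eq_of_lt hs,
          add_zero, ite_and]
      rw [Finset.sum_congr rfl h1, ih]
      by_cases h2 : L' = o
      · subst h2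
        simp
      · simp only [if_neg h2, Finset.sum_const_zero, add_zero]
        by_cases h3 : o < L'
        · rw [if_pos h3, if_pos (by omega)]
        · rw [if_neg h3, if_neg (by omega)]
  rw [key, if_pos ho]

/-- Choosing a most frequent letter in each column gives the best image. -/
theorem wordErr_best (E : Env) {t L : ℕ} {occ b : ℕ → ℕ}
    (h1 : ∀ o < L, ∀ l, seen (fun s o => E.inp (occ s + o)) t (t * L) o l ≤ b o)
    (h2 : ∀ o < L, ∃ l, seen (fun s o => E.inp (occ s + o)) t (t * L) o l = b o) :
    (∃ u, ∑ o ∈ Finset.range L, b o + ∑ s ∈ Finset.range t, E.wordErr L u (occ s) = t * L) ∧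
    ∀ u, t * L ≤ ∑ o ∈ Finset.range L, b o + ∑ s ∈ Finset.range t, E.wordErr L u (occ s) := by
  have key : ∀ u, ∑ o ∈ Finset.range L, seen (fun s o => E.inp (occ s + o)) t (t * L) o (u o) +
      ∑ s ∈ Finset.range t, E.wordErr L u (occ s) = t * L := by
    intro u
    simp only [Env.wordErr]
    rw [Finset.sum_comm, ← Finset.sum_add_distrib]
    have : ∀ o ∈ Finset.range L, seen (fun s o => E.inp (occ s + o)) t (t * L) o (u o) +
        ∑ s ∈ Finset.range t, (if E.inp (occ s + o) ≠ u o then 1 else 0) = t := by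
      intro o ho
      rw [seen_mul _ _ (Finset.mem_range.1 ho), ← Finset.sum_add_distrib]
      refine (Finset.sum_congr rfl fun s _ => ?_).trans (by simp : ∑ s ∈ Finset.range t, 1 = t)
      split_ifs <;> simp_all
    rw [Finset.sum_congr rfl this]
    simp [mul_comm]
  constructor
  · choose! u hu using h2
    refine ⟨u, ?_⟩
    rw [← key u, Finset.sum_congr rfl fun o ho => hu o (Finset.mem_range.1 ho)]
  · intro u
    rw [← key u]
    exact Nat.add_le_add_right
      (Finset.sum_le_sum fun o ho => h1 o (Finset.mem_range.1 ho) _) _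

theorem countBody_spec (E : Env) (s : St) {o l d a : ℕ} (ho : s.v 24 / s.v 11 = o)
    (hl : E.inp ((s.A 7 (s.v 24 % s.v 11) + o) % E.M % (2 * E.n)) = l)
    (hd : (s.v 19 * (E.n + 2) % E.M + o) % E.M = d) (ha : (d * (E.n + 2) % E.M + l) % E.M = a)
    (hc : (s.A 8 a + 1) % E.M = s.A 8 a + 1) (hv : (s.v 18 + 1) % E.M = s.v 18 + 1) :
    (countBody.den E s).A 8 = Function.update (s.A 8) a (s.A 8 a + 1) ∧
    (countBody.den E s).A 9 =
      (if s.A 9 d < s.A 8 a + 1 then Function.update (s.A 9) d (s.A 8 a + 1) else s.A 9) ∧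
    (countBody.den E s).v 18 = s.v 18 + if s.A 9 d < s.A 8 a + 1 then 1 else 0 := by
  subst ha hd hl ho
  simp only [countBody, den_block_cons, den_block_nil, den_assign, den_store, den_when, ev_var,
    ev_arr, ev_add, ev_mul, ev_div, ev_mod, ev_inp, ev_base, ev_one, St.setV_v, St.setV_A,
    St.setA_v, St.setA_A, Nat.reduceEqDiff, if_true, if_false, hc, Function.update_self,
    show (9 : Fin 16) ≠ 8 by decide]
  split_ifs <;> simp [hv]

/-- Variable `18` plus the least number of errors of an image is `t * L`; the maxima themselves are
not exposed. The first two clauses hand clean cells on to the next guess. -/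
theorem countCmd_spec {E : Env} (hw : ∀ i < E.n, E.inp i ≤ E.n) (s : St)
    (htL : s.v 11 * s.v 5 ≤ E.n) (hocc : ∀ i < s.v 11, s.A 7 i + s.v 5 ≤ E.n)
    (hM : (s.v 19 + 1) * (E.n + 2) * (E.n + 2) < E.M)
    (h8 : ∀ i ≥ s.v 19 * (E.n + 2) * (E.n + 2), s.A 8 i = 0)
    (h9 : ∀ i ≥ s.v 19 * (E.n + 2), s.A 9 i = 0) :
    (∀ i ≥ (s.v 19 + 1) * (E.n + 2) * (E.n + 2), (countCmd.den E s).A 8 i = 0) ∧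
    (∀ i ≥ (s.v 19 + 1) * (E.n + 2), (countCmd.den E s).A 9 i = 0) ∧
    (∃ u, (countCmd.den E s).v 18 +
      ∑ i ∈ Finset.range (s.v 11), E.wordErr (s.v 5) u (s.A 7 i) = s.v 11 * s.v 5) ∧
    ∀ u, s.v 11 * s.v 5 ≤ (countCmd.den E s).v 18 +
      ∑ i ∈ Finset.range (s.v 11), E.wordErr (s.v 5) u (s.A 7 i) := by
  set t := s.v 11 with ht
  set L := s.v 5 with hL
  set h := s.v 19 with hh
  set occ := s.A 7 with hoccd
  set w : ℕ → ℕ → ℕ := fun s o => E.inp (occ s + o) with hwd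
  set N := E.n + 2 with hN
  have hNN : N ≤ (h + 1) * N * N := Nat.le_mul_of_pos_left _ (Nat.mul_pos (by omega) (by omega))
  let I : ℕ → St → Prop := fun q s' =>
    s'.v 11 = t ∧ s'.v 5 = L ∧ s'.v 19 = h ∧ s'.A 7 = occ ∧
    (∀ i ≥ (h + 1) * N * N, s'.A 8 i = 0) ∧ (∀ i ≥ (h + 1) * N, s'.A 9 i = 0) ∧
    (∀ o < N, ∀ l < N, s'.A 8 ((h * N + o) * N + l) = seen w t (min q (t * L)) o l) ∧
    (∀ o < N, ∀ l < N, seen w t (min q (t * L)) o l ≤ s'.A 9 (h * N + o)) ∧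
    (∀ o < N, ∃ l < N, seen w t (min q (t * L)) o l = s'.A 9 (h * N + o)) ∧
    s'.v 18 = ∑ o ∈ Finset.range L, s'.A 9 (h * N + o) ∧ s'.v 18 ≤ min q (t * L)
  have hI : I N (countCmd.den E s) := by
    simp only [countCmd, den_block_cons, den_block_nil]
    rw [hN, ← E.lim_base]
    refine Cmd.loop_inv I ?_ ?_
    · have h10 : ∀ o l, (h * N + o) * N + l ≥ h * N * N := fun o l => by
        rw [add_mul]; omega
      have h11 : ∀ o, h * N + o ≥ h * N := fun o => by omega
      simp only [I, den_assign, St.setV_v, St.setV_A, Nat.zero_min, seen, Finset.range_zero,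
        Finset.sum_empty]
      refine ⟨by simp [ht], by simp [hL], by simp [hh], rfl, fun i hi => h8 i (by nlinarith),
        fun i hi => h9 i (by nlinarith), fun o _ l _ => h8 _ (h10 o l), fun _ _ _ _ => Nat.zero_le _,
        fun o ho => ⟨o, ho, (h9 _ (h11 o)).symm⟩, ?_, by simp⟩
      simp only [if_true, ev_zero]
      rw [Finset.sum_eq_zero fun o _ => h9 _ (h11 o)]
    · rintro q - s₀ ⟨i1, i2, i3, i4, i5, i6, i7, i8, i9, i10, i11⟩
      have hmod : t * L % E.M = t * L := Nat.mod_eq_of_lt (by omega)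
      simp only [den_when, ev_var, ev_mul, St.setV_v, Nat.reduceEqDiff,
        if_true, if_false, i1, i2, hmod]
      by_cases hq : q < t * L
      · rw [if_pos hq]
        have hmin : min q (t * L) = q := by omega
        have hmin' : min (q + 1) (t * L) = q + 1 := by omega
        rw [hmin] at i7 i8 i9 i11
        simp only [I, hmin']
        have ht0 : 0 < t := Nat.pos_of_ne_zero fun h0 => by simp [h0] at hq
        have ho : q / t < L := Nat.div_lt_of_lt_mul hq
        have hp : occ (q % t) + q / t < E.n := by
          have := hocc (q % t) (Nat.mod_lt _ ht0)
          omega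
        have hl : w (q % t) (q / t) < N := by
          have := hw _ hp
          simp only [hwd]
          omega
        have hoN : q / t < N := by omega
        have hdN : h * N + q / t < (h + 1) * N := by rw [add_mul]; omega
        have haN : ∀ o < N, ∀ l < N, (h * N + o) * N + l < (h + 1) * N * N := by
          intro o ho l hl
          calc (h * N + o) * N + l < (h * N + o + 1) * N := by rw [add_mul _ 1]; omega
            _ ≤ _ := Nat.mul_le_mul_right _ (by rw [add_mul]; omega)
        have hNM : (h + 1) * N ≤ (h + 1) * N * N := Nat.le_mul_of_pos_right _ (by omega)
        have ha := haN _ hoN _ hl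
        have hsl := seen_le w t q (q / t) (w (q % t) (q / t))
        have e1 := i7 _ hoN _ hl
        have m1 : h * N % E.M = h * N :=
          Nat.mod_eq_of_lt (((Nat.le_add_right _ _).trans_lt hdN).trans (hNM.trans_lt hM))
        have m2 : (h * N + q / t) % E.M = h * N + q / t :=
          Nat.mod_eq_of_lt (hdN.trans (hNM.trans_lt hM))
        have m3 : (h * N + q / t) * N % E.M = (h * N + q / t) * N :=
          Nat.mod_eq_of_lt (((Nat.le_add_right _ _).trans_lt ha).trans hM)
        have m4 := Nat.mod_eq_of_lt (ha.trans hM)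
        obtain ⟨f1, f2, f3⟩ := countBody_spec E (s₀.setV 24 q) (o := q / t)
          (l := w (q % t) (q / t)) (d := h * N + q / t)
          (a := (h * N + q / t) * N + w (q % t) (q / t))
          (by simp [i1]) (by
            simp only [St.setV_A, St.setV_v, Nat.reduceEqDiff, if_true, if_false, i1, i4]
            rw [Nat.mod_eq_of_lt (by omega : occ (q % t) + q / t < E.M),
              Nat.mod_eq_of_lt (by omega)])
          (by
            simp only [St.setV_v, Nat.reduceEqDiff, if_false, i3]
            rw [← hN, m1, m2])
          (by rw [← hN, m3, m4])
          (by rw [St.setV_A, e1]; exact Nat.mod_eq_of_lt (by omega))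
          (by
            simp only [St.setV_v, Nat.reduceEqDiff, if_false]
            exact Nat.mod_eq_of_lt (by omega))
        simp only [St.setV_A, St.setV_v, Nat.reduceEqDiff, if_false, e1] at f1 f2 f3
        -- The index determines column and letter, both being digits below `N`.
        have hinj : ∀ o < N, ∀ l < N, ((h * N + o) * N + l =
            (h * N + q / t) * N + w (q % t) (q / t)) ↔ q / t = o ∧ w (q % t) (q / t) = l := by
          intro o ho l hl'
          constructor
          · intro heq
            have h12 := congrArg (· / N) heq
            have h13 := congrArg (· % N) heq
            simp only [Nat.mul_add_mod', Nat.mod_eq_of_lt hl', Nat.mod_eq_of_lt hl] at h13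
            rw [mul_comm, mul_comm (h * N + q / t)] at heq
            simp only [mul_comm _ N, Nat.mul_add_div (show 0 < N by omega), Nat.div_eq_of_lt hl',
              Nat.div_eq_of_lt hl] at h12
            omega
          · rintro ⟨rfl, rfl⟩
            rfl
        have g8 : ∀ o < N, ∀ l < N, (countBody.den E (s₀.setV 24 q)).A 8 ((h * N + o) * N + l) =
            seen w t (q + 1) o l := by
          intro o ho l hl'
          rw [f1, Function.update_apply, seen_succ]
          by_cases h12 : q / t = o ∧ w (q % t) (q / t) = l
          · rw [if_pos ((hinj o ho l hl').2 h12), ← h12.1, ← h12.2, if_pos ⟨rfl, rfl⟩]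
          · rw [if_neg fun h => h12 ((hinj o ho l hl').1 h), i7 o ho l hl', if_neg, add_zero]
            rintro ⟨rfl, h13⟩
            exact h12 ⟨rfl, h13⟩
        have g9 : ∀ o < N, (countBody.den E (s₀.setV 24 q)).A 9 (h * N + o) =
            if q / t = o then max (s₀.A 9 (h * N + o)) (seen w t (q + 1) o (w (q % t) o))
            else s₀.A 9 (h * N + o) := by
          intro o ho
          rw [f2, seen_succ]
          by_cases h12 : q / t = o
          · subst h12
            simp only [and_self, if_true]
            split_ifs with h13
            · rw [Function.update_self]
              omega
            · omega
          · rw [if_neg h12]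
            split_ifs
            · rw [Function.update_of_ne (by omega)]
            · rfl
        refine ⟨?_, ?_, ?_, ?_, ?_, ?_, g8, ?_, ?_, ?_, ?_⟩
        · rw [Cmd.den_v (by rfl)]; simpa using i1
        · rw [Cmd.den_v (by rfl)]; simpa using i2
        · rw [Cmd.den_v (by rfl)]; simpa using i3
        · rw [Cmd.den_A (by rfl)]; simpa using i4
        · intro i hi
          rw [f1, Function.update_of_ne (by omega), i5 i hi]
        · intro i hi
          rw [f2]
          split_ifs
          · rw [Function.update_of_ne (by omega), i6 i hi]
          · exact i6 i hi
        · intro o ho l hl'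
          have := i8 o ho l hl'
          rw [g9 o ho]
          by_cases h12 : q / t = o
          · rw [if_pos h12]
            by_cases h13 : w (q % t) (q / t) = l
            · subst h12 h13
              exact le_max_right _ _
            · subst h12
              rw [seen_succ w t q (q / t) l, if_neg fun h => h13 h.2]
              exact le_max_of_le_left this
          · rw [if_neg h12, seen_succ, if_neg fun h => h12 h.1]
            exact this
        · intro o ho
          rw [g9 o ho]
          split_ifs with h12
          · subst h12
            rcases le_total (s₀.A 9 (h * N + q / t)) (seen w t (q + 1) (q / t) (w (q % t) (q / t)))
              with h13 | h13
            · exact ⟨_, hl, (max_eq_right h13).symm⟩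
            · obtain ⟨l, hl', h14⟩ := i9 _ ho
              refine ⟨l, hl', ?_⟩
              rw [max_eq_left h13, seen_succ, if_neg, h14, add_zero]
              rintro ⟨-, rfl⟩
              rw [seen_succ, if_pos ⟨rfl, rfl⟩] at h13
              omega
          · obtain ⟨l, hl', h14⟩ := i9 o ho
            refine ⟨l, hl', ?_⟩
            rw [seen_succ, if_neg fun h => h12 h.1, h14, add_zero]
        · have hs1 : seen w t (q + 1) (q / t) (w (q % t) (q / t)) =
              seen w t q (q / t) (w (q % t) (q / t)) + 1 := by rw [seen_succ, if_pos ⟨rfl, rfl⟩]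
          -- The old maximum is at least the old count, so a new count that exceeds it does so by
          -- exactly one.
          have h15 := i8 _ hoN _ hl
          have hb := fun o (ho' : o ∈ Finset.range L) => g9 o (by
            have := Finset.mem_range.1 ho'
            have := (Nat.le_mul_of_pos_left L ht0).trans htL
            omega)
          rw [f3, i10, Finset.sum_congr rfl hb, ← Finset.add_sum_erase _ _ (Finset.mem_range.2 ho),
            ← Finset.add_sum_erase (Finset.range L) _ (Finset.mem_range.2 ho), if_pos rfl,
            Finset.sum_congr (s₁ := (Finset.range L).erase (q / t)) rfl
              (g := fun o => s₀.A 9 (h * N + o))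
              (fun o ho' => if_neg (Finset.ne_of_mem_erase ho').symm),
            hs1]
          split_ifs <;> omega
        · rw [f3]
          split_ifs <;> omega
      · rw [if_neg hq]
        have hmin : min (q + 1) (t * L) = min q (t * L) := by omega
        simp only [I, hmin]
        exact ⟨i1, i2, i3, i4, i5, i6, i7, i8, i9, i10, i11⟩
  obtain ⟨-, -, -, -, i5, i6, i7, i8, i9, i10, i11⟩ := hI
  refine ⟨i5, i6, ?_⟩
  rw [i10]
  have hmin : min N (t * L) = t * L := by omega
  rw [hmin] at i8 i9
  have hLN : 0 < t → L ≤ E.n := fun h => (Nat.le_mul_of_pos_left _ h).trans htL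
  rcases Nat.eq_zero_or_pos t with h0 | h0
  · have : ∑ o ∈ Finset.range L, (countCmd.den E s).A 9 (h * N + o) = 0 := by
      rw [← i10]
      rw [h0] at i11
      simpa using i11
    rw [this]
    simp [h0]
  · refine wordErr_best E (fun o ho l => ?_) fun o ho => ?_
    · by_cases hl : l < N
      · exact i8 o (by have := hLN h0; omega) l hl
      -- No letter of the word has a code of `N` or more, so such an `l` was never seen.
      · refine le_trans (le_of_eq ?_) (Nat.zero_le _)
        rw [seen_mul _ _ ho]
        refine Finset.sum_eq_zero fun s' hs' => if_neg fun heq => hl ?_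
        have := hocc s' (Finset.mem_range.1 hs')
        have := hw (occ s' + o) (by omega)
        omega
    · obtain ⟨l, -, hl⟩ := i9 o (by have := hLN h0; omega)
      exact ⟨l, hl⟩

end PatternMatching

namespace PatternMatching

/-! ## One guess in the dynamic programme -/

/-- An occurrence that overran the word would invalidate the walk at the next boundary. So the
indicators of overruns sum to `0`, which `walk_sum_occ` carries over to the recorded starts. -/
theorem walk_occ_le {E : Env} {b S : ℕ → ℕ} {x g : ℕ} {occ : ℕ → ℕ} (hb : E.Owner b)
    (hS : E.Closed b S) (hx : x ≠ 0) (hok : (walk E S (mark b S x) g occ (E.n + 2)).ok = 1) :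
    ∀ i < (walk E S (mark b S x) g occ (E.n + 2)).t,
      (walk E S (mark b S x) g occ (E.n + 2)).occ i + g % (E.n + 2) ≤ E.n := by
  have hS' := hS.mark hb hx
  have h0 : ∑ i ∈ Finset.range (walk E S (mark b S x) g occ (E.n + 2)).t,
      (if E.n < (walk E S (mark b S x) g occ (E.n + 2)).occ i + g % (E.n + 2) then 1 else 0) = 0 := by
    rw [walk_sum_occ (fun p => if E.n < p + g % (E.n + 2) then 1 else 0)]
    refine Finset.sum_eq_zero fun j _ => ?_
    split_ifs with h1 h2 <;> try rfl
    have h3 := hS'.le j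
    have hjm : j < E.m := by
      by_contra hjm
      have := hS'.out j (by omega)
      omega
    have h4 := walkPos_succ hok (j := j) (by have := hb.le; omega) (by omega) (by omega) hS'.le
    rw [if_pos h1.2] at h4
    have := walkPos_le (E := E) (S := S) (S' := mark b S x) (g := g) (occ := occ) (j + 1)
    omega
  intro i hi
  have := Finset.sum_eq_zero_iff.1 h0 i (Finset.mem_range.2 hi)
  split_ifs at this
  omega

/-- Keep the better one of two encoded costs, where `0` stands for infinity. -/
def better (old v : ℕ) : ℕ := if old = 0 ∨ v < old then v else old

def updateCmd : Cmd :=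
  .ite (rd 6 (vr 23)) 1 (.store 6 (vr 23) (vr 22))
    (.when (vr 22) (rd 6 (vr 23)) (.store 6 (vr 23) (vr 22)))

def dpTail (k : ℕ) : Cmd :=
  block [.assign 19 (vr 1 * basePow (2 * k + 1) + vr 2), countCmd,
    .assign 22 (rd 6 (vr 17) + vr 10 + (vr 11 * vr 5 - vr 18)),
    .assign 23 ((vr 1 + 1) * basePow (2 * k) + vr 9), updateCmd]

/-- The test of `t * L` against `n` keeps the counting within its `n + 2` rounds; by `walk_complete`
it costs no complete placement. -/
def dpBody (k : ℕ) : Cmd :=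
  block [walkCmd, .when .n (vr 11 * vr 5) (.assign 12 0),
    .assign 17 (vr 1 * basePow (2 * k) + vr 8),
    .when 0 (vr 12) (.when 0 (rd 6 (vr 17)) (dpTail k))]

theorem updateCmd_spec (E : Env) (s : St) : (updateCmd.den E s).A 6 =
    Function.update (s.A 6) (s.v 23) (better (s.A 6 (s.v 23)) (s.v 22)) := by
  simp only [updateCmd, den_ite, den_when, den_store, ev_arr, ev_var, ev_one, better]
  by_cases h1 : s.A 6 (s.v 23) = 0
  · simp [h1]
  · rw [if_neg (by omega)]
    split_ifs with h2 h3 h3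
    · simp
    · omega
    · omega
    · simp

/-- The exponent `2 * k + 5` leaves room for the largest array index, that of a counter, which is
below `(n + 2) ^ (2 * k + 4)`. -/
theorem dpTail_spec {E : Env} {k i : ℕ} (hw : ∀ i < E.n, E.inp i ≤ E.n) (s : St)
    (htL : s.v 11 * s.v 5 ≤ E.n) (hocc : ∀ i < s.v 11, s.A 7 i + s.v 5 ≤ E.n)
    (hM : (E.n + 2) ^ (2 * k + 5) < E.M) (hi : s.v 1 = i) (hin : i < E.n)
    (hg : s.v 2 < (E.n + 2) ^ (2 * k + 1)) (hnc : s.v 9 < (E.n + 2) ^ (2 * k))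
    (hD : s.A 6 (s.v 17) + s.v 10 + E.n < E.M)
    (h8 : ∀ j ≥ (i * (E.n + 2) ^ (2 * k + 1) + s.v 2) * (E.n + 2) * (E.n + 2), s.A 8 j = 0)
    (h9 : ∀ j ≥ (i * (E.n + 2) ^ (2 * k + 1) + s.v 2) * (E.n + 2), s.A 9 j = 0) :
    (∀ j ≥ (i * (E.n + 2) ^ (2 * k + 1) + s.v 2 + 1) * (E.n + 2) * (E.n + 2),
      ((dpTail k).den E s).A 8 j = 0) ∧
    (∀ j ≥ (i * (E.n + 2) ^ (2 * k + 1) + s.v 2 + 1) * (E.n + 2),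
      ((dpTail k).den E s).A 9 j = 0) ∧
    ∃ e, (∃ u, e = ∑ j ∈ Finset.range (s.v 11), E.wordErr (s.v 5) u (s.A 7 j)) ∧
      (∀ u, e ≤ ∑ j ∈ Finset.range (s.v 11), E.wordErr (s.v 5) u (s.A 7 j)) ∧
      ((dpTail k).den E s).A 6 = Function.update (s.A 6) ((i + 1) * (E.n + 2) ^ (2 * k) + s.v 9)
        (better (s.A 6 ((i + 1) * (E.n + 2) ^ (2 * k) + s.v 9))
          (s.A 6 (s.v 17) + s.v 10 + e)) := by
  set N := E.n + 2 with hN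
  set T := N ^ (2 * k) with hT
  have hN0 : 0 < N := by omega
  have hG : N ^ (2 * k + 1) = T * N := pow_succ _ _
  have hT0 : 0 < T := Nat.pow_pos hN0
  have hM5 : N ^ (2 * k + 5) = T * N * N * N * N * N := by simp only [hT, pow_succ]
  set G := N ^ (2 * k + 1) with hGd
  have hG0 : 0 < G := Nat.pow_pos hN0
  have hiG : i * G + s.v 2 + 1 ≤ N * G := by
    calc i * G + s.v 2 + 1 ≤ (i + 1) * G := by rw [add_mul]; omega
      _ ≤ N * G := Nat.mul_le_mul_right _ (by omega)
  have hle : ∀ a, a ≤ a * N := fun a => Nat.le_mul_of_pos_right _ hN0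
  have hNG : N * G * N * N < E.M := by
    refine lt_of_le_of_lt ?_ hM
    rw [hM5, hG]
    calc N * (T * N) * N * N = T * N * N * N * N := by ring
      _ ≤ _ := hle _
  have hbig : (i * G + s.v 2 + 1) * N * N < E.M :=
    (Nat.mul_le_mul_right _ (Nat.mul_le_mul_right _ hiG)).trans_lt hNG
  have hGM : N * G < E.M := ((hle _).trans (hle _)).trans_lt hNG
  have hGM' : G < E.M := (Nat.le_mul_of_pos_left _ hN0).trans_lt hGM
  have hTG : T ≤ G := by rw [hG]; exact hle _
  have hTN : (i + 1) * T + s.v 9 < E.M := by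
    calc (i + 1) * T + s.v 9 < (i + 2) * T := by simp only [add_mul]; omega
      _ ≤ N * G := Nat.mul_le_mul (by omega) hTG
      _ < E.M := hGM
  have hNM : N < E.M := (Nat.le_mul_of_pos_right _ hG0).trans_lt hGM
  have e1 : (basePow (2 * k + 1)).ev E s = G := ev_basePow _ _ hGM'
  have e2 : i * G % E.M = i * G := Nat.mod_eq_of_lt (by omega)
  have e3 : (i * G + s.v 2) % E.M = i * G + s.v 2 := Nat.mod_eq_of_lt (by omega)
  have e0 : Exp.ev E s (vr 1 * basePow (2 * k + 1) + vr 2) = i * G + s.v 2 := by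
    simp only [ev_add, ev_mul, ev_var, hi, e1, e2, e3]
  simp only [dpTail, den_block_cons, den_block_nil, den_assign, e0]
  set s₁ := s.setV 19 (i * G + s.v 2) with hs₁
  have hv : ∀ y, y ≠ 19 → s₁.v y = s.v y := fun y hy => by simp [hs₁, hy]
  have hv19 : s₁.v 19 = i * G + s.v 2 := by simp [hs₁]
  have hA : s₁.A = s.A := by simp [hs₁]
  obtain ⟨q8, q9, ⟨u, hu⟩, hall⟩ := countCmd_spec hw s₁ (by simpa [hv] using htL)
    (by simpa [hv, hA] using hocc) (by rw [hv19]; exact hbig) (by rw [hv19, hA]; exact h8)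
    (by rw [hv19, hA]; exact h9)
  rw [hv19] at q8 q9
  rw [hv _ (by omega), hv _ (by omega), hA] at hu hall
  have hframe : ∀ s', (updateCmd.den E s').A 8 = s'.A 8 ∧ (updateCmd.den E s').A 9 = s'.A 9 :=
    fun s' => ⟨Cmd.den_A (by rfl) _, Cmd.den_A (by rfl) _⟩
  simp only [(hframe _).1, (hframe _).2, St.setV_A]
  refine ⟨q8, q9, s.v 11 * s.v 5 - (countCmd.den E s₁).v 18, ⟨u, by omega⟩, fun u => ?_, ?_⟩
  · have := hall u
    omega
  have c6 : (countCmd.den E s₁).A 6 = s.A 6 := (Cmd.den_A (by rfl) _).trans (by rw [hA])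
  have c1 : (countCmd.den E s₁).v 1 = i := ((Cmd.den_v (by rfl) _).trans (hv _ (by omega))).trans hi
  have c9 : (countCmd.den E s₁).v 9 = s.v 9 := (Cmd.den_v (by rfl) _).trans (hv _ (by omega))
  have c17 : (countCmd.den E s₁).v 17 = s.v 17 := (Cmd.den_v (by rfl) _).trans (hv _ (by omega))
  have c10 : (countCmd.den E s₁).v 10 = s.v 10 := (Cmd.den_v (by rfl) _).trans (hv _ (by omega))
  have c11 : (countCmd.den E s₁).v 11 = s.v 11 := (Cmd.den_v (by rfl) _).trans (hv _ (by omega))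
  have c5 : (countCmd.den E s₁).v 5 = s.v 5 := (Cmd.den_v (by rfl) _).trans (hv _ (by omega))
  have hTM : (i + 1) * T < E.M := by omega
  rw [updateCmd_spec]
  have d23 : ∀ y, Exp.ev E ((countCmd.den E s₁).setV 22 y)
      ((vr 1 + 1) * basePow (2 * k) + vr 9) = (i + 1) * T + s.v 9 := by
    intro y
    simp only [ev_add, ev_mul, ev_var, ev_one, St.setV_v, Nat.reduceEqDiff, if_false, c1, c9,
      ev_basePow _ _ (hTG.trans_lt hGM')]
    rw [Nat.mod_eq_of_lt (by omega : i + 1 < E.M), Nat.mod_eq_of_lt hTM, Nat.mod_eq_of_lt hTN]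
  have d22 : Exp.ev E (countCmd.den E s₁) (rd 6 (vr 17) + vr 10 + (vr 11 * vr 5 - vr 18)) =
      s.A 6 (s.v 17) + s.v 10 + (s.v 11 * s.v 5 - (countCmd.den E s₁).v 18) := by
    simp only [ev_add, ev_mul, ev_sub, ev_var, ev_arr, c6, c17, c10, c11, c5]
    rw [Nat.mod_eq_of_lt (by omega : s.v 11 * s.v 5 < E.M),
      Nat.mod_eq_of_lt (by omega : s.A 6 (s.v 17) + s.v 10 < E.M), Nat.mod_eq_of_lt (by omega)]
  simp only [St.setV_v, St.setV_A, if_true, Nat.reduceEqDiff, if_false, d22, d23, c6]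

/-- The effect of one guess `g` in stage `i`. -/
theorem dpBody_spec {E : Env} (hE : E.Ok) {k i : ℕ} (hw : ∀ i < E.n, E.inp i ≤ E.n)
    (hM : (E.n + 2) ^ (2 * k + 5) < E.M)
    {b S : ℕ → ℕ} {x : ℕ} (hb : E.Owner b) (hS : E.Closed b S) (hx : x ≠ 0)
    (htS : togCount S (E.n + 2) ≤ 2 * k) (htS' : togCount (mark b S x) (E.n + 2) ≤ 2 * k)
    (s : St) (hB : s.A 0 = b) (hC : s.A 5 = S) (hsx : s.v 4 = x) (hi : s.v 1 = i) (hin : i < E.n)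
    (hg : s.v 2 < (E.n + 2) ^ (2 * k + 1))
    (hD : ∀ c < (E.n + 2) ^ (2 * k), s.A 6 (i * (E.n + 2) ^ (2 * k) + c) + (E.n + 2) + E.n < E.M)
    (h8 : ∀ j ≥ (i * (E.n + 2) ^ (2 * k + 1) + s.v 2) * (E.n + 2) * (E.n + 2), s.A 8 j = 0)
    (h9 : ∀ j ≥ (i * (E.n + 2) ^ (2 * k + 1) + s.v 2) * (E.n + 2), s.A 9 j = 0)
    (W : Walk) (hW : W = walk E S (mark b S x) (s.v 2) (s.A 7) (E.n + 2)) :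
    (∀ j ≥ (i * (E.n + 2) ^ (2 * k + 1) + s.v 2 + 1) * (E.n + 2) * (E.n + 2),
      ((dpBody k).den E s).A 8 j = 0) ∧
    (∀ j ≥ (i * (E.n + 2) ^ (2 * k + 1) + s.v 2 + 1) * (E.n + 2),
      ((dpBody k).den E s).A 9 j = 0) ∧
    if W.ok = 1 ∧ W.t * (s.v 2 % (E.n + 2)) ≤ E.n ∧ s.A 6 (i * (E.n + 2) ^ (2 * k) + W.oc) ≠ 0 then
      ∃ e, (∃ u, e = ∑ j ∈ Finset.range W.t, E.wordErr (s.v 2 % (E.n + 2)) u (W.occ j)) ∧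
        (∀ u, e ≤ ∑ j ∈ Finset.range W.t, E.wordErr (s.v 2 % (E.n + 2)) u (W.occ j)) ∧
        ((dpBody k).den E s).A 6 = Function.update (s.A 6) ((i + 1) * (E.n + 2) ^ (2 * k) + W.nc)
          (better (s.A 6 ((i + 1) * (E.n + 2) ^ (2 * k) + W.nc))
            (s.A 6 (i * (E.n + 2) ^ (2 * k) + W.oc) + W.cost + e))
    else ((dpBody k).den E s).A 6 = s.A 6 := by
  have hE0 := hE.pos
  set N := E.n + 2 with hN
  set T := N ^ (2 * k) with hT
  have hN0 : 0 < N := by omega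
  have hT0 : 0 < T := Nat.pow_pos hN0
  have hM5 : N ^ (2 * k + 5) = T * N * N * N * N * N := by simp only [hT, pow_succ]
  have hle : ∀ a, a ≤ a * N := fun a => Nat.le_mul_of_pos_right _ hN0
  have hTM : T * N * N < E.M :=
    ((hle _).trans ((hle _).trans (hle _))).trans_lt (hM5 ▸ hM)
  obtain ⟨R, hL⟩ := walkCmd_spec hE (k := k)
    ((Nat.pow_le_pow_right (by omega) (by omega)).trans_lt hM) hb hS hx htS htS' s hB hC hsx
  rw [← hW] at R
  set g := s.v 2 with hgd
  have hWoc : W.oc < T := by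
    rw [hW, walk_oc]
    exact (horner_lt fun j _ _ => by
      have := walkPos_le (E := E) (S := S) (S' := mark b S x) (g := g) (occ := s.A 7) j
      omega).trans_le (Nat.pow_le_pow_right (by omega) htS)
  have hWnc : W.nc < T := by
    rw [hW, walk_nc]
    exact (horner_lt fun j _ _ => by
      have := walkPos_le (E := E) (S := S) (S' := mark b S x) (g := g) (occ := s.A 7) j
      omega).trans_le (Nat.pow_le_pow_right (by omega) htS')
  have hWt : W.t ≤ N := by rw [hW]; exact walk_t_le _
  have hWc : W.cost ≤ N := by rw [hW]; exact walk_cost_le _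
  have hWo : W.ok ≤ 1 := by rw [hW]; exact walk_ok_le _
  have hlN : g % N < N := Nat.mod_lt _ hN0
  have hNNM : N * N < E.M := by
    refine lt_of_le_of_lt ?_ hTM
    rw [mul_assoc]
    exact Nat.le_mul_of_pos_left _ hT0
  have htl : W.t * (g % N) < E.M :=
    (Nat.mul_le_mul hWt hlN.le).trans_lt hNNM
  set s₁ := walkCmd.den E s with hs₁
  have f1 : s₁.v 1 = i := (Cmd.den_v (by rfl) _).trans hi
  have f2 : s₁.v 2 = g := Cmd.den_v (by rfl) _
  have f6 : s₁.A 6 = s.A 6 := Cmd.den_A (by rfl) _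
  have f8 : s₁.A 8 = s.A 8 := Cmd.den_A (by rfl) _
  have f9 : s₁.A 9 = s.A 9 := Cmd.den_A (by rfl) _
  obtain ⟨r1, r2, r3, r4, r5, r6, r7, r8⟩ := R
  have m8 : ∀ j ≥ (i * N ^ (2 * k + 1) + g + 1) * N * N, s.A 8 j = 0 := fun j hj =>
    h8 j (le_trans (Nat.mul_le_mul_right _ (Nat.mul_le_mul_right _ (Nat.le_succ _))) hj)
  have m9 : ∀ j ≥ (i * N ^ (2 * k + 1) + g + 1) * N, s.A 9 j = 0 := fun j hj =>
    h9 j (le_trans (Nat.mul_le_mul_right _ (Nat.le_succ _)) hj)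
  have hiT : i * T + W.oc < E.M := by
    calc i * T + W.oc < (i + 1) * T := by rw [add_mul]; omega
      _ ≤ N * T := Nat.mul_le_mul_right _ (by omega)
      _ ≤ T * N * N := by rw [mul_comm]; exact hle _
      _ < _ := hTM
  set s₂ := (Cmd.when .n (vr 11 * vr 5) (.assign 12 0)).den E s₁ with hs₂
  have hs₂' : s₂ = if E.n < W.t * (g % N) then s₁.setV 12 0 else s₁ := by
    simp only [hs₂, den_when, ev_mul, ev_var, ev_n, r6, hL, den_assign, ev_zero]
    rw [← hN, Nat.mod_eq_of_lt htl]
  have hv : ∀ y, y ≠ 12 → s₂.v y = s₁.v y := fun y hy => by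
    rw [hs₂']
    split_ifs <;> simp [hy]
  have hv12 : 0 < s₂.v 12 ↔ W.ok = 1 ∧ W.t * (g % N) ≤ E.n := by
    rw [hs₂']
    split_ifs with h10
    · simp
      omega
    · rw [r7]
      omega
  have hA : s₂.A = s₁.A := by
    rw [hs₂']
    split_ifs
    · exact St.setV_A _ _ _
    · exact Eq.refl _
  have e17 : Exp.ev E s₂ (vr 1 * basePow (2 * k) + vr 8) = i * T + W.oc := by
    simp only [ev_add, ev_mul, ev_var, hv _ (show 1 ≠ 12 by omega), hv _ (show 8 ≠ 12 by omega), f1,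
      r3, ev_basePow _ _ (((hle _).trans (hle _)).trans_lt hTM)]
    rw [Nat.mod_eq_of_lt (by omega : i * T < E.M), Nat.mod_eq_of_lt hiT]
  have hfin : (dpBody k).den E s = if W.ok = 1 ∧ W.t * (g % N) ≤ E.n ∧ s.A 6 (i * T + W.oc) ≠ 0
      then (dpTail k).den E (s₂.setV 17 (i * T + W.oc)) else s₂.setV 17 (i * T + W.oc) := by
    simp only [dpBody, den_block_cons, den_block_nil, den_assign, den_when _ _ 0, ← hs₁, ← hs₂, e17,
      ev_zero, ev_var, ev_arr, St.setV_v, St.setV_A, Nat.reduceEqDiff, if_false, if_true, hA, f6,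
      hv12]
    by_cases h10 : W.ok = 1 ∧ W.t * (g % N) ≤ E.n
    · rw [if_pos h10]
      by_cases h11 : s.A 6 (i * T + W.oc) = 0
      · rw [if_neg (by omega), if_neg fun h => h.2.2 h11]
      · rw [if_pos (by omega), if_pos ⟨h10.1, h10.2, h11⟩]
    · rw [if_neg h10, if_neg fun h => h10 ⟨h.1, h.2.1⟩]
  rw [hfin]
  by_cases hc : W.ok = 1 ∧ W.t * (g % N) ≤ E.n ∧ s.A 6 (i * T + W.oc) ≠ 0
  · rw [if_pos hc, if_pos hc]
    set s₃ := s₂.setV 17 (i * T + W.oc) with hs₃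
    have hv3 : ∀ y, y ≠ 17 → y ≠ 12 → s₃.v y = s₁.v y := fun y h1 h2 => by
      simp [hs₃, h1, hv y h2]
    have hv17 : s₃.v 17 = i * T + W.oc := by simp [hs₃]
    have hA3 : s₃.A = s₁.A := by simp [hs₃, hA]
    have w11 : s₃.v 11 = W.t := (hv3 _ (by omega) (by omega)).trans r6
    have w5 : s₃.v 5 = g % N := (hv3 _ (by omega) (by omega)).trans hL
    have w2 : s₃.v 2 = g := (hv3 _ (by omega) (by omega)).trans f2
    have w9 : s₃.v 9 = W.nc := (hv3 _ (by omega) (by omega)).trans r4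
    have w10 : s₃.v 10 = W.cost := (hv3 _ (by omega) (by omega)).trans r5
    have w1 : s₃.v 1 = i := (hv3 _ (by omega) (by omega)).trans f1
    have := dpTail_spec (k := k) (i := i) hw s₃ (by rw [w11, w5]; exact hc.2.1)
      (by
        rw [w11, w5, hA3, r8, hW]
        exact walk_occ_le hb hS hx (by rw [← hW]; exact hc.1)) hM w1 hin (by rw [w2]; exact hg)
      (by rw [w9]; exact hWnc)
      (by
        have := hD _ hWoc
        rw [hv17, w10, hA3, f6]
        omega) (by rw [w2, hA3, f8]; exact h8) (by rw [w2, hA3, f9]; exact h9)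
    simpa only [w11, w5, w2, w9, w10, hv17, hA3, f6, r8] using this
  · rw [if_neg hc, if_neg hc]
    simp only [St.setV_A, hA, f8, f9, f6]
    exact ⟨m8, m9, trivial⟩

end PatternMatching

namespace PatternMatching

/-! ## The dynamic programme -/

def markCmd : Cmd :=
  .loop 3 1 0 (.whenEq (rd 0 (vr 3)) (vr 4) (.store 5 (vr 3) 1))

/-- Array `5` is updated only after all guesses, which still read the old set. -/
def dpStage (k : ℕ) : Cmd :=
  block [.assign 4 (rd 4 (vr 1)), .loop 2 (2 * k + 1) 0 (dpBody k), markCmd]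

def dpCmd (k : ℕ) : Cmd := block [.store 6 0 1, .loop 1 0 1 (dpStage k)]

theorem markCmd_spec {E : Env} {b S : ℕ → ℕ} {x : ℕ} {s : St} (hB : s.A 0 = b) (hS : s.A 5 = S)
    (hx : s.v 4 = x) (hb : ∀ j ≥ E.n + 2, b j ≠ x) : (markCmd.den E s).A 5 = mark b S x := by
  have key : (markCmd.den E s).A 0 = b ∧ (markCmd.den E s).v 4 = x ∧
      ∀ j, (markCmd.den E s).A 5 j = if j < E.lim 1 0 then mark b S x j else S j := by
    refine Cmd.loop_inv (fun J s' => s'.A 0 = b ∧ s'.v 4 = x ∧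
      ∀ j, s'.A 5 j = if j < J then mark b S x j else S j) ⟨hB, hx, fun j => by simp [hS]⟩ ?_
    rintro J - s' ⟨h1, h2, h3⟩
    simp only [den_whenEq, ev_arr, ev_var, St.setV_A, St.setV_v, Nat.reduceEqDiff, if_true, if_false,
      h1, h2]
    by_cases h4 : b J = x
    · rw [if_pos h4]
      refine ⟨by simpa using h1, by simpa using h2, fun j => ?_⟩
      simp only [den_store, ev_var, ev_one, St.setA_A, St.setV_v, St.setV_A, if_true,
        Function.update_apply]
      by_cases h5 : j = J
      · subst h5
        simp [mark, h4]
      · rw [if_neg h5, h3]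
        simp only [show j < J + 1 ↔ j < J by omega]
    · rw [if_neg h4]
      refine ⟨by simpa using h1, by simpa using h2, fun j => ?_⟩
      simp only [St.setV_A, h3]
      by_cases h5 : j = J
      · subst h5
        simp [mark, h4]
      · simp only [show j < J + 1 ↔ j < J by omega]
  funext j
  rw [key.2.2 j, E.lim_base]
  split_ifs with h
  · rfl
  · simp [mark, hb j (by omega)]

/-- Each finite entry of the table is the cost of a placement with this code. -/
def Env.Sound (E : Env) (k : ℕ) (S d : ℕ → ℕ) : Prop :=
  ∀ c < (E.n + 2) ^ (2 * k), d c ≠ 0 → ∃ L h P, E.Feas S L P ∧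
    horner (E.n + 2) S P (E.n + 2) = c ∧ E.costOn S L h P + 1 = d c

/-- No complete placement is cheaper than the table says. -/
def Env.Optimal (E : Env) (S d : ℕ → ℕ) : Prop :=
  ∀ L h P, E.Full L P → d (horner (E.n + 2) S P (E.n + 2)) ≠ 0 ∧
    d (horner (E.n + 2) S P (E.n + 2)) ≤ E.costOn S L h P + 1

/-- Each covered letter costs at most `n`. This serves to show that sums with table entries stay
below `M`. -/
theorem Env.Feas.costOn_le {E : Env} {S L P : ℕ → ℕ} (hn : 1 ≤ E.n) (hF : E.Feas S L P)
    (h : ℕ → ℕ → ℕ) : E.costOn S L h P ≤ E.m * E.n := by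
  refine (Finset.sum_le_card_nsmul _ _ E.n fun j _ => ?_).trans (by simp)
  split_ifs with hj
  · obtain ⟨h1, h2⟩ := hF j hj
    simp only [Env.err, Env.len] at h1 ⊢
    split_ifs with h3
    · refine (Finset.sum_le_card_nsmul _ _ 1 fun o _ => ?_).trans ?_
      · split_ifs <;> simp
      · rw [if_pos h3] at h1
        simp only [Finset.card_range, smul_eq_mul, mul_one]
        omega
    · exact hn
    · exact Nat.zero_le _
  · exact Nat.zero_le _

theorem better_ne_zero {a v : ℕ} (h : v ≠ 0) : better a v ≠ 0 := by
  unfold better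
  split_ifs <;> omega

theorem better_le {a v : ℕ} : better a v ≤ v := by
  unfold better
  split_ifs <;> omega

theorem better_le_left {a v : ℕ} (h : a ≠ 0) : better a v ≤ a := by
  unfold better
  split_ifs <;> omega

section Stage

variable {E : Env} {k i : ℕ} {b S : ℕ → ℕ} {x : ℕ}

/-- The guess `g` describes the placement given by `P` of the positions that `x` adds. -/
def Env.Traces (E : Env) (b S : ℕ → ℕ) (x : ℕ) (L : ℕ → ℕ) (h : ℕ → ℕ → ℕ) (P : ℕ → ℕ)
    (g : ℕ) : Prop :=
  ∀ occ,
    (walk E S (mark b S x) g occ (E.n + 2)).ok = 1 ∧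
    (walk E S (mark b S x) g occ (E.n + 2)).oc = horner (E.n + 2) S P (E.n + 2) ∧
    (walk E S (mark b S x) g occ (E.n + 2)).nc = horner (E.n + 2) (mark b S x) P (E.n + 2) ∧
    (walk E S (mark b S x) g occ (E.n + 2)).t * (g % (E.n + 2)) ≤ E.n ∧
    E.costOn (mark b S x) L h P = E.costOn S L h P +
      ((walk E S (mark b S x) g occ (E.n + 2)).cost +
      ∑ s ∈ Finset.range (walk E S (mark b S x) g occ (E.n + 2)).t,
        E.wordErr (g % (E.n + 2)) (h x) ((walk E S (mark b S x) g occ (E.n + 2)).occ s))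

/-- The invariant of the loop over the guesses. -/
structure StageInv (E : Env) (k i : ℕ) (b S : ℕ → ℕ) (x : ℕ) (D : ℕ → ℕ) (g : ℕ) (s : St) :
    Prop where
  owner : s.A 0 = b
  cover : s.A 5 = S
  var : s.v 4 = x
  stage : s.v 1 = i
  cnt : ∀ j ≥ (i * (E.n + 2) ^ (2 * k + 1) + g) * (E.n + 2) * (E.n + 2), s.A 8 j = 0
  best : ∀ j ≥ (i * (E.n + 2) ^ (2 * k + 1) + g) * (E.n + 2), s.A 9 j = 0
  old : ∀ c < (E.n + 2) ^ (2 * k), s.A 6 (i * (E.n + 2) ^ (2 * k) + c) = D c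
  fresh : ∀ c ≥ (i + 2) * (E.n + 2) ^ (2 * k), s.A 6 c = 0
  sound : E.Sound k (mark b S x) fun c => s.A 6 ((i + 1) * (E.n + 2) ^ (2 * k) + c)
  optimal : ∀ g' < g, ∀ L h P, E.Full L P → E.Traces b S x L h P g' →
    s.A 6 ((i + 1) * (E.n + 2) ^ (2 * k) + horner (E.n + 2) (mark b S x) P (E.n + 2)) ≠ 0 ∧
    s.A 6 ((i + 1) * (E.n + 2) ^ (2 * k) + horner (E.n + 2) (mark b S x) P (E.n + 2)) ≤
      E.costOn (mark b S x) L h P + 1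

/-- Soundness is `walk_sound` with an image `u` that attains the minimum. For optimality, a complete
placement traced by `g` has a finite old entry by `hO`, so the guess passes all tests, and the best
image is no worse than that of the placement. -/
theorem StageInv.step (hE : E.Ok) (hw : ∀ i < E.n, E.inp i ≤ E.n)
    (hM : (E.n + 2) ^ (2 * k + 5) < E.M) (hb : E.Owner b) (hS : E.Closed b S) (hx : x ≠ 0)
    (htS : togCount S (E.n + 2) ≤ 2 * k) (htS' : togCount (mark b S x) (E.n + 2) ≤ 2 * k)
    (hin : i < E.n) {D : ℕ → ℕ} (hD : E.Sound k S D) (hO : E.Optimal S D) {g : ℕ}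
    (hg : g < (E.n + 2) ^ (2 * k + 1)) {s : St} (H : StageInv E k i b S x D g s) :
    StageInv E k i b S x D (g + 1) ((dpBody k).den E (s.setV 2 g)) := by
  have hn := hE.pos
  have hS' := hS.mark hb hx
  have hW : walk E S (mark b S x) g (s.A 7) (E.n + 2) =
    walk E S (mark b S x) ((s.setV 2 g).v 2) ((s.setV 2 g).A 7) (E.n + 2) := by simp
  set W := walk E S (mark b S x) g (s.A 7) (E.n + 2) with hWd
  have hWoc : W.oc < (E.n + 2) ^ (2 * k) := by
    rw [hWd, walk_oc]
    exact (horner_lt fun j _ _ => by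
      have := walkPos_le (E := E) (S := S) (S' := mark b S x) (g := g) (occ := s.A 7) j
      omega).trans_le (Nat.pow_le_pow_right (by omega) htS)
  have hWnc : W.nc < (E.n + 2) ^ (2 * k) := by
    rw [hWd, walk_nc]
    exact (horner_lt fun j _ _ => by
      have := walkPos_le (E := E) (S := S) (S' := mark b S x) (g := g) (occ := s.A 7) j
      omega).trans_le (Nat.pow_le_pow_right (by omega) htS')
  have hcode : ∀ {S₀ P : ℕ → ℕ}, E.Closed b S₀ → togCount S₀ (E.n + 2) ≤ 2 * k →
      (∀ j ≤ E.m, P j ≤ E.n) → horner (E.n + 2) S₀ P (E.n + 2) < (E.n + 2) ^ (2 * k) := by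
    intro S₀ P h1 h2 h3
    refine (horner_lt fun j _ hj => ?_).trans_le (Nat.pow_le_pow_right (by omega) h2)
    have : j ≤ E.m := by
      by_contra hjm
      obtain ⟨j, rfl⟩ : ∃ j', j = j' + 1 := ⟨j - 1, by omega⟩
      rw [prev_succ, h1.out j (by omega), h1.out (j + 1) (by omega)] at hj
      exact hj rfl
    have := h3 j this
    omega
  have hDle : ∀ c < (E.n + 2) ^ (2 * k), D c ≤ E.m * E.n + 1 := by
    intro c hc
    by_cases h0 : D c = 0
    · omega
    · obtain ⟨L, h, P, h1, -, h3⟩ := hD c hc h0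
      have := h1.costOn_le hn h
      omega
  have hbnd : E.m * E.n + 1 + (E.n + 2) + E.n < E.M := by
    have h1 : (E.n + 2) ^ 3 ≤ (E.n + 2) ^ (2 * k + 5) :=
      Nat.pow_le_pow_right (by omega) (by omega)
    have h2 : E.m * E.n ≤ E.n * E.n := Nat.mul_le_mul_right _ hE.m
    nlinarith
  obtain ⟨q8, q9, hq⟩ := dpBody_spec hE (k := k) (i := i) hw hM hb hS hx htS htS' (s.setV 2 g)
    (by simpa using H.owner) (by simpa using H.cover) (by simpa using H.var)
    (by simpa using H.stage) hin (by simpa using hg)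
    (fun c hc => by
      rw [St.setV_A, H.old c hc]
      have := hDle c hc
      omega)
    (by simpa using H.cnt) (by simpa using H.best) W hW
  simp only [St.setV_v, if_true, St.setV_A] at q8 q9 hq
  have f0 : ((dpBody k).den E (s.setV 2 g)).A 0 = b := by
    rw [Cmd.den_A (by rfl), St.setV_A, H.owner]
  have f5 : ((dpBody k).den E (s.setV 2 g)).A 5 = S := by
    rw [Cmd.den_A (by rfl), St.setV_A, H.cover]
  have f4 : ((dpBody k).den E (s.setV 2 g)).v 4 = x := by
    rw [Cmd.den_v (by rfl)]
    simpa using H.var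
  have f1 : ((dpBody k).den E (s.setV 2 g)).v 1 = i := by
    rw [Cmd.den_v (by rfl)]
    simpa using H.stage
  have hle : ∀ {L P}, E.Full L P → ∀ j ≤ E.m, P j ≤ E.n := fun hF j hj => hF.le hj
  by_cases hc : W.ok = 1 ∧ W.t * (g % (E.n + 2)) ≤ E.n ∧
      s.A 6 (i * (E.n + 2) ^ (2 * k) + W.oc) ≠ 0
  · rw [if_pos hc] at hq
    obtain ⟨e, ⟨u, hu⟩, hall, h6⟩ := hq
    rw [H.old _ hWoc] at h6 hc
    have hadd : (i + 1) * (E.n + 2) ^ (2 * k) = i * (E.n + 2) ^ (2 * k) + (E.n + 2) ^ (2 * k) := by ring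
    have hadd2 : (i + 2) * (E.n + 2) ^ (2 * k) = (i + 1) * (E.n + 2) ^ (2 * k) + (E.n + 2) ^ (2 * k) := by ring
    have hnew : ∀ c, ((dpBody k).den E (s.setV 2 g)).A 6 ((i + 1) * (E.n + 2) ^ (2 * k) + c) =
        if c = W.nc then better (s.A 6 ((i + 1) * (E.n + 2) ^ (2 * k) + c)) (D W.oc + W.cost + e)
        else s.A 6 ((i + 1) * (E.n + 2) ^ (2 * k) + c) := by
      intro c
      rw [h6, Function.update_apply]
      by_cases h : c = W.nc
      · rw [if_pos (by omega), if_pos h, h]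
      · rw [if_neg (by omega), if_neg h]
    refine ⟨f0, f5, f4, f1, q8, q9, ?_, ?_, ?_, ?_⟩
    · intro c hc'
      rw [h6, Function.update_of_ne (by omega), H.old c hc']
    · intro c hc'
      rw [h6, Function.update_of_ne (by omega), H.fresh c hc']
    · intro c hcT hne
      simp only [hnew] at hne ⊢
      by_cases hcn : c = W.nc
      · rw [if_pos hcn] at hne ⊢
        simp only [better] at hne ⊢
        split_ifs with h7
        · obtain ⟨L, h, P, g1, g2, g3⟩ := hD _ hWoc hc.2.2
          obtain ⟨L', h', P', g4, g5, g6⟩ := walk_sound hb hS hx hc.1 g1 g2.symm (h := h) u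
          refine ⟨L', h', P', g4, by rw [g5, hcn], ?_⟩
          rw [g6, ← hWd, ← hu]
          omega
        · rw [if_neg h7] at hne
          exact H.sound c hcT hne
      · rw [if_neg hcn] at hne ⊢
        exact H.sound c hcT hne
    · intro g' hg' L h P hF ht
      have hcT := hcode hS' htS' (hle hF)
      simp only [hnew]
      by_cases hg'g : g' < g
      · obtain ⟨o1, o2⟩ := H.optimal g' hg'g L h P hF ht
        split_ifs
        · exact ⟨better_ne_zero (by omega), (better_le_left o1).trans o2⟩
        · exact ⟨o1, o2⟩
      · obtain rfl : g' = g := by omega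
        obtain ⟨-, t2, t3, -, t5⟩ := ht (s.A 7)
        rw [← hWd] at t2 t3 t5
        rw [if_pos t3.symm]
        obtain ⟨o1, o2⟩ := hO L h P hF
        rw [← t2] at o1 o2
        refine ⟨better_ne_zero (by omega), better_le.trans ?_⟩
        have := hall (h x)
        rw [t5]
        omega
  · rw [if_neg hc] at hq
    rw [H.old _ hWoc] at hc
    refine ⟨f0, f5, f4, f1, q8, q9, ?_, ?_, ?_, ?_⟩
    · rw [hq]
      exact H.old
    · rw [hq]
      exact H.fresh
    · rw [hq]
      exact H.sound
    · intro g' hg' L h P hF ht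
      rw [hq]
      by_cases hg'g : g' < g
      · exact H.optimal g' hg'g L h P hF ht
      · obtain rfl : g' = g := by omega
        obtain ⟨t1, t2, -, t4, -⟩ := ht (s.A 7)
        rw [← hWd] at t1 t2 t4
        refine absurd ⟨t1, t4, ?_⟩ hc
        rw [t2]
        exact (hO L h P hF).1

end Stage

/-- The invariant of the loop over the stages. -/
structure DpInv (E : Env) (k : ℕ) (b ord : ℕ → ℕ) (i : ℕ) (s : St) : Prop where
  owner : s.A 0 = b
  order : s.A 4 = ord
  cover : s.A 5 = PatternMatching.cover b ord i
  cnt : ∀ j ≥ i * (E.n + 2) ^ (2 * k + 1) * (E.n + 2) * (E.n + 2), s.A 8 j = 0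
  best : ∀ j ≥ i * (E.n + 2) ^ (2 * k + 1) * (E.n + 2), s.A 9 j = 0
  fresh : ∀ c ≥ (i + 1) * (E.n + 2) ^ (2 * k), s.A 6 c = 0
  sound : E.Sound k (PatternMatching.cover b ord i) fun c => s.A 6 (i * (E.n + 2) ^ (2 * k) + c)
  optimal : E.Optimal (PatternMatching.cover b ord i) fun c =>
    s.A 6 (i * (E.n + 2) ^ (2 * k) + c)

theorem horner_const {N : ℕ} {S P : ℕ → ℕ} (hS : ∀ j, S j = 0) (J : ℕ) : horner N S P J = 0 := by
  induction J with
  | zero => rfl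
  | succ J ih =>
    rw [horner, if_neg, ih]
    cases J <;> simp [prev, hS]

/-- The full set changes only at `0` and at `m`, so its code consists of the two ends. -/
theorem horner_initial {N m : ℕ} {S P : ℕ → ℕ} (hm : 1 ≤ m) (h1 : ∀ j < m, S j = 1)
    (h0 : ∀ j ≥ m, S j = 0) {J : ℕ} (hJ : m < J) : horner N S P J = P 0 * N + P m := by
  have key : ∀ J, horner N S P J =
      if J = 0 then 0 else if J ≤ m then P 0 else P 0 * N + P m := by
    intro J
    induction J with
    | zero => rfl
    | succ J ih =>
      rw [horner, ih, if_neg (by omega : J + 1 ≠ 0)]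
      cases J with
      | zero => simp [prev, h1 0 (by omega), hm]
      | succ J =>
        simp only [prev_succ, Nat.add_eq_zero_iff, one_ne_zero, and_false, if_false]
        rcases lt_trichotomy (J + 1) m with h | h | h
        · rw [h1 _ h, h1 _ (by omega), if_neg (by simp), if_pos (by omega), if_pos (by omega)]
        · rw [h0 _ (by omega), h1 _ (by omega), if_pos (by simp), if_pos (by omega),
            if_neg (by omega), h]
        · rw [h0 _ (by omega), h0 _ (by omega), if_neg (by simp), if_neg (by omega),
            if_neg (by omega)]
  rw [key, if_neg (by omega), if_neg (by omega)]

/-- Before the first guess the row `i + 1` is empty, hence sound, and optimality concerns no guess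
yet. After the last one, `walk_complete` turns optimality for traced placements into optimality for
all complete ones. -/
theorem dpStage_step {E : Env} (hE : E.Ok) {k : ℕ} (hw : ∀ i < E.n, E.inp i ≤ E.n)
    (hM : (E.n + 2) ^ (2 * k + 5) < E.M) {b ord : ℕ → ℕ} (hb : E.Owner b)
    (hord : ∀ i < E.m, ord i ≠ 0)
    (htog : ∀ i ≤ E.m, togCount (cover b ord i) (E.n + 2) ≤ 2 * k) {i : ℕ} (hi : i < E.m) {s : St}
    (H : DpInv E k b ord i s) :
    DpInv E k b ord (i + 1) ((dpStage k).den E (s.setV 1 i)) := by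
  have hn := hE.pos
  have hm := hE.m
  have hcl : E.Closed b (cover b ord i) := cover_closed hb fun i' h => hord i' (by omega)
  have hstep := @StageInv.step E k i b (cover b ord i) (ord i) hE hw hM hb hcl (hord i hi)
    (htog i (by omega)) (htog (i + 1) (by omega)) (by omega) _ H.sound H.optimal
  have hadd : (i + 1) * (E.n + 2) ^ (2 * k) = i * (E.n + 2) ^ (2 * k) + (E.n + 2) ^ (2 * k) := by
    ring
  have hadd2 : (i + 2) * (E.n + 2) ^ (2 * k) =
    (i + 1) * (E.n + 2) ^ (2 * k) + (E.n + 2) ^ (2 * k) := by ring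
  simp only [dpStage, den_block_cons, den_block_nil, den_assign, ev_arr, ev_var, St.setV_A,
    St.setV_v, if_true]
  rw [H.order]
  have hK := Cmd.loop_inv (E := E) (x := 2) (a := 2 * k + 1) (b := 0) (c := dpBody k)
    (s := (s.setV 1 i).setV 4 (ord i))
    (StageInv E k i b (cover b ord i) (ord i) fun c => s.A 6 (i * (E.n + 2) ^ (2 * k) + c))
    ⟨by simpa using H.owner, by simpa using H.cover, by simp, by simp, by simpa using H.cnt,
      by simpa using H.best, fun c _ => by simp,
      fun c hc => by simpa using H.fresh c (by omega),
      fun c _ hne => absurd (by simpa using H.fresh _ (by omega)) hne,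
      fun g' hg' => absurd hg' (by omega)⟩
    (fun g hg s' H' => hstep (by rwa [E.lim_pow] at hg) H')
  rw [E.lim_pow] at hK
  set s' := (Cmd.loop 2 (2 * k + 1) 0 (dpBody k)).den E ((s.setV 1 i).setV 4 (ord i)) with hs'
  have f0 : (markCmd.den E s').A 0 = s'.A 0 := Cmd.den_A (by rfl) _
  have f4 : (markCmd.den E s').A 4 = s'.A 4 := Cmd.den_A (by rfl) _
  have f6 : (markCmd.den E s').A 6 = s'.A 6 := Cmd.den_A (by rfl) _
  have f8 : (markCmd.den E s').A 8 = s'.A 8 := Cmd.den_A (by rfl) _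
  have f9 : (markCmd.den E s').A 9 = s'.A 9 := Cmd.den_A (by rfl) _
  have g4 : s'.A 4 = s.A 4 := by
    rw [hs', Cmd.den_A (by rfl), St.setV_A, St.setV_A]
  refine ⟨f0.trans hK.owner, f4.trans (g4.trans H.order), ?_, ?_, ?_, ?_, ?_, ?_⟩
  · exact markCmd_spec hK.owner hK.cover hK.var fun j hj =>
      by rw [hb.out j (by omega)]; exact (hord i hi).symm
  · rw [f8]
    intro j hj
    exact hK.cnt j (by simpa only [add_mul, one_mul] using hj)
  · rw [f9]
    intro j hj
    exact hK.best j (by simpa only [add_mul, one_mul] using hj)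
  · rw [f6]
    exact hK.fresh
  · rw [f6]
    exact hK.sound
  · rw [f6]
    intro L h P hF
    obtain ⟨g, hg, ht⟩ := walk_complete hb hcl (hord i hi) (htog i (by omega))
      (htog (i + 1) (by omega)) hF h
    exact hK.optimal g hg L h P hF ht

/-- A complete placement has the code `0 * (n + 2) + n`. Conversely, a feasible placement of all
positions with the code `n` starts at `0` and ends at `n`, hence is complete. -/
theorem dpCmd_spec {E : Env} (hE : E.Ok) {k : ℕ} (hk : 1 ≤ k) (hw : ∀ i < E.n, E.inp i ≤ E.n)
    (hM : (E.n + 2) ^ (2 * k + 5) < E.M) {b ord : ℕ → ℕ} (hb : E.Owner b)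
    (hord : ∀ i < E.m, ord i ≠ 0)
    (htog : ∀ i ≤ E.m, togCount (cover b ord i) (E.n + 2) ≤ 2 * k)
    (hall : ∀ j < E.m, cover b ord E.m j = 1) (s : St) (h0 : s.A 0 = b) (h4 : s.A 4 = ord)
    (h5 : ∀ j, s.A 5 j = 0) (h6 : ∀ j, s.A 6 j = 0) (h8 : ∀ j, s.A 8 j = 0)
    (h9 : ∀ j, s.A 9 j = 0) {d : ℕ}
    (hd : d = ((dpCmd k).den E s).A 6 (E.m * (E.n + 2) ^ (2 * k) + E.n)) :
    (∀ L h P, E.Full L P → d ≠ 0 ∧ d ≤ E.total L h P + 1) ∧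
    (d ≠ 0 → ∃ L h P, E.Full L P ∧ E.total L h P + 1 = d) := by
  have hn := hE.pos
  have hm := hE.m
  have hm1 := hE.m_pos
  have hT : 0 < (E.n + 2) ^ (2 * k) := Nat.pow_pos (by omega)
  have hI : DpInv E k b ord E.m ((dpCmd k).den E s) := by
    simp only [dpCmd, den_block_cons, den_block_nil, den_store, ev_zero, ev_one]
    rw [← E.lim_m]
    refine Cmd.loop_inv _ ?_ fun i hi s' H => dpStage_step hE hw hM hb hord htog (by rwa [E.lim_m] at hi) H
    have hc0 : ∀ P, horner (E.n + 2) (cover b ord 0) P (E.n + 2) = 0 := fun P =>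
      horner_const (fun j => rfl) _
    refine ⟨by simpa using h0, by simpa using h4, ?_, by simpa using h8, by simpa using h9, ?_, ?_,
      ?_⟩
    · funext j
      simpa [PatternMatching.cover] using h5 j
    · intro c hc
      rw [St.setA_A, if_pos rfl, Function.update_of_ne (by omega), h6]
    -- The only finite entry of row `0` is that of the empty set, with the value `1` for cost `0`.
    · intro c hc hne
      have hc' : c = 0 := by
        by_contra hc'
        refine hne ?_
        simp only [Nat.zero_mul, zero_add]
        rw [St.setA_A, if_pos rfl, Function.update_of_ne hc', h6]
      subst hc'
      refine ⟨fun _ => 0, fun _ _ => 0, fun _ => 0, fun j hj => absurd hj (by simp [cover]),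
        hc0 _, ?_⟩
      simp [Env.costOn, cover]
    · intro L h P _
      simp [hc0]
  have hcl : E.Closed b (cover b ord E.m) := cover_closed hb hord
  have hhor : ∀ P, horner (E.n + 2) (cover b ord E.m) P (E.n + 2) = P 0 * (E.n + 2) + P E.m :=
    fun P => horner_initial hm1 hall hcl.out (by omega)
  have hcost : ∀ L h P, E.costOn (cover b ord E.m) L h P = E.total L h P := fun L h P =>
    Finset.sum_congr rfl fun j hj => if_pos (hall j (Finset.mem_range.1 hj))
  -- Here `1 ≤ k` is used: the code `n` must fit into a row of the table.
  have hnT : E.n < (E.n + 2) ^ (2 * k) := by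
    calc E.n < (E.n + 2) ^ 1 := by rw [pow_one]; omega
      _ ≤ _ := Nat.pow_le_pow_right (by omega) (by omega)
  constructor
  · intro L h P hF
    have := hI.optimal L h P hF
    rw [hhor, hF.zero, hF.last, zero_mul, zero_add, hcost] at this
    rwa [hd]
  · intro hne
    obtain ⟨L, h, P, h1, h2, h3⟩ := hI.sound E.n hnT (by rwa [hd] at hne)
    rw [hhor] at h2
    rw [hcost] at h3
    have hP : ∀ j < E.m, P (j + 1) = P j + E.len L j ∧ P (j + 1) ≤ E.n := fun j hj =>
      h1 j (hall j hj)
    have hlast := (hP (E.m - 1) (by omega)).2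
    rw [Nat.sub_add_cancel hm1] at hlast
    have hzero : P 0 = 0 := by
      by_contra h
      have := Nat.le_mul_of_pos_left (E.n + 2) (Nat.pos_of_ne_zero h)
      omega
    refine ⟨L, h, P, ⟨hzero, ?_, fun j hj => (hP j hj).1⟩, h3.trans hd.symm⟩
    rw [hzero] at h2
    omega

end PatternMatching

namespace PatternMatching

/-! ## The search for a marking order -/

/-- Digits `j + 1` instead of `j`, so that a change at position `0` leaves a nonzero digit. -/
def Env.setCode (E : Env) (S : ℕ → ℕ) : ℕ := horner (E.n + 2) S (· + 1) (E.n + 2)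

theorem Env.Closed.le_of_toggle {E : Env} {b S : ℕ → ℕ} (h : E.Closed b S) {j : ℕ}
    (hj : S j ≠ prev S j) : j ≤ E.m := by
  by_contra hjm
  obtain ⟨j, rfl⟩ : ∃ j', j = j' + 1 := ⟨j - 1, by omega⟩
  rw [prev_succ, h.out j (by omega), h.out (j + 1) (by omega)] at hj
  exact hj rfl

theorem Env.Closed.setCode_inj {E : Env} {b S S' : ℕ → ℕ} (hm : E.m ≤ E.n) (h : E.Closed b S)
    (h' : E.Closed b S') (hc : E.setCode S = E.setCode S') : S = S' := by
  -- No change occurs after `m ≤ n`, and `horner_pos_inj` asks for a length below the base `n + 2`.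
  have key : ∀ {S}, E.Closed b S → E.setCode S = horner (E.n + 2) S (· + 1) (E.n + 1) := by
    intro S hS
    rw [setCode, horner, if_neg]
    intro hne
    have := hS.le_of_toggle hne
    omega
  rw [key h, key h'] at hc
  funext j
  by_cases hj : j < E.n + 1
  · exact horner_pos_inj h.le h'.le (by omega) hc j hj
  · rw [h.out j (by omega), h'.out j (by omega)]

theorem Env.Closed.setCode_lt {E : Env} {b S : ℕ → ℕ} {k : ℕ} (hm : E.m ≤ E.n) (h : E.Closed b S)
    (ht : togCount S (E.n + 2) ≤ 2 * k) : E.setCode S < (E.n + 2) ^ (2 * k) :=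
  (horner_lt fun j _ hj => by have := h.le_of_toggle hj; omega).trans_le
    (Nat.pow_le_pow_right (by omega) ht)

theorem togCount_le (S : ℕ → ℕ) (J : ℕ) : togCount S J ≤ J := by
  induction J with
  | zero => exact le_rfl
  | succ J ih =>
    simp only [togCount]
    split_ifs <;> omega

theorem cover_congr_ord {b ord ord' : ℕ → ℕ} {i : ℕ} (h : ∀ i' < i, ord i' = ord' i') :
    cover b ord i = cover b ord' i := by
  induction i with
  | zero => rfl
  | succ i ih =>
    funext j
    rw [cover, cover, ih fun i' hi => h i' (by omega), h i (by omega)]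

/-- Variable `25` counts all changes, but only the first `2 * k` enter the code in variable `9`; a
set with more changes is rejected by the count. -/
def encodeCmd (k : ℕ) : Cmd :=
  block [.assign 25 0, .assign 9 0, .assign 26 0,
    .loop 3 1 0 (block [.assign 27 (rd 3 (vr 17 * .base + vr 3)),
      .whenEq (rd 0 (vr 3)) (vr 4) (.assign 27 1),
      .whenNe (vr 27) (vr 26) (block [
        .when (vr 25) (.const (2 * k)) (.assign 9 (vr 9 * .base + (vr 3 + 1))),
        .assign 25 (vr 25 + 1)]),
      .assign 26 (vr 27)])]

def copyCmd : Cmd :=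
  .loop 3 1 0 (block [.store 3 (vr 23 * .base + vr 3) (rd 3 (vr 17 * .base + vr 3)),
    .whenEq (rd 0 (vr 3)) (vr 4) (.store 3 (vr 23 * .base + vr 3) 1)])

/-- Array `1` keeps the owner added last (`0` if the set is not recorded), array `2` the code of the
predecessor, and array `3` the indicator of the set as a row of length `n + 2`. -/
def recordCmd (k : ℕ) : Cmd :=
  block [.assign 23 ((vr 1 + 1) * basePow (2 * k) + vr 9),
    .when (rd 1 (vr 23)) 1
      (block [.store 1 (vr 23) (vr 4), .store 2 (vr 23) (vr 2 / .base), copyCmd])]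

/-- Variable `2` encodes a pair: the code of a set, and a position whose owner is to be added. -/
def searchBody (k : ℕ) : Cmd :=
  block [.assign 17 (vr 1 * basePow (2 * k) + vr 2 / .base), .assign 29 (vr 2 % .base),
    .when (vr 29) .m (.when 0 (rd 1 (vr 17)) (block [.assign 4 (rd 0 (vr 29)), encodeCmd k,
      .when (vr 25) (.const (2 * k + 1)) (recordCmd k)]))]

/-- Predecessors are followed from the full set, whose code is `n + 2 + (m + 1)` because it changes
at `0` and at `m`. -/
def backCmd (k : ℕ) : Cmd :=
  block [.assign 28 (.base + (.m + 1)), .loop 1 0 1 (block [.assign 18 (.m - vr 1),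
    .assign 17 (vr 18 * basePow (2 * k) + vr 28), .store 4 (vr 18 - 1) (rd 1 (vr 17)),
    .assign 28 (rd 2 (vr 17))])]

/-- The value `1` stored at the beginning merely marks the empty set in layer `0` as recorded. -/
def searchCmd (k : ℕ) : Cmd :=
  block [.store 1 0 1, .loop 1 0 1 (.loop 2 (2 * k + 1) 0 (searchBody k)), backCmd k]

theorem encodeCmd_spec {E : Env} {k : ℕ} (hm : E.m ≤ E.n) (hM : (E.n + 2) ^ (2 * k + 5) < E.M)
    {b S : ℕ → ℕ} {x : ℕ} (hS' : E.Closed b (mark b S x)) (s : St) (h0 : s.A 0 = b)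
    (h4 : s.v 4 = x) (h17 : s.v 17 * (E.n + 2) + (E.n + 2) < E.M)
    (h3 : ∀ j < E.n + 2, s.A 3 (s.v 17 * (E.n + 2) + j) = S j) :
    ((encodeCmd k).den E s).v 25 = togCount (mark b S x) (E.n + 2) ∧
    (togCount (mark b S x) (E.n + 2) ≤ 2 * k →
      ((encodeCmd k).den E s).v 9 = E.setCode (mark b S x)) := by
  set S' := mark b S x with hS'd
  let I : ℕ → St → Prop := fun J s' =>
    s'.A 0 = b ∧ s'.v 4 = x ∧ s'.v 17 = s.v 17 ∧ s'.A 3 = s.A 3 ∧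
      s'.v 26 = prev S' J ∧ s'.v 25 = togCount S' J ∧
      (togCount S' J ≤ 2 * k → s'.v 9 = horner (E.n + 2) S' (· + 1) J)
  have hI : I (E.n + 2) ((encodeCmd k).den E s) := by
    simp only [encodeCmd, den_block_cons, den_block_nil, den_assign, ev_zero]
    rw [← E.lim_base]
    refine Cmd.loop_inv I ⟨by simpa using h0, by simpa using h4, by simp, by simp, by simp [prev],
      by simp [togCount], by simp [horner]⟩ ?_
    rintro J hJ s' ⟨i1, i2, i3, i4, i5, i6, i7⟩
    rw [E.lim_base] at hJ
    have e1 : s.v 17 * (E.n + 2) % E.M = s.v 17 * (E.n + 2) := Nat.mod_eq_of_lt (by omega)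
    have e2 : (s.v 17 * (E.n + 2) + J) % E.M = s.v 17 * (E.n + 2) + J :=
      Nat.mod_eq_of_lt (by omega)
    have hJ1 : (J + 1) % E.M = J + 1 := Nat.mod_eq_of_lt (by omega)
    have htog := togCount_le S' J
    have hcnt : (togCount S' J + 1) % E.M = togCount S' J + 1 := Nat.mod_eq_of_lt (by omega)
    simp only [den_block_cons, den_block_nil, den_assign]
    have hx27 : Exp.ev E (s'.setV 3 J) (rd 3 (vr 17 * .base + vr 3)) = S J := by
      simp only [ev_arr, ev_add, ev_mul, ev_var, ev_base, St.setV_v, St.setV_A, Nat.reduceEqDiff,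
        if_true, if_false, i3, i4, e1, e2, h3 J hJ]
    rw [hx27]
    set s₁ := (Cmd.whenEq (rd 0 (vr 3)) (vr 4) (.assign 27 1)).den E
      ((s'.setV 3 J).setV 27 (S J)) with hs₁
    have hs₁' : s₁ = if b J = x then ((s'.setV 3 J).setV 27 (S J)).setV 27 1 else
        (s'.setV 3 J).setV 27 (S J) := by
      rw [hs₁, den_whenEq]
      simp only [ev_arr, ev_var, St.setV_A, St.setV_v, Nat.reduceEqDiff, if_true, if_false, i1, i2,
        den_assign, ev_one]
    have hv27 : s₁.v 27 = S' J := by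
      rw [hs₁', hS'd, mark]
      split_ifs <;> simp
    have hv : ∀ y, y ≠ 27 → s₁.v y = (s'.setV 3 J).v y := by
      intro y hy
      rw [hs₁']
      split_ifs <;> simp [hy]
    have hA : s₁.A = s'.A := by
      rw [hs₁']
      split_ifs <;> simp
    have v3 : s₁.v 3 = J := by simp [hv]
    have v4 : s₁.v 4 = x := by simp [hv, i2]
    have v17 : s₁.v 17 = s.v 17 := by simp [hv, i3]
    have v9 : s₁.v 9 = s'.v 9 := by simp [hv]
    have v26 : s₁.v 26 = prev S' J := by simp [hv, i5]
    have v25 : s₁.v 25 = togCount S' J := by simp [hv, i6]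
    simp only [den_whenNe, den_when, ev_var, ev_const, hv27, v26, v25, den_block_cons,
      den_block_nil, den_assign, ev_add, ev_mul, ev_base, ev_one, v3, hJ1, v9]
    by_cases hne : S' J ≠ prev S' J
    · rw [if_pos hne]
      have ht1 : togCount S' (J + 1) = togCount S' J + 1 := by rw [togCount, if_pos hne]
      by_cases hlt : togCount S' J < 2 * k
      · rw [if_pos hlt, i7 hlt.le]
        have h9 : horner (E.n + 2) S' (· + 1) (J + 1) < E.M := by
          refine (horner_lt fun j _ hj => ?_).trans_le ((Nat.pow_le_pow_right (by omega)
            (show togCount S' (J + 1) ≤ 2 * k + 5 by omega)).trans hM.le)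
          have := hS'.le_of_toggle hj
          omega
        rw [horner, if_pos hne] at h9
        rw [Nat.mod_eq_of_lt (by omega : horner (E.n + 2) S' (· + 1) J * (E.n + 2) < E.M),
          Nat.mod_eq_of_lt h9]
        refine ⟨by simpa [hA] using i1, by simp [v4], by simp [v17], by simp [hA, i4],
          by simp [hv27, prev_succ], by simp [v25, ht1, hcnt], fun _ => ?_⟩
        rw [horner, if_pos hne]
        simp
      · rw [if_neg hlt]
        exact ⟨by simpa [hA] using i1, by simp [v4], by simp [v17], by simp [hA, i4],
          by simp [hv27, prev_succ], by simp [v25, ht1, hcnt], fun h => by omega⟩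
    · rw [if_neg hne]
      have ht1 : togCount S' (J + 1) = togCount S' J := by rw [togCount, if_neg hne]
      refine ⟨by simpa [hA] using i1, by simp [v4], by simp [v17], by simp [hA, i4],
        by simp [hv27, prev_succ], by simp [v25, ht1], fun h => ?_⟩
      rw [horner, if_neg hne, ← i7 (by omega)]
      simp [v9]
  exact ⟨hI.2.2.2.2.2.1, hI.2.2.2.2.2.2⟩

/-- The target row lies after the source row, so copying destroys nothing that is still to be read.
-/
theorem copyCmd_spec {E : Env} {b S : ℕ → ℕ} {x : ℕ} (s : St) (h0 : s.A 0 = b) (h4 : s.v 4 = x)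
    (hlt : s.v 17 < s.v 23) (hM : s.v 23 * (E.n + 2) + (E.n + 2) < E.M)
    (h3 : ∀ j < E.n + 2, s.A 3 (s.v 17 * (E.n + 2) + j) = S j) :
    (∀ j < E.n + 2, (copyCmd.den E s).A 3 (s.v 23 * (E.n + 2) + j) = mark b S x j) ∧
    ∀ i, i < s.v 23 * (E.n + 2) ∨ s.v 23 * (E.n + 2) + (E.n + 2) ≤ i →
      (copyCmd.den E s).A 3 i = s.A 3 i := by
  have hrow : s.v 17 * (E.n + 2) + (E.n + 2) ≤ s.v 23 * (E.n + 2) := by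
    calc s.v 17 * (E.n + 2) + (E.n + 2) = (s.v 17 + 1) * (E.n + 2) := by ring
      _ ≤ _ := Nat.mul_le_mul_right _ hlt
  let I : ℕ → St → Prop := fun J s' =>
    s'.A 0 = b ∧ s'.v 4 = x ∧ s'.v 17 = s.v 17 ∧ s'.v 23 = s.v 23 ∧
    (∀ j < J, s'.A 3 (s.v 23 * (E.n + 2) + j) = mark b S x j) ∧
    ∀ i, i < s.v 23 * (E.n + 2) ∨ s.v 23 * (E.n + 2) + (E.n + 2) ≤ i → s'.A 3 i = s.A 3 i
  have hI : I (E.n + 2) (copyCmd.den E s) := by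
    rw [← E.lim_base]
    refine Cmd.loop_inv I ⟨h0, h4, rfl, rfl, fun j hj => absurd hj (by omega), fun _ _ => rfl⟩ ?_
    rintro J hJ s' ⟨i1, i2, i3, i4, i5, i6⟩
    rw [E.lim_base] at hJ
    have e1 : s.v 17 * (E.n + 2) % E.M = s.v 17 * (E.n + 2) := Nat.mod_eq_of_lt (by omega)
    have e2 : (s.v 17 * (E.n + 2) + J) % E.M = s.v 17 * (E.n + 2) + J :=
      Nat.mod_eq_of_lt (by omega)
    have e3 : s.v 23 * (E.n + 2) % E.M = s.v 23 * (E.n + 2) := Nat.mod_eq_of_lt (by omega)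
    have e4 : (s.v 23 * (E.n + 2) + J) % E.M = s.v 23 * (E.n + 2) + J :=
      Nat.mod_eq_of_lt (by omega)
    have e5 : s'.A 3 (s.v 17 * (E.n + 2) + J) = S J := by
      rw [i6 _ (Or.inl (by omega)), h3 J hJ]
    have hA3 : (Cmd.den E (block [.store 3 (vr 23 * .base + vr 3) (rd 3 (vr 17 * .base + vr 3)),
        .whenEq (rd 0 (vr 3)) (vr 4) (.store 3 (vr 23 * .base + vr 3) 1)]) (s'.setV 3 J)).A 3 =
        Function.update (s'.A 3) (s.v 23 * (E.n + 2) + J) (mark b S x J) := by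
      simp only [den_block_cons, den_block_nil, den_store, den_whenEq, ev_arr, ev_var, ev_add,
        ev_mul, ev_base, ev_one, St.setV_v, St.setV_A, St.setA_v, St.setA_A, Nat.reduceEqDiff,
        if_true, if_false, i1, i2, i3, i4, e1, e2, e3, e4, e5, show (0 : Fin 16) ≠ 3 by decide, mark]
      split_ifs with h
      · simp
      · simp
    refine ⟨?_, ?_, ?_, ?_, ?_, ?_⟩
    · rw [Cmd.den_A (by rfl)]; simpa using i1
    · rw [Cmd.den_v (by rfl)]; simpa using i2
    · rw [Cmd.den_v (by rfl)]; simpa using i3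
    · rw [Cmd.den_v (by rfl)]; simpa using i4
    · intro j hj
      rw [hA3, Function.update_apply]
      split_ifs with h
      · rw [show j = J by omega]
      · exact i5 j (by omega)
    · intro i hi
      rw [hA3, Function.update_of_ne (by omega), i6 i hi]
  exact ⟨hI.2.2.2.2.1, hI.2.2.2.2.2⟩

/-- The effect of one pair of a recorded set and an added position. -/
theorem searchBody_spec {E : Env} {k : ℕ} (hn : 1 ≤ E.n) (hm : E.m ≤ E.n)
    (hM : (E.n + 2) ^ (2 * k + 5) < E.M) {b S : ℕ → ℕ} (hb : E.Owner b)
    (hb0 : ∀ y < E.m, b y ≠ 0) (hS : E.Closed b S) {r g : ℕ} (hr : r < E.m)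
    (hg : g < (E.n + 2) ^ (2 * k + 1)) (s : St) (h0 : s.A 0 = b) (h1 : s.v 1 = r) (h2 : s.v 2 = g)
    (hrow : s.A 1 (r * (E.n + 2) ^ (2 * k) + g / (E.n + 2)) ≠ 0 → ∀ j < E.n + 2,
      s.A 3 ((r * (E.n + 2) ^ (2 * k) + g / (E.n + 2)) * (E.n + 2) + j) = S j)
    {S' : ℕ → ℕ} (hS'd : S' = mark b S (b (g % (E.n + 2)))) {dst : ℕ}
    (hdst : dst = (r + 1) * (E.n + 2) ^ (2 * k) + E.setCode S') :
    if g % (E.n + 2) < E.m ∧ s.A 1 (r * (E.n + 2) ^ (2 * k) + g / (E.n + 2)) ≠ 0 ∧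
        togCount S' (E.n + 2) ≤ 2 * k ∧ s.A 1 dst = 0 then
      ((searchBody k).den E s).A 1 = Function.update (s.A 1) dst (b (g % (E.n + 2))) ∧
      ((searchBody k).den E s).A 2 = Function.update (s.A 2) dst (g / (E.n + 2)) ∧
      (∀ j < E.n + 2, ((searchBody k).den E s).A 3 (dst * (E.n + 2) + j) = S' j) ∧
      ∀ i, i < dst * (E.n + 2) ∨ dst * (E.n + 2) + (E.n + 2) ≤ i →
        ((searchBody k).den E s).A 3 i = s.A 3 i
    else ((searchBody k).den E s).A 1 = s.A 1 ∧ ((searchBody k).den E s).A 2 = s.A 2 ∧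
      ((searchBody k).den E s).A 3 = s.A 3 := by
  have hc : g / (E.n + 2) < (E.n + 2) ^ (2 * k) :=
    Nat.div_lt_of_lt_mul (by rwa [pow_succ, mul_comm] at hg)
  have hM5 : (E.n + 2) ^ (2 * k + 5) = (E.n + 2) ^ (2 * k) * (E.n + 2) * (E.n + 2) * (E.n + 2) *
    (E.n + 2) * (E.n + 2) := by simp only [pow_succ]
  have hev : (E.n + 2) ^ (2 * k) < E.M :=
    (Nat.pow_le_pow_right (by omega) (by omega)).trans_lt hM
  set N := E.n + 2 with hN
  have hNp : 0 < N := by omega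
  generalize hTd : N ^ (2 * k) = T at *
  have hT0 : 0 < T := Nat.zero_lt_of_lt hc
  have hle : ∀ a, a ≤ a * N := fun a => Nat.le_mul_of_pos_right _ hNp
  have hTNN : T * N * N < E.M :=
    ((hle _).trans ((hle _).trans (hle _))).trans_lt (hM5 ▸ hM)
  have hrT : r * T + T ≤ N * T := by
    calc r * T + T = (r + 1) * T := by ring
      _ ≤ _ := Nat.mul_le_mul_right _ (by omega)
  have hrT2 : (r + 1) * T + T ≤ N * T := by
    calc (r + 1) * T + T = (r + 2) * T := by ring
      _ ≤ _ := Nat.mul_le_mul_right _ (by omega)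
  have hrow2 : ∀ a < N * T, a * N + N < E.M := by
    intro a ha
    calc a * N + N = (a + 1) * N := by ring
      _ ≤ N * T * N := Nat.mul_le_mul_right _ ha
      _ = T * N * N := by ring
      _ < _ := hTNN
  have hNT : N * T < E.M := by
    rw [mul_comm]
    exact (hle _).trans_lt hTNN
  have hNM : N < E.M := (Nat.le_mul_of_pos_right _ hT0).trans_lt hNT
  have e1 : r * T % E.M = r * T := Nat.mod_eq_of_lt (by omega)
  have e2 : (r * T + g / N) % E.M = r * T + g / N := Nat.mod_eq_of_lt (by omega)
  have e17 : Exp.ev E s (vr 1 * basePow (2 * k) + vr 2 / .base) = r * T + g / N := by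
    simp only [ev_add, ev_mul, ev_div, ev_var, ev_base, h1, h2, ← hN,
      ev_basePow _ _ (hTd.trans_lt hev), hTd, e1, e2]
  have e29 : ∀ y, Exp.ev E (s.setV 17 y) (vr 2 % .base) = g % N := by
    intro y
    simp only [ev_mod, ev_var, ev_base, St.setV_v, Nat.reduceEqDiff, if_false, h2, hN]
  set s₁ := (s.setV 17 (r * T + g / N)).setV 29 (g % N) with hs₁
  have hbody : (searchBody k).den E s = if g % N < E.m then (if 0 < s.A 1 (r * T + g / N) then
      (Cmd.when (vr 25) (.const (2 * k + 1)) (recordCmd k)).den E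
        ((encodeCmd k).den E (s₁.setV 4 (b (g % N)))) else s₁) else s₁ := by
    simp only [searchBody, den_block_cons, den_block_nil, den_assign, e17, e29, ← hs₁]
    rw [den_when]
    have e3 : Exp.ev E s₁ (vr 29) = g % N := by simp [hs₁]
    have e4 : Exp.ev E s₁ (rd 1 (vr 17)) = s.A 1 (r * T + g / N) := by simp [hs₁]
    have e5 : Exp.ev E s₁ (rd 0 (vr 29)) = b (g % N) := by simp [hs₁, h0]
    rw [e3, ev_m, den_when, e4, ev_zero]
    simp only [den_block_cons, den_block_nil, den_assign, e5]
  have hA₁ : s₁.A = s.A := by simp [hs₁]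
  rw [hbody]
  by_cases hy : g % N < E.m
  swap
  · rw [if_neg fun h => hy h.1, if_neg hy, hA₁]
    exact ⟨rfl, rfl, rfl⟩
  by_cases hF : s.A 1 (r * T + g / N) = 0
  · rw [if_neg fun h => h.2.1 hF, if_pos hy, if_neg (by omega), hA₁]
    exact ⟨rfl, rfl, rfl⟩
  rw [if_pos hy, if_pos (Nat.pos_of_ne_zero hF)]
  have hS' : E.Closed b S' := by rw [hS'd]; exact hS.mark hb (hb0 _ hy)
  set s₂ := s₁.setV 4 (b (g % N)) with hs₂
  have hA₂ : s₂.A = s.A := by simp [hs₂, hA₁]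
  have v17 : s₂.v 17 = r * T + g / N := by simp [hs₂, hs₁]
  obtain ⟨c1, c2⟩ := encodeCmd_spec (k := k) (S := S) (b := b) hm hM (by rwa [← hS'd]) s₂
    (by rw [hA₂, h0]) (by simp [hs₂]) (by rw [v17]; exact hrow2 _ (by omega))
    (by rw [v17, hA₂]; exact hrow hF)
  rw [← hS'd] at c1 c2
  set s₃ := (encodeCmd k).den E s₂ with hs₃
  have hA₃ : ∀ r', s₃.A r' = s.A r' := fun r' => by rw [hs₃, Cmd.den_A (by rfl), hA₂]
  rw [den_when, ev_var, ev_const, c1]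
  by_cases ht : togCount S' N ≤ 2 * k
  swap
  · rw [if_neg fun h => ht h.2.2.1, if_neg fun h => ht (Nat.lt_succ_iff.1 h)]
    exact ⟨hA₃ 1, hA₃ 2, hA₃ 3⟩
  rw [if_pos (Nat.lt_succ_of_le ht)]
  have hcode : E.setCode S' < T := by rw [← hTd]; exact hS'.setCode_lt hm ht
  have w1 : s₃.v 1 = r := by
    rw [hs₃, Cmd.den_v (by rfl)]
    simp [hs₂, hs₁, h1]
  have w2 : s₃.v 2 = g := by
    rw [hs₃, Cmd.den_v (by rfl)]
    simp [hs₂, hs₁, h2]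
  have w4 : s₃.v 4 = b (g % N) := by
    rw [hs₃, Cmd.den_v (by rfl)]
    simp [hs₂]
  have w17 : s₃.v 17 = r * T + g / N := by
    rw [hs₃, Cmd.den_v (by rfl)]
    exact v17
  have e23 : Exp.ev E s₃ ((vr 1 + 1) * basePow (2 * k) + vr 9) = dst := by
    simp only [ev_add, ev_mul, ev_one, ev_var, w1, c2 ht, ev_basePow _ _ (hTd.trans_lt hev), ← hN,
      hTd]
    rw [Nat.mod_eq_of_lt (by omega : r + 1 < E.M), Nat.mod_eq_of_lt (by omega : (r + 1) * T < E.M),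
      Nat.mod_eq_of_lt (by omega), hdst]
  simp only [recordCmd, den_block_cons, den_block_nil, den_assign, e23, den_when, ev_arr, ev_var,
    St.setV_v, St.setV_A, if_true, hA₃, ev_one]
  by_cases hd : s.A 1 dst = 0
  swap
  · rw [if_neg fun h => hd h.2.2.2, if_neg (by omega)]
    simp [hA₃]
  rw [if_pos ⟨hy, hF, ht, hd⟩, if_pos (by omega)]
  simp only [den_store, ev_var, ev_div, ev_base, St.setV_v, St.setA_v, if_true, Nat.reduceEqDiff,
    if_false, w4, w2, ← hN]
  set s₄ := ((s₃.setV 23 dst).setA 1 dst (b (g % N))).setA 2 dst (g / N) with hs₄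
  have x17 : s₄.v 17 = r * T + g / N := by simp [hs₄, w17]
  have x23 : s₄.v 23 = dst := by simp [hs₄]
  have hdlt : dst < N * T := by omega
  have hadd : (r + 1) * T = r * T + T := by ring
  obtain ⟨y1, y2⟩ := copyCmd_spec (E := E) (S := S) (b := b) (x := b (g % N)) s₄
    (by simp [hs₄, hA₃, h0]) (by simp [hs₄, w4]) (by rw [x17, x23]; omega)
    (by rw [x23]; exact hrow2 _ hdlt) (by
      intro j hj
      rw [x17]
      simpa [hs₄, hA₃] using hrow hF j hj)
  rw [x23, ← hS'd] at y1
  rw [x23] at y2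
  refine ⟨?_, ?_, y1, fun i hi => ?_⟩
  · rw [Cmd.den_A (by rfl)]
    simp [hs₄, hA₃]
  · rw [Cmd.den_A (by rfl)]
    simp [hs₄, hA₃]
  · rw [y2 i hi]
    simp [hs₄, hA₃]

end PatternMatching

/-! ### Correctness of the search for a marking order -/

namespace PatternMatching

section Search

variable {E : Env} {k : ℕ} {b : ℕ → ℕ}

/-- The tables `F` and `p` record the order `ord` of length `l`. -/
structure Env.Chain (E : Env) (k : ℕ) (b F p : ℕ → ℕ) (l : ℕ) (ord : ℕ → ℕ) : Prop where
  mem : ∀ i < l, ∃ y < E.m, ord i = b y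
  tog : ∀ i ≤ l, togCount (cover b ord i) (E.n + 2) ≤ 2 * k
  last : ∀ i < l, F ((i + 1) * (E.n + 2) ^ (2 * k) + E.setCode (cover b ord (i + 1))) = ord i
  parent : ∀ i < l, p ((i + 1) * (E.n + 2) ^ (2 * k) + E.setCode (cover b ord (i + 1))) =
    E.setCode (cover b ord i)

theorem Env.Chain.closed {F p : ℕ → ℕ} {l : ℕ} {ord : ℕ → ℕ} (h : E.Chain k b F p l ord)
    (hb : E.Owner b) (hb0 : ∀ y < E.m, b y ≠ 0) {i : ℕ} (hi : i ≤ l) :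
    E.Closed b (cover b ord i) :=
  cover_closed hb fun i' hi' => by
    obtain ⟨y, hy, h⟩ := h.mem i' (by omega)
    rw [h]
    exact hb0 y hy

/-- The entries of a chain are nonzero, so a write to an empty entry meets none of them. -/
theorem Env.Chain.update {F p : ℕ → ℕ} {l : ℕ} {ord : ℕ → ℕ} (h : E.Chain k b F p l ord)
    (hb0 : ∀ y < E.m, b y ≠ 0) {d : ℕ} (hd : F d = 0) (v w : ℕ) :
    E.Chain k b (Function.update F d v) (Function.update p d w) l ord := by
  have hne : ∀ i < l, (i + 1) * (E.n + 2) ^ (2 * k) + E.setCode (cover b ord (i + 1)) ≠ d := by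
    rintro i hi rfl
    obtain ⟨y, hy, h1⟩ := h.mem i hi
    rw [h.last i hi, h1] at hd
    exact hb0 y hy hd
  exact ⟨h.mem, h.tog, fun i hi => by rw [Function.update_of_ne (hne i hi), h.last i hi],
    fun i hi => by rw [Function.update_of_ne (hne i hi), h.parent i hi]⟩

/-- An entry is evidence that some order of length `l` leads to the set; orders that lead to the
same set share one entry. -/
def Env.Recorded (E : Env) (k : ℕ) (b : ℕ → ℕ) (s : St) : Prop :=
  ∀ l, ∀ c < (E.n + 2) ^ (2 * k), s.A 1 (l * (E.n + 2) ^ (2 * k) + c) ≠ 0 →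
    ∃ ord, E.Chain k b (s.A 1) (s.A 2) l ord ∧ E.setCode (cover b ord l) = c ∧
      ∀ j < E.n + 2, s.A 3 ((l * (E.n + 2) ^ (2 * k) + c) * (E.n + 2) + j) = cover b ord l j

theorem eq_of_mul_add_eq {T l l' c c' : ℕ} (hc : c < T) (hc' : c' < T)
    (h : l * T + c = l' * T + c') : l = l' ∧ c = c' := by
  have h1 := congrArg (· / T) h
  have h2 := congrArg (· % T) h
  simp only [Nat.mul_add_mod', Nat.mod_eq_of_lt hc, Nat.mod_eq_of_lt hc'] at h2
  simp only [mul_comm _ T, Nat.mul_add_div (show 0 < T by omega), Nat.div_eq_of_lt hc,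
    Nat.div_eq_of_lt hc'] at h1
  omega

/-- The invariant of the loop over the pairs of a set and a position. -/
structure SearchInv (E : Env) (k : ℕ) (b F : ℕ → ℕ) (r g : ℕ) (s : St) : Prop where
  owner : s.A 0 = b
  stage : s.v 1 = r
  recorded : E.Recorded k b s
  mono : ∀ i, F i ≠ 0 → s.A 1 i ≠ 0
  done : ∀ S, E.Closed b S → togCount S (E.n + 2) ≤ 2 * k →
    F (r * (E.n + 2) ^ (2 * k) + E.setCode S) ≠ 0 → ∀ y < E.m, E.setCode S * (E.n + 2) + y < g →
    togCount (mark b S (b y)) (E.n + 2) ≤ 2 * k →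
    s.A 1 ((r + 1) * (E.n + 2) ^ (2 * k) + E.setCode (mark b S (b y))) ≠ 0

/-- A new entry extends the order of its predecessor by one owner, and older chains survive by
`Env.Chain.update`. For `done`, `Env.Closed.setCode_inj` identifies the set stored under the current
code with the set in question. -/
theorem SearchInv.step (hn : 1 ≤ E.n) (hm : E.m ≤ E.n)
    (hM : (E.n + 2) ^ (2 * k + 5) < E.M) (hb : E.Owner b) (hb0 : ∀ y < E.m, b y ≠ 0) {F : ℕ → ℕ}
    {r g : ℕ} (hr : r < E.m) (hg : g < (E.n + 2) ^ (2 * k + 1)) {s : St}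
    (H : SearchInv E k b F r g s) :
    SearchInv E k b F r (g + 1) ((searchBody k).den E (s.setV 2 g)) := by
  have hc : g / (E.n + 2) < (E.n + 2) ^ (2 * k) :=
    Nat.div_lt_of_lt_mul (by rwa [pow_succ, mul_comm] at hg)
  obtain ⟨S, hS, hrow⟩ : ∃ S, E.Closed b S ∧
      (s.A 1 (r * (E.n + 2) ^ (2 * k) + g / (E.n + 2)) ≠ 0 → ∃ ord,
        E.Chain k b (s.A 1) (s.A 2) r ord ∧ S = cover b ord r ∧ E.setCode S = g / (E.n + 2) ∧
        ∀ j < E.n + 2,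
          s.A 3 ((r * (E.n + 2) ^ (2 * k) + g / (E.n + 2)) * (E.n + 2) + j) = S j) := by
    by_cases h : s.A 1 (r * (E.n + 2) ^ (2 * k) + g / (E.n + 2)) = 0
    · exact ⟨fun _ => 0, ⟨fun _ => Nat.zero_le _, fun _ _ _ => rfl, fun _ _ => rfl⟩,
        fun h' => absurd h h'⟩
    · obtain ⟨ord, h1, h2, h3⟩ := H.recorded r _ hc h
      exact ⟨cover b ord r, h1.closed hb hb0 le_rfl, fun _ => ⟨ord, h1, rfl, h2, h3⟩⟩
  have hspec := searchBody_spec hn hm hM hb hb0 hS hr hg (s.setV 2 g) (by simpa using H.owner)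
    (by simpa using H.stage) (by simp) (fun h j hj => by
      obtain ⟨ord, -, -, -, h4⟩ := hrow (by simpa using h)
      simpa using h4 j hj) rfl rfl
  have f0 : ((searchBody k).den E (s.setV 2 g)).A 0 = b := by
    rw [Cmd.den_A (by rfl)]
    simpa using H.owner
  have f1 : ((searchBody k).den E (s.setV 2 g)).v 1 = r := by
    rw [Cmd.den_v (by rfl)]
    simpa using H.stage
  simp only [St.setV_A] at hspec
  have hpair : ∀ S₁ y, E.Closed b S₁ → F (r * (E.n + 2) ^ (2 * k) + E.setCode S₁) ≠ 0 → y < E.m →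
      E.setCode S₁ * (E.n + 2) + y = g → S₁ = S ∧ y = g % (E.n + 2) ∧
      s.A 1 (r * (E.n + 2) ^ (2 * k) + g / (E.n + 2)) ≠ 0 := by
    intro S₁ y h1 h2 h3 h4
    have h5 : g / (E.n + 2) = E.setCode S₁ := by
      rw [← h4, mul_comm, Nat.mul_add_div (by omega), Nat.div_eq_of_lt (by omega), add_zero]
    have h6 : g % (E.n + 2) = y := by
      rw [← h4, Nat.mul_add_mod', Nat.mod_eq_of_lt (by omega)]
    have h7 := H.mono _ h2
    rw [← h5] at h7
    obtain ⟨ord, -, -, h8, -⟩ := hrow h7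
    exact ⟨h1.setCode_inj hm hS (by rw [h8, h5]), h6.symm, h7⟩
  split_ifs at hspec with hcond
  · obtain ⟨hy, hF, ht, hd⟩ := hcond
    obtain ⟨q1, q2, q3, q4⟩ := hspec
    obtain ⟨ord, hch, hSo, hSc, -⟩ := hrow hF
    have hS' := hS.mark hb (hb0 _ hy)
    have hmono : ∀ i, s.A 1 i ≠ 0 → ((searchBody k).den E (s.setV 2 g)).A 1 i ≠ 0 := by
      intro i hi
      rw [q1, Function.update_apply]
      split_ifs
      · exact hb0 _ hy
      · exact hi
    refine ⟨f0, f1, ?_, fun i hi => hmono i (H.mono i hi), ?_⟩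
    · intro l c hcT hne
      rw [q1, q2]
      by_cases hl : l * (E.n + 2) ^ (2 * k) + c = (r + 1) * (E.n + 2) ^ (2 * k) +
          E.setCode (mark b S (b (g % (E.n + 2))))
      · obtain ⟨rfl, rfl⟩ := eq_of_mul_add_eq hcT (hS'.setCode_lt hm ht) hl
        have hcov : ∀ i ≤ r, cover b (Function.update ord r (b (g % (E.n + 2)))) i =
            cover b ord i := fun i hi =>
          cover_congr_ord fun i' hi' => Function.update_of_ne (by omega) _ _
        have hcov' : cover b (Function.update ord r (b (g % (E.n + 2)))) (r + 1) =
            mark b S (b (g % (E.n + 2))) := by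
          change mark b (cover b _ r) (Function.update ord r _ r) = _
          rw [hcov r le_rfl, Function.update_self, ← hSo]
        have hch' := hch.update hb0 hd (b (g % (E.n + 2))) (g / (E.n + 2))
        refine ⟨Function.update ord r (b (g % (E.n + 2))), ⟨?_, ?_, ?_, ?_⟩, by rw [hcov'], ?_⟩
        · intro i hi
          by_cases hir : i = r
          · exact ⟨_, hy, by rw [hir, Function.update_self]⟩
          · rw [Function.update_of_ne hir]
            exact hch.mem i (by omega)
        · intro i hi
          by_cases hir : i = r + 1
          · rw [hir, hcov']
            exact ht
          · rw [hcov i (by omega)]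
            exact hch.tog i (by omega)
        · intro i hi
          by_cases hir : i = r
          · rw [hir, hcov', Function.update_self, Function.update_self]
          · rw [hcov (i + 1) (by omega), Function.update_of_ne hir]
            exact hch'.last i (by omega)
        · intro i hi
          by_cases hir : i = r
          · rw [hir, hcov', Function.update_self, hcov r le_rfl, ← hSo, hSc]
          · rw [hcov (i + 1) (by omega), hcov i (by omega)]
            exact hch'.parent i (by omega)
        · rw [hcov']
          exact q3
      · rw [q1, Function.update_of_ne hl] at hne
        obtain ⟨ord', h1, h2, h3⟩ := H.recorded l c hcT hne
        refine ⟨ord', h1.update hb0 hd _ _, h2, fun j hj => ?_⟩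
        rw [q4, h3 j hj]
        rcases Nat.lt_or_gt_of_ne hl with h4 | h4
        · left
          have := Nat.mul_le_mul_right (E.n + 2) h4
          rw [Nat.succ_mul] at this
          omega
        · right
          have := Nat.mul_le_mul_right (E.n + 2) h4
          rw [Nat.succ_mul] at this
          omega
    · intro S₁ h1 h2 h3 y hy' h4 h5
      by_cases h6 : E.setCode S₁ * (E.n + 2) + y < g
      · exact hmono _ (H.done S₁ h1 h2 h3 y hy' h6 h5)
      · obtain ⟨rfl, rfl, -⟩ := hpair S₁ y h1 h3 hy' (by omega)
        rw [q1, Function.update_self]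
        exact hb0 _ hy
  · obtain ⟨q1, q2, q3⟩ := hspec
    refine ⟨f0, f1, ?_, ?_, ?_⟩
    · simp only [Env.Recorded, q1, q2, q3]
      exact H.recorded
    · rw [q1]
      exact H.mono
    · intro S₁ h1 h2 h3 y hy' h4 h5
      rw [q1]
      by_cases h6 : E.setCode S₁ * (E.n + 2) + y < g
      · exact H.done S₁ h1 h2 h3 y hy' h6 h5
      · obtain ⟨rfl, rfl, h7⟩ := hpair S₁ y h1 h3 hy' (by omega)
        exact fun h8 => hcond ⟨hy', h7, h5, h8⟩

/-- All orders of length `r` with few blocks have been found. -/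
structure ReachInv (E : Env) (k : ℕ) (b : ℕ → ℕ) (r : ℕ) (s : St) : Prop where
  owner : s.A 0 = b
  recorded : E.Recorded k b s
  reach : ∀ ord, (∀ i, ∃ y < E.m, ord i = b y) →
    (∀ i, togCount (cover b ord i) (E.n + 2) ≤ 2 * k) →
    s.A 1 (r * (E.n + 2) ^ (2 * k) + E.setCode (cover b ord r)) ≠ 0

/-- Remembering sets instead of orders suffices, as whether a further mark is allowed depends only
on the set covered so far. The pair of that set and the position `y` has a number below `(n + 2) ^
(2 * k + 1)`, so the inner loop reaches it. -/
theorem ReachInv.step (hn : 1 ≤ E.n) (hm : E.m ≤ E.n)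
    (hM : (E.n + 2) ^ (2 * k + 5) < E.M) (hb : E.Owner b) (hb0 : ∀ y < E.m, b y ≠ 0)
    {r : ℕ} (hr : r < E.m) {s : St} (H : ReachInv E k b r s) :
    ReachInv E k b (r + 1) ((Cmd.loop 2 (2 * k + 1) 0 (searchBody k)).den E (s.setV 1 r)) := by
  have hK := Cmd.loop_inv (E := E) (x := 2) (a := 2 * k + 1) (b := 0) (c := searchBody k)
    (s := s.setV 1 r) (SearchInv E k b (s.A 1) r)
    ⟨by simpa using H.owner, by simp, by simpa [Env.Recorded] using H.recorded, fun i hi => by simpa,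
      fun _ _ _ _ _ _ h => absurd h (by omega)⟩
    (fun g hg s' H' => H'.step hn hm hM hb hb0 hr (by rwa [E.lim_pow] at hg))
  rw [E.lim_pow] at hK
  refine ⟨hK.owner, hK.recorded, fun ord h1 h2 => ?_⟩
  obtain ⟨y, hy, h3⟩ := h1 r
  have hcl : E.Closed b (cover b ord r) := cover_closed hb fun i _ => by
    obtain ⟨y, hy, h⟩ := h1 i
    rw [h]
    exact hb0 y hy
  have h4 := hcl.setCode_lt hm (h2 r)
  have h5 := hK.done _ hcl (h2 r) (H.reach ord h1 h2) y hy (by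
    rw [pow_succ]
    calc _ < (E.setCode (cover b ord r) + 1) * (E.n + 2) := by rw [add_mul]; omega
      _ ≤ _ := Nat.mul_le_mul_right _ h4) (by rw [← h3]; exact h2 (r + 1))
  rw [← h3] at h5
  exact h5

theorem backCmd_spec (hm : E.m ≤ E.n) (hm1 : 1 ≤ E.m) (hM : (E.n + 2) ^ (2 * k + 5) < E.M)
    (s : St) {ord : ℕ → ℕ} (hb : E.Owner b) (hb0 : ∀ y < E.m, b y ≠ 0)
    (hc : E.Chain k b (s.A 1) (s.A 2) E.m ord)
    (hcode : E.setCode (cover b ord E.m) = E.n + 2 + (E.m + 1)) :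
    ∀ i < E.m, ((backCmd k).den E s).A 4 i = ord i := by
  have hev : (E.n + 2) ^ (2 * k) < E.M :=
    (Nat.pow_le_pow_right (by omega) (by omega)).trans_lt hM
  have hTM : (E.m + 1) * (E.n + 2) ^ (2 * k) < E.M := by
    calc _ ≤ (E.n + 2) * (E.n + 2) ^ (2 * k) := Nat.mul_le_mul_right _ (by omega)
      _ = (E.n + 2) ^ (2 * k + 1) := by rw [pow_succ, mul_comm]
      _ ≤ (E.n + 2) ^ (2 * k + 5) := Nat.pow_le_pow_right (by omega) (by omega)
      _ < _ := hM
  have hNM : 3 * (E.n + 2) < E.M := by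
    have : (E.n + 2) ^ 2 ≤ (E.n + 2) ^ (2 * k + 5) := Nat.pow_le_pow_right (by omega) (by omega)
    nlinarith
  let I : ℕ → St → Prop := fun r s' =>
    s'.A 1 = s.A 1 ∧ s'.A 2 = s.A 2 ∧ s'.v 28 = E.setCode (cover b ord (E.m - r)) ∧
    ∀ i < E.m, E.m - r ≤ i → s'.A 4 i = ord i
  have hI : I E.m ((backCmd k).den E s) := by
    simp only [backCmd, den_block_cons, den_block_nil, den_assign]
    rw [← E.lim_m]
    refine Cmd.loop_inv I ⟨by simp, by simp, ?_, fun i hi h => absurd h (by omega)⟩ ?_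
    · simp only [ev_add, ev_base, ev_m, ev_one, St.setV_v, if_true, tsub_zero, hcode]
      rw [Nat.mod_eq_of_lt (by omega : E.m + 1 < E.M), Nat.mod_eq_of_lt (by omega)]
    · rintro r hr s' ⟨i1, i2, i3, i4⟩
      rw [E.lim_m] at hr
      obtain ⟨l, hl⟩ : ∃ l, E.m - r = l + 1 := ⟨E.m - r - 1, by omega⟩
      have hl' : E.m - (r + 1) = l := by omega
      have hlm : l < E.m := by omega
      have hcT : E.setCode (cover b ord (l + 1)) < (E.n + 2) ^ (2 * k) :=
        (hc.closed hb hb0 (by omega)).setCode_lt hm (hc.tog _ (by omega))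
      have hidx : (l + 1) * (E.n + 2) ^ (2 * k) + E.setCode (cover b ord (l + 1)) < E.M := by
        calc _ < (l + 1) * (E.n + 2) ^ (2 * k) + (E.n + 2) ^ (2 * k) := by omega
          _ = (l + 1 + 1) * (E.n + 2) ^ (2 * k) := by ring
          _ ≤ (E.m + 1) * (E.n + 2) ^ (2 * k) := Nat.mul_le_mul_right _ (by omega)
          _ < _ := hTM
      simp only [I, den_block_cons, den_block_nil, den_assign, den_store, ev_sub, ev_add, ev_mul,
        ev_arr, ev_var, ev_m, ev_one, ev_basePow _ _ hev, St.setV_v, St.setV_A, St.setA_v,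
        St.setA_A, Nat.reduceEqDiff, if_true, if_false, i1, i2, i3, hl, hl',
        Nat.mod_eq_of_lt (show (l + 1) * (E.n + 2) ^ (2 * k) < E.M by omega),
        Nat.mod_eq_of_lt hidx, hc.last l hlm, hc.parent l hlm, Nat.add_sub_cancel,
        show (1 : Fin 16) ≠ 4 by decide, show (2 : Fin 16) ≠ 4 by decide]
      refine ⟨trivial, trivial, trivial, fun i hi hli => ?_⟩
      rw [Function.update_apply]
      split_ifs with h
      · rw [h]
      · exact i4 i hi (by omega)
  exact fun i hi => hI.2.2.2 i hi (by omega)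

/-- The order found may differ from the one in `hex`. It has few changes at every stage, and it
covers everything because the set it ends with has the code of the full set. -/
theorem searchCmd_spec (hE : E.Ok) (hM : (E.n + 2) ^ (2 * k + 5) < E.M)
    (hb : E.Owner b) (hb0 : ∀ y < E.m, b y ≠ 0)
    (hex : ∃ ord, (∀ i, ∃ y < E.m, ord i = b y) ∧
      (∀ i, togCount (cover b ord i) (E.n + 2) ≤ 2 * k) ∧ ∀ j < E.m, cover b ord E.m j = 1)
    (s : St) (h0 : s.A 0 = b) (h1 : ∀ i, s.A 1 i = 0) (h3 : ∀ i, s.A 3 i = 0) {ord : ℕ → ℕ}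
    (hord : ord = ((searchCmd k).den E s).A 4) :
    (∀ i < E.m, ord i ≠ 0) ∧ (∀ i ≤ E.m, togCount (cover b ord i) (E.n + 2) ≤ 2 * k) ∧
      ∀ j < E.m, cover b ord E.m j = 1 := by
  have hn := hE.pos
  have hm := hE.m
  have hm1 := hE.m_pos
  set s₁ := (Cmd.loop 1 0 1 (.loop 2 (2 * k + 1) 0 (searchBody k))).den E (s.setA 1 0 1) with hs₁
  have hI : ReachInv E k b E.m s₁ := by
    rw [hs₁, ← E.lim_m]
    refine Cmd.loop_inv (ReachInv E k b) ⟨by simpa using h0, ?_, ?_⟩ fun r hr s' H =>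
      H.step hn hm hM hb hb0 (by rwa [E.lim_m] at hr)
    · intro l c hc hne
      have hz : l * (E.n + 2) ^ (2 * k) + c = 0 := by
        by_contra h
        rw [St.setA_A, if_pos rfl, Function.update_of_ne h] at hne
        exact hne (h1 _)
      obtain ⟨hl, rfl⟩ := Nat.add_eq_zero_iff.1 hz
      obtain rfl : l = 0 := by
        rcases Nat.mul_eq_zero.1 hl with h | h
        · exact h
        · omega
      refine ⟨fun _ => 0, ⟨fun _ h => absurd h (by omega), fun i hi => ?_,
        fun _ h => absurd h (by omega), fun _ h => absurd h (by omega)⟩,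
        horner_const (fun j => rfl) _, fun j _ => ?_⟩
      · obtain rfl : i = 0 := by omega
        obtain ⟨ord, -, h, -⟩ := hex
        exact h 0
      · rw [St.setA_A, if_neg (by decide), h3]
        rfl
    · intro ord _ _
      have : E.setCode (cover b ord 0) = 0 := horner_const (fun j => rfl) _
      simp [this]
  obtain ⟨ord₀, g1, g2, g3⟩ := hex
  have hcl₀ : E.Closed b (cover b ord₀ E.m) := cover_closed hb fun i _ => by
    obtain ⟨y, hy, h⟩ := g1 i
    rw [h]
    exact hb0 y hy
  have hcode : E.setCode (cover b ord₀ E.m) = E.n + 2 + (E.m + 1) := by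
    rw [Env.setCode, horner_initial hm1 g3 hcl₀.out (by omega)]
    ring
  obtain ⟨ord', hch, hc', -⟩ := hI.recorded E.m _ (hcl₀.setCode_lt hm (g2 E.m)) (hI.reach ord₀ g1 g2)
  have hcov := (hch.closed hb hb0 le_rfl).setCode_inj hm hcl₀ hc'
  have hback : ∀ i < E.m, ord i = ord' i := by
    rw [hord]
    exact backCmd_spec hm hm1 hM s₁ hb hb0 hch (hc'.trans hcode)
  have hcc : ∀ i ≤ E.m, cover b ord i = cover b ord' i := fun i hi =>
    cover_congr_ord fun i' hi' => hback i' (by omega)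
  refine ⟨fun i hi => ?_, fun i hi => ?_, fun j hj => ?_⟩
  · obtain ⟨y, hy, h⟩ := hch.mem i hi
    rw [hback i hi, h]
    exact hb0 y hy
  · rw [hcc i hi]
    exact hch.tog i hi
  · rw [hcc _ le_rfl, hcov]
    exact g3 j hj

end Search

end PatternMatching

namespace PatternMatching

/-! ## The owners of the pattern positions -/

/-- The first pass finds the first variable, the second spreads each variable over the terminals
after it. The value `1` stands for "none yet", as codes of variables exceed `n ≥ 1`. -/
def ownerCmd : Cmd :=
  block [.assign 4 1,
    .loop 3 0 1 (.when (vr 4) 2 (.when .n (ip (.n + vr 3)) (.assign 4 (ip (.n + vr 3))))),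
    .loop 3 0 1 (block [.when .n (ip (.n + vr 3)) (.assign 4 (ip (.n + vr 3))),
      .store 0 (vr 3) (vr 4)])]

theorem Env.Ok.ev_pat {E : Env} (hE : E.Ok) (hM : 2 * E.n < E.M) {j : ℕ} (hj : j < E.m) {s : St}
    (h3 : s.v 3 = j) : Exp.ev E s (ip (.n + vr 3)) = E.pat j := by
  have hm := hE.m
  simp only [ev_inp, ev_add, ev_n, ev_var, h3, Env.pat]
  rw [Nat.mod_eq_of_lt (by omega : E.n + j < E.M), Nat.mod_eq_of_lt (by omega)]

theorem ownerCmd_spec {E : Env} (hE : E.Ok) (hM : 2 * E.n < E.M) (s : St)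
    (h0 : ∀ i, s.A 0 i = 0) : (ownerCmd.den E s).A 0 = E.owner := by
  have hm := hE.m
  simp only [ownerCmd, den_block_cons, den_block_nil, den_assign, ev_one]
  set s₁ := (Cmd.loop 3 0 1 (.when (vr 4) 2 (.when .n (ip (.n + vr 3))
    (.assign 4 (ip (.n + vr 3)))))).den E (s.setV 4 1) with hs₁
  have h1 : s₁.v 4 = E.firstVar E.m := by
    rw [hs₁, ← E.lim_m]
    refine Cmd.loop_inv (fun J s' => s'.v 4 = E.firstVar J) (by simp [Env.firstVar]) ?_
    intro J hJ s' ih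
    rw [E.lim_m] at hJ
    have hp := hE.ev_pat hM hJ (s := s'.setV 3 J) (by simp)
    simp only [den_when, den_assign, hp, ev_var, ev_two, ev_n, St.setV_v, Nat.reduceEqDiff,
      if_false, ih, Env.firstVar]
    split_ifs <;> simp [ih]
  have h2 : ∀ i, s₁.A 0 i = 0 := fun i => by
    rw [hs₁, Cmd.den_A (by rfl), St.setV_A, h0]
  have hI := Cmd.loop_inv (E := E) (x := 3) (a := 0) (b := 1)
    (c := block [.when .n (ip (.n + vr 3)) (.assign 4 (ip (.n + vr 3))), .store 0 (vr 3) (vr 4)])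
    (s := s₁) (fun J s' => s'.v 4 = E.lastVar J ∧
      ∀ j, s'.A 0 j = if j < J then E.lastVar (j + 1) else 0) ⟨h1, fun j => by simp [h2]⟩ (by
    rintro J hJ s' ⟨i1, i2⟩
    rw [E.lim_m] at hJ
    have hp := hE.ev_pat hM hJ (s := s'.setV 3 J) (by simp)
    have hst : Cmd.den E (.when .n (ip (.n + vr 3)) (.assign 4 (ip (.n + vr 3)))) (s'.setV 3 J) =
        if E.n < E.pat J then (s'.setV 3 J).setV 4 (E.pat J) else s'.setV 3 J := by
      simp only [den_when, den_assign, hp, ev_n]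
    have hv4 : (if E.n < E.pat J then (s'.setV 3 J).setV 4 (E.pat J) else s'.setV 3 J).v 4 =
        E.lastVar (J + 1) := by
      rw [Env.lastVar]
      split_ifs <;> simp [i1]
    have hv3 : (if E.n < E.pat J then (s'.setV 3 J).setV 4 (E.pat J) else s'.setV 3 J).v 3 = J := by
      split_ifs <;> simp
    have hA : (if E.n < E.pat J then (s'.setV 3 J).setV 4 (E.pat J) else s'.setV 3 J).A = s'.A := by
      split_ifs <;> simp
    simp only [den_block_cons, den_block_nil, hst, den_store, ev_var, hv3, hv4, St.setA_v, St.setA_A,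
      if_true, hA, true_and]
    intro j
    rw [Function.update_apply, i2]
    by_cases hj : j = J
    · subst hj
      simp
    · rw [if_neg hj]
      simp only [show j < J + 1 ↔ j < J by omega])
  rw [E.lim_m] at hI
  funext j
  rw [hI.2 j]
  rfl

/-! ## The table entry that holds the answer -/

/-- The number `d` is one more than the least cost of a placement, or `0` if there is none. -/
structure Env.Answer (E : Env) (d : ℕ) : Prop where
  least : ∀ L h P, E.Full L P → d ≠ 0 ∧ d ≤ E.total L h P + 1
  attained : d ≠ 0 → ∃ L h P, E.Full L P ∧ E.total L h P + 1 = d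

/-- The answer stands in row `m` at the code `n` of a complete placement. -/
def solveCmd (k : ℕ) : Cmd :=
  block [ownerCmd, searchCmd k, dpCmd k, .assign 22 (rd 6 (.m * basePow (2 * k) + .n))]

theorem Input.inp_le (I : Input) (c : ℕ) : ∀ i < (I.env c).n, (I.env c).inp i ≤ (I.env c).n := by
  intro i hi
  have hi : i < I.n := hi
  rw [I.inp_word c hi]
  have := (I.word[i]'(by rw [I.word_length]; exact hi)).isLt
  have := I.alphabet_le
  change _ ≤ I.n
  omega

theorem solveCmd_spec (I : Input) {k c : ℕ} (hk : 1 ≤ k) (hc : 2 * k + 6 ≤ c)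
    (h : I.pattern.IsLocal k) (Δ : ℕ) :
    (I.env c).Answer (((solveCmd k).den (I.env c) (startSt Δ)).v 22) := by
  have hE := I.env_ok (c := c) (by omega)
  have hM : ((I.env c).n + 2) ^ (2 * k + 5) < (I.env c).M :=
    Nat.pow_lt_pow_right (by change 1 < I.n + 2; omega) (by omega)
  have hex := I.exists_order c hk h
  have hw := I.inp_le c
  set E := I.env c with hEd
  have hm := hE.m
  have hn := hE.pos
  have hMn : 2 * E.n < E.M := by
    have : (E.n + 2) ^ 2 ≤ (E.n + 2) ^ (2 * k + 5) := Nat.pow_le_pow_right (by omega) (by omega)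
    nlinarith
  have hT : (E.n + 2) ^ (2 * k) < E.M :=
    (Nat.pow_le_pow_right (by omega) (by omega)).trans_lt hM
  have hidx : E.m * (E.n + 2) ^ (2 * k) + E.n < E.M := by
    have h1 : E.n < (E.n + 2) ^ (2 * k) := by
      calc E.n < (E.n + 2) ^ 1 := by rw [pow_one]; omega
        _ ≤ _ := Nat.pow_le_pow_right (by omega) (by omega)
    calc E.m * (E.n + 2) ^ (2 * k) + E.n < (E.m + 1) * (E.n + 2) ^ (2 * k) := by
          rw [add_mul]
          omega
      _ ≤ (E.n + 2) * (E.n + 2) ^ (2 * k) := Nat.mul_le_mul_right _ (by omega)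
      _ = (E.n + 2) ^ (2 * k + 1) := by rw [pow_succ, mul_comm]
      _ ≤ (E.n + 2) ^ (2 * k + 5) := Nat.pow_le_pow_right (by omega) (by omega)
      _ < _ := hM
  have hA : ∀ r i, (startSt Δ).A r i = 0 := fun _ _ => rfl
  simp only [solveCmd, den_block_cons, den_block_nil, den_assign, St.setV_v, if_true]
  set s₁ := ownerCmd.den E (startSt Δ) with hs₁
  have a1 : ∀ r, r ≠ 0 → ∀ i, s₁.A r i = 0 := fun r hr i => by
    rw [hs₁, Cmd.den_A (by simpa [ownerCmd, block, Cmd.wa, Cmd.when] using hr.symm), hA]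
  have hown : s₁.A 0 = E.owner := ownerCmd_spec hE hMn _ (hA 0)
  have hb := E.owner_isOwner hm
  have hsearch := searchCmd_spec hE hM hb (fun y hy => E.owner_ne_zero hy) hex s₁ hown
    (a1 1 (by decide)) (a1 3 (by decide)) rfl
  set s₂ := (searchCmd k).den E s₁ with hs₂
  have b0 : s₂.A 0 = E.owner := by rw [hs₂, Cmd.den_A (by rfl), hown]
  have b5 : ∀ i, s₂.A 5 i = 0 := by rw [hs₂, Cmd.den_A (by rfl)]; exact a1 5 (by decide)
  have b6 : ∀ i, s₂.A 6 i = 0 := by rw [hs₂, Cmd.den_A (by rfl)]; exact a1 6 (by decide)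
  have b8 : ∀ i, s₂.A 8 i = 0 := by rw [hs₂, Cmd.den_A (by rfl)]; exact a1 8 (by decide)
  have b9 : ∀ i, s₂.A 9 i = 0 := by rw [hs₂, Cmd.den_A (by rfl)]; exact a1 9 (by decide)
  have hev : ∀ s, Exp.ev E s (rd 6 (.m * basePow (2 * k) + .n)) =
      s.A 6 (E.m * (E.n + 2) ^ (2 * k) + E.n) := by
    intro s
    simp only [ev_arr, ev_add, ev_mul, ev_m, ev_n, ev_basePow _ _ hT]
    rw [Nat.mod_eq_of_lt (by omega : E.m * (E.n + 2) ^ (2 * k) < E.M), Nat.mod_eq_of_lt hidx]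
  obtain ⟨h1, h2⟩ := dpCmd_spec hE hk hw hM hb hsearch.1 hsearch.2.1 hsearch.2.2 s₂ b0 rfl b5 b6
    b8 b9 (hev _)
  exact ⟨h1, h2⟩

/-! ## Patterns without variables -/

def solveZeroCmd : Cmd :=
  block [.assign 22 0, .whenEq .n .m (block [.assign 22 1,
    .loop 3 0 1 (.whenNe (ip (vr 3)) (ip (.n + vr 3)) (.assign 22 (vr 22 + 1)))])]

/-- After the last mark, a nonempty skeleton would be a block. -/
theorem Pattern.IsLocal.skeleton_eq_nil {A X : Type} {α : Pattern A X} (h : α.IsLocal 0) :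
    α.skeleton = [] := by
  obtain ⟨s, ⟨-, hs⟩, hb⟩ := h
  by_contra hne
  obtain ⟨x, hx⟩ := List.exists_mem_of_ne_nil _ hne
  have hpos : 1 ≤ s.length := List.length_pos_of_mem ((hs x).2 hx)
  have h1 := hb s.length hpos le_rfl
  rw [List.take_length, Nat.cast_zero, nonpos_iff_eq_zero, Set.encard_eq_zero] at h1
  have h2 : ((0, α.skeleton.length) : ℕ × ℕ) ∈ markedBlocks α.skeleton s := by
    refine ⟨List.length_pos_of_mem hx, le_rfl, fun j _ hj => ?_, Or.inl rfl, ?_⟩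
    · exact ⟨α.skeleton[j], (hs _).2 (List.getElem_mem _), List.getElem?_eq_getElem hj⟩
    · rintro ⟨y, -, hy⟩
      simp at hy
  rw [h1] at h2
  exact h2

theorem Input.pat_le_of_skeleton (I : Input) (c : ℕ) (h : I.pattern.skeleton = []) {j : ℕ}
    (hj : j < I.m) : (I.env c).pat j ≤ I.n := by
  rw [I.pat_eq c hj]
  have h1 : I.pattern[j]'hj ∈ I.pattern := List.getElem_mem _
  rw [Pattern.skeleton, List.filterMap_eq_nil_iff] at h
  have h2 := h _ h1
  revert h2
  rcases I.pattern[j]'hj with a | x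
  · intro _
    have := a.isLt
    have := I.alphabet_le
    simp only [Sum.elim_inl]
    omega
  · simp

/-- All lengths are `1`, so the only candidate is `P j = j`, and it is complete only for `m = n`. -/
theorem solveZeroCmd_spec (I : Input) {c : ℕ} (hc : 6 ≤ c) (h : I.pattern.IsLocal 0) (Δ : ℕ) :
    (I.env c).Answer ((solveZeroCmd.den (I.env c) (startSt Δ)).v 22) := by
  have hE := I.env_ok (c := c) hc
  have hpat : ∀ j < (I.env c).m, (I.env c).pat j ≤ (I.env c).n := fun j hj =>
    I.pat_le_of_skeleton c h.skeleton_eq_nil hj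
  set E := I.env c with hEd
  have hm := hE.m
  have hn := hE.pos
  have hMn : 2 * E.n + 2 < E.M := by
    have : (I.n + 2) ^ 2 ≤ (I.n + 2) ^ c := Nat.pow_le_pow_right (by omega) (by omega)
    have h1 : E.M = (I.n + 2) ^ c := rfl
    have h2 : E.n = I.n := rfl
    nlinarith
  have hlen : ∀ L, ∀ j < E.m, E.len L j = 1 := fun L j hj => if_neg (not_lt.2 (hpat j hj))
  have hP : ∀ L P, E.Full L P → ∀ j ≤ E.m, P j = j := by
    intro L P hF j hj
    induction j with
    | zero => exact hF.zero
    | succ j ih => rw [hF.succ j hj, hlen L j hj, ih (by omega)]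
  have hres : (solveZeroCmd.den E (startSt Δ)).v 22 = if E.n = E.m then
      (∑ j ∈ Finset.range E.m, if E.inp j ≠ E.pat j then 1 else 0) + 1 else 0 := by
    simp only [solveZeroCmd, den_block_cons, den_block_nil, den_assign, ev_zero, den_whenEq, ev_n,
      ev_m, ev_one]
    split_ifs with hnm
    · have hI := Cmd.loop_inv (E := E) (x := 3) (a := 0) (b := 1)
        (c := .whenNe (ip (vr 3)) (ip (.n + vr 3)) (.assign 22 (vr 22 + 1)))
        (s := ((startSt Δ).setV 22 0).setV 22 1) (fun J s' => s'.v 22 =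
          (∑ j ∈ Finset.range J, if E.inp j ≠ E.pat j then 1 else 0) + 1) (by simp) (by
        intro J hJ s' ih
        rw [E.lim_m] at hJ
        have hp := hE.ev_pat (by omega) hJ (s := s'.setV 3 J) (by simp)
        have hle : (∑ j ∈ Finset.range J, if E.inp j ≠ E.pat j then 1 else 0) ≤ J := by
          refine (Finset.sum_le_card_nsmul _ _ 1 fun j _ => ?_).trans (by simp)
          split_ifs <;> simp
        rw [Finset.sum_range_succ, den_whenNe, hp]
        simp only [ev_inp, ev_var, St.setV_v, if_true, Nat.mod_eq_of_lt (by omega : J < 2 * E.n),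
          den_assign, ev_add, ev_one, Nat.reduceEqDiff, if_false]
        by_cases hne : E.inp J ≠ E.pat J
        · rw [if_pos hne, if_pos hne]
          simp only [St.setV_v, if_true]
          rw [ih, Nat.mod_eq_of_lt (by omega)]
        · rw [if_neg hne, if_neg hne]
          simpa using ih)
      rwa [E.lim_m] at hI
    · simp
  have htot : ∀ L h P, E.Full L P → E.total L h P =
      ∑ j ∈ Finset.range E.m, if E.inp j ≠ E.pat j then 1 else 0 := by
    intro L h P hF
    refine Finset.sum_congr rfl fun j hj => ?_
    have hj := Finset.mem_range.1 hj
    rw [Env.err, if_neg (not_lt.2 (hpat j hj)), hP L P hF j hj.le]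
  refine ⟨fun L h P hF => ?_, fun hne => ?_⟩
  · have hnm : E.n = E.m := by rw [← hF.last, hP L P hF _ le_rfl]
    rw [hres, if_pos hnm, htot L h P hF]
    exact ⟨by omega, le_rfl⟩
  · rw [hres] at hne ⊢
    split_ifs at hne ⊢ with hnm
    · have hF : E.Full (fun _ => 0) id := ⟨rfl, hnm.symm, fun j hj => by rw [hlen _ j hj]; rfl⟩
      exact ⟨_, fun _ _ => 0, _, hF, by rw [htot _ _ _ hF]⟩
    · exact absurd rfl hne

end PatternMatching

namespace PatternMatching

/-! ## The two problems -/

def minCmd (solve : Cmd) : Cmd :=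
  block [solve, .ite (vr 22) 1 (.assign 30 (.n + 1)) (.assign 30 (vr 22 - 1))]

def decideCmd (solve : Cmd) : Cmd :=
  block [solve, .assign 30 0, .when 0 (vr 22) (.when (vr 22) (vr 0 + 2) (.assign 30 1))]

theorem Input.dist_le_of_answer (I : Input) {c d : ℕ} (hd : (I.env c).Answer d) (e : ℕ) :
    I.pattern.dist I.word ≤ e ↔ d ≠ 0 ∧ d ≤ e + 1 := by
  rw [I.dist_le_iff c]
  constructor
  · rintro ⟨L, h, P, hF, ht⟩
    obtain ⟨h1, h2⟩ := hd.least L h P hF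
    exact ⟨h1, by omega⟩
  · rintro ⟨h1, h2⟩
    obtain ⟨L, h, P, hF, ht⟩ := hd.attained h1
    exact ⟨L, h, P, hF, by omega⟩

theorem Input.minMisMatch_of_answer (I : Input) {c d : ℕ} (hd : (I.env c).Answer d) :
    I.minMisMatch = if d = 0 then I.n + 1 else d - 1 := by
  have h := I.dist_le_of_answer hd
  by_cases h0 : d = 0
  · rw [if_pos h0, Input.minMisMatch, if_pos]
    by_contra hne
    obtain ⟨e, he⟩ := ENat.ne_top_iff_exists.1 hne
    exact ((h e).1 he.ge).1 h0
  · have h1 : I.pattern.dist I.word = ((d - 1 : ℕ) : ℕ∞) := by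
      have h2 := (h (d - 1)).2 ⟨h0, by omega⟩
      obtain ⟨e, he⟩ := ENat.ne_top_iff_exists.1 (ne_top_of_le_ne_top (ENat.natCast_ne_top _) h2)
      have h3 := (h e).1 he.ge
      rw [← he] at h2 ⊢
      have h4 : e ≤ d - 1 := by exact_mod_cast h2
      rw [show e = d - 1 by omega]
    rw [if_neg h0, Input.minMisMatch, h1, if_neg (ENat.natCast_ne_top _), ENat.toNat_natCast]

theorem Input.misMatch_of_answer (I : Input) {c d : ℕ} (hd : (I.env c).Answer d) (Δ : ℕ) :
    I.misMatch Δ = if d ≠ 0 ∧ d ≤ Δ + 1 then 1 else 0 := by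
  unfold Input.misMatch
  exact if_congr (I.dist_le_of_answer hd Δ) rfl rfl

theorem minCmd_spec {I : Input} {c : ℕ} {solve : Cmd} {s : St} (hM : I.n + 1 < (I.env c).M)
    (hd : (I.env c).Answer ((solve.den (I.env c) s).v 22)) :
    ((minCmd solve).den (I.env c) s).v 30 = I.minMisMatch := by
  have hn : (I.env c).n = I.n := rfl
  rw [I.minMisMatch_of_answer hd]
  simp only [minCmd, den_block_cons, den_block_nil, den_ite, den_assign, ev_var, ev_one, ev_add,
    ev_sub, ev_n, hn, Nat.mod_eq_of_lt hM, Nat.lt_one_iff]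
  split_ifs <;> simp

theorem decideCmd_spec {I : Input} {c Δ : ℕ} {solve : Cmd} (hM : Δ + 2 < (I.env c).M)
    (h0 : solve.wv 0 = false)
    (hd : (I.env c).Answer ((solve.den (I.env c) (startSt Δ)).v 22)) :
    ((decideCmd solve).den (I.env c) (startSt Δ)).v 30 = I.misMatch Δ := by
  have h1 : (solve.den (I.env c) (startSt Δ)).v 0 = Δ := by
    rw [Cmd.den_v h0]
    rfl
  rw [I.misMatch_of_answer hd]
  simp only [decideCmd, den_block_cons, den_block_nil, den_when, den_assign, ev_var, ev_one, ev_zero,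
    ev_add, ev_two, St.setV_v, Nat.reduceEqDiff, if_false, h1, Nat.mod_eq_of_lt hM]
  set d := (solve.den (I.env c) (startSt Δ)).v 22 with hdd
  by_cases h2 : d = 0
  · simp [h2]
  · rw [if_pos (Nat.pos_of_ne_zero h2)]
    by_cases h3 : d ≤ Δ + 1
    · rw [if_pos (by omega), if_pos ⟨h2, h3⟩]
      simp
    · rw [if_neg (by omega), if_neg fun h => h3 h.2]
      simp

/-- As `n ≥ 1`, the inequality `n + 2 ≤ 3 * n` replaces the base `n + 2` by `n`. -/
theorem Cmd.Fits.steps_le {cmd : Cmd} {a : ℕ} (h : cmd.Fits a 1) (c : ℕ) :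
    ∃ C, ∀ I : Input, cmd.cost I.n I.m + c + 7 ≤ C * (I.n ^ a * I.m) := by
  obtain ⟨C, hC⟩ := h.cost_le
  refine ⟨C * 3 ^ a + (c + 7), fun I => ?_⟩
  have hm := I.m_pos
  have hn := I.m_le
  have h1 := hC I.n I.m hm
  have h2 : (I.n + 2) ^ a ≤ 3 ^ a * I.n ^ a := by
    rw [← mul_pow]
    exact Nat.pow_le_pow_left (by omega) a
  have h3 : 1 ≤ I.n ^ a * I.m := Nat.mul_pos (Nat.pow_pos (by omega)) hm
  calc cmd.cost I.n I.m + c + 7 ≤ C * ((I.n + 2) ^ a * I.m ^ 1) + (c + 7) * 1 := by omega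
    _ ≤ C * (3 ^ a * I.n ^ a * I.m) + (c + 7) * (I.n ^ a * I.m) := by
        rw [pow_one]
        gcongr
    _ = _ := by ring

theorem Outputs.mono {P : RAM.Program} {c : RAM.Config} {T T' B out : ℕ}
    (h : RAM.Outputs P c T B out) (hT : T ≤ T') : RAM.Outputs P c T' B out := by
  obtain ⟨t, ht, h⟩ := h
  exact ⟨t, ht.trans hT, h⟩

/-- A command that computes the table entry of the answer yields programs for both problems. -/
theorem solves_of_answer {k : ℕ} {solve : Cmd} (hfit : solve.Fits (2 * k + 2) 1)
    (h0 : solve.wv 0 = false) {c₀ : ℕ} (hc₀ : 6 ≤ c₀)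
    (hd : ∀ (I : Input) (c Δ : ℕ), c₀ ≤ c → I.pattern.IsLocal k →
      (I.env c).Answer ((solve.den (I.env c) (startSt Δ)).v 22)) :
    (∃ (P : RAM.Program) (C : ℕ),
      SolvesMinMisMatchLocal k P (fun n m => C * (n ^ (2 * k + 2) * m))) ∧
    (∃ (P : RAM.Program) (C : ℕ),
      SolvesMisMatchLocal k P (fun n m => C * (n ^ (2 * k + 2) * m))) := by
  constructor
  -- Large enough for the constants and loop exponents of the command and for the codes in `solve`.
  · obtain ⟨c, hc⟩ : ∃ c, c = (minCmd solve).maxc + 1 + c₀ := ⟨_, rfl⟩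
    obtain ⟨C, hC⟩ := Cmd.Fits.steps_le (cmd := minCmd solve) (a := 2 * k + 2)
      ⟨hfit, ⟨trivial, trivial⟩, trivial⟩ c
    refine ⟨(minCmd solve).program c 30, C, 2 * c, fun I hI => ?_⟩
    have hE := I.env_ok (c := c) (by omega)
    have hb : I.n + 2 < (I.env c).M := hE.base
    have := Outputs.mono ((minCmd solve).outputs_program 30 (c := c) (by omega) (by omega) I 0
      (Nat.zero_le _)) (hC I)
    rwa [minCmd_spec (by omega) (hd I c 0 (by omega) hI)] at this
  · obtain ⟨c, hc⟩ : ∃ c, c = (decideCmd solve).maxc + 1 + c₀ := ⟨_, rfl⟩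
    obtain ⟨C, hC⟩ := Cmd.Fits.steps_le (cmd := decideCmd solve) (a := 2 * k + 2)
      ⟨hfit, trivial, ⟨⟨trivial, trivial⟩, trivial⟩, trivial⟩ c
    refine ⟨(decideCmd solve).program c 30, C, 2 * c, fun I hI Δ hΔ => ?_⟩
    have hE := I.env_ok (c := c) (by omega)
    have hb : I.n + 2 < (I.env c).M := hE.base
    have := Outputs.mono ((decideCmd solve).outputs_program 30 (c := c) (by omega) (by omega) I Δ
      hΔ) (hC I)
    rwa [decideCmd_spec (by omega) h0 (hd I c Δ (by omega) hI)] at this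

/-- In the search as in the dynamic programme, `m` stages contain `(n + 2) ^ (2 * k + 1)` rounds of
`O(n)` steps. -/
theorem solveCmd_fits (k : ℕ) : (solveCmd k).Fits (2 * k + 2) 1 := by
  simp [solveCmd, ownerCmd, searchCmd, searchBody, encodeCmd, recordCmd, copyCmd, backCmd, dpCmd,
    dpStage, dpBody, dpTail, markCmd, walkCmd, walkBody, readCmd, jumpCmd, takeDigit, clipCmd,
    codeNewCmd, codeOldCmd, visitCmd, countCmd, countBody, updateCmd, block, Cmd.Fits, Cmd.when,
    Cmd.whenEq, Cmd.whenNe]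

theorem solveZeroCmd_fits : solveZeroCmd.Fits (2 * 0 + 2) 1 := by
  simp [solveZeroCmd, block, Cmd.Fits, Cmd.when, Cmd.whenEq, Cmd.whenNe]

end PatternMatching

theorem mainTheorem4 (k : ℕ) :
    (∃ (P : PatternMatching.RAM.Program) (C : ℕ),
      PatternMatching.SolvesMinMisMatchLocal k P (fun n m => C * (n ^ (2 * k + 2) * m))) ∧
    (∃ (P : PatternMatching.RAM.Program) (C : ℕ),
      PatternMatching.SolvesMisMatchLocal k P (fun n m => C * (n ^ (2 * k + 2) * m))) := by
  -- For `k = 0` a row of the table would have a single entry, and the one block of terminals would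
  -- already exceed `k`.
  rcases Nat.eq_zero_or_pos k with rfl | hk
  · exact PatternMatching.solves_of_answer PatternMatching.solveZeroCmd_fits rfl le_rfl
      fun I c Δ hc h => PatternMatching.solveZeroCmd_spec I hc h Δ
  · exact PatternMatching.solves_of_answer (PatternMatching.solveCmd_fits k) rfl
      (c₀ := 2 * k + 6) (by omega) fun I c Δ hc h => PatternMatching.solveCmd_spec I hk hc h Δ
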